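/- Let $m>0$, let $X_1<X_2<\dots<X_N$ be points of $\mathbb R$, and for $1\le J\le N$ let $U_J(z)=\sum_{n=0}^{p_J}u_{J,n}|z|^{2n}$, $z\in\mathbb C$, with $u_{J,n}\in\mathbb R$, $p_J\ge 2$, $u_{J,p_J}>0$, and let $F_J=-\nabla U_J$ (gradient with respect to $\operatorname{Re}z$ and $\operatorname{Im}z$). Let $\mathscr E=H^1(\mathbb R)\oplus L^2(\mathbb R)$ with the norm $\|(\psi,\pi)\|_{\mathscr E}^2=\|\pi\|_{L^2}^2+\|\psi'\|_{L^2}^2+m^2\|\psi\|_{L^2}^2$. Let $(\psi,\dot\psi)\in C(\mathbb R,\mathscr E)$ be a solution (in the sense of distributions) of $$\ddot\psi=\psi''-m^2\psi+\sum_{J=1}^N\delta(x-X_J)F_J(\psi(X_J,t)),\qquad x,t\in\mathbb R,$$ let $(\chi,\dot\chi)\in C(\mathbb R,\mathscr E)$ be the solution of the free equation $\ddot\chi=\chi''-m^2\chi$ with the same data at $t=0$, $(\chi,\dot\chi)|_{t=0}=(\psi,\dot\psi)|_{t=0}$, and put $\varphi=\psi-\chi$. Define $$\mu_1=m,\quad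 \mu_{J+1}=(2p_J-1)\mu_J;\qquad \mu'_N=m,\quad \mu'_J=(2p_{J+1}-1)\mu'_{J+1}\qquad(1\le J\le N-1);\qquad M_J=\min(\mu_J,\mu'_J).$$ Then for each $x\in\mathbb R$ the Fourier transform in time $\hat\varphi(x,\omega)=\int_{\mathbb R}e^{i\omega t}\varphi(x,t)\,dt$ is a well-defined tempered distribution of $\omega$, the one-sided derivatives $\hat\varTheta_J(\omega)=\partial_x\hat\varphi(X_J+0,\omega)$, $1\le J\le N-1$, exist as tempered distributions, and, with $\hat\varPhi_J(\omega)=\hat\varphi(X_J,\omega)$, the following holds. (1) $\hat\varPhi_J$, $1\le J\le N$, is absolutely continuous for $|\omega|>\mu_J$, and $\hat\varTheta_J$, $1\le J\le N-1$, is absolutely continuous for $|\omega|>(2p_J-1)\mu_J$; moreover, for any $\epsilon>0$, $$\int_{|\omega|>\mu_J+\epsilon}|\hat\varPhi_J(\omega)|^2\omega^2\,d\omega<\infty,\quad 1\le J\le N;\qquad \int_{|\omega|>(2p_J-1)\mu_J+\epsilon}|\hat\varTheta_J(\omega)|^2\,d\omega<\infty,\quad 1\le J\le N-1.$$ (2)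 $\hat\varPhi_J$, $1\le J\le N$, is absolutely continuous for $|\omega|>M_J$, and $\hat\varTheta_J$, $1\le J\le N-1$, is absolutely continuous for $|\omega|>(2p_J-1)M_J$. Here a distribution is called absolutely continuous for $|\omega|>a$ if its restriction to the open set $\{|\omega|>a\}$ is a locally integrable function. -/

import Mathlib

open MeasureTheory Set Filter Topology
open scoped SchwartzMap ContDiff ENNReal Gradient

noncomputable section

namespace KGOscillators

/-- Smooth compactly supported test functions on the line. -/
def IsTestFunction (ρ : ℝ → ℂ) : Prop :=
  ContDiff ℝ ∞ ρ ∧ HasCompactSupport ρ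

/-- `v` is the distributional derivative of `u` on the line. -/
def IsWeakDeriv (u v : ℝ → ℂ) : Prop :=
  ∀ ρ : ℝ → ℂ, IsTestFunction ρ → ∫ x, u x * deriv ρ x = -∫ x, v x * ρ x

/-- The square of the energy norm, `‖π‖² + ‖ψ'‖² + m² ‖ψ‖²` (norms of `L²(ℝ)`), written for a
field `fld = ψ`, its derivative `dfld = ψ'` and a momentum `mom = π`. -/
def energyNormSq (m : ℝ) (fld dfld mom : ℝ → ℂ) : ℝ≥0∞ :=
  ∫⁻ x, (‖mom x‖ₑ ^ 2 + ‖dfld x‖ₑ ^ 2 + ENNReal.ofReal (m ^ 2) * ‖fld x‖ₑ ^ 2)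

/-- A state of finite energy, `(ψ, π) ∈ H¹(ℝ) ⊕ L²(ℝ)`.  The element `ψ` of `H¹(ℝ)` is given by its
continuous representative `fld`, together with a representative `dfld` of its weak derivative. -/
structure EnergyState where
  fld : ℝ → ℂ
  dfld : ℝ → ℂ
  mom : ℝ → ℂ
  continuous_fld : Continuous fld
  memLp_fld : MemLp fld 2 volume
  memLp_dfld : MemLp dfld 2 volume
  isWeakDeriv : IsWeakDeriv fld dfld
  memLp_mom : MemLp mom 2 volume

/-- `Ψ ∈ C(ℝ, ℰ)`: continuity in time with respect to the energy norm. -/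
def ContinuousInEnergy (m : ℝ) (Ψ : ℝ → EnergyState) : Prop :=
  ∀ t : ℝ, Tendsto (fun s : ℝ => energyNormSq m ((Ψ s).fld - (Ψ t).fld)
    ((Ψ s).dfld - (Ψ t).dfld) ((Ψ s).mom - (Ψ t).mom)) (𝓝 t) (𝓝 0)

/-- `Ψ = (ψ, π) ∈ C(ℝ, ℰ)` solves `ψ̇ = π`, `π̇ = ψ'' - m² ψ + ∑_J δ(x - X_J) f_J(t)` in the sense
of distributions.  For `Ψ ∈ C(ℝ, ℰ)` and continuous `f_J` all pairings with a test function `ρ` of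
`x` are continuous in `t`, so that the time derivative of a pairing is a classical one. -/
structure SolvesForcedKG {N : ℕ} (m : ℝ) (X : Fin N → ℝ) (f : Fin N → ℝ → ℂ)
    (Ψ : ℝ → EnergyState) : Prop where
  continuousInEnergy : ContinuousInEnergy m Ψ
  hasDerivAt_fld : ∀ ρ : ℝ → ℂ, IsTestFunction ρ → ∀ t : ℝ,
    HasDerivAt (fun s : ℝ => ∫ x, (Ψ s).fld x * ρ x) (∫ x, (Ψ t).mom x * ρ x) t
  hasDerivAt_mom : ∀ ρ : ℝ → ℂ, IsTestFunction ρ → ∀ t : ℝ,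
    HasDerivAt (fun s : ℝ => ∫ x, (Ψ s).mom x * ρ x)
      ((∫ x, (Ψ t).fld x * deriv (deriv ρ) x) - (m : ℂ) ^ 2 * (∫ x, (Ψ t).fld x * ρ x)
        + ∑ J : Fin N, f J t * ρ (X J)) t

/-- The polynomial potential `U(z) = ∑_{n=0}^{p} u_n |z|^{2n}`. -/
def potential (p : ℕ) (u : ℕ → ℝ) (z : ℂ) : ℝ :=
  ∑ n ∈ Finset.range (p + 1), u n * ‖z‖ ^ (2 * n)

/-- The force `F = -∇U`, the gradient being taken with respect to `Re z` and `Im z`. -/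
def force (p : ℕ) (u : ℕ → ℝ) (z : ℂ) : ℂ :=
  -(∇ (potential p u) z)

/-- A finite energy solution `Ψ = (ψ, ψ̇) ∈ C(ℝ, ℰ)` of the Klein-Gordon equation coupled to the
oscillators, `ψ̈ = ψ'' - m² ψ + ∑_J δ(x - X_J) F_J(ψ(X_J, t))`. -/
def SolvesCoupledKG {N : ℕ} (m : ℝ) (X : Fin N → ℝ) (p : Fin N → ℕ) (u : Fin N → ℕ → ℝ)
    (Ψ : ℝ → EnergyState) : Prop :=
  SolvesForcedKG m X (fun J t => force (p J) (u J) ((Ψ t).fld (X J))) Ψ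

/-- A finite energy solution of the free Klein-Gordon equation `χ̈ = χ'' - m² χ`. -/
def SolvesFreeKG (m : ℝ) (Chi : ℝ → EnergyState) : Prop :=
  SolvesForcedKG (N := 0) m Fin.elim0 Fin.elim0 Chi

/-- Two states are the same element of `H¹(ℝ) ⊕ L²(ℝ)`. -/
def EnergyState.SameAs (Φ Ψ : EnergyState) : Prop :=
  Φ.fld = Ψ.fld ∧ Φ.mom =ᵐ[volume] Ψ.mom

/-- `μ_1 = m`, `μ_{J+1} = (2 p_J - 1) μ_J`, that is, `μ_J = m ∏_{K < J} (2 p_K - 1)`. -/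
def muLeft {N : ℕ} (m : ℝ) (p : Fin N → ℕ) (J : Fin N) : ℝ :=
  m * ∏ K ∈ Finset.Iio J, (2 * (p K : ℝ) - 1)

/-- `μ'_N = m`, `μ'_J = (2 p_{J+1} - 1) μ'_{J+1}`, that is, `μ'_J = m ∏_{K > J} (2 p_K - 1)`. -/
def muRight {N : ℕ} (m : ℝ) (p : Fin N → ℕ) (J : Fin N) : ℝ :=
  m * ∏ K ∈ Finset.Ioi J, (2 * (p K : ℝ) - 1)

/-- `M_J = min(μ_J, μ'_J)`. -/
def muMin {N : ℕ} (m : ℝ) (p : Fin N → ℕ) (J : Fin N) : ℝ :=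
  min (muLeft m p J) (muRight m p J)

/-- The Fourier transform `t ↦ ∫ e^{iωt} η(ω) dω` of a Schwartz function. -/
def fourierOfTest (η : 𝓢(ℝ, ℂ)) (t : ℝ) : ℂ :=
  ∫ ν : ℝ, Complex.exp (Complex.I * ν * t) * η ν

/-- The tempered distribution `T` is the Fourier transform `û(ω) = ∫ e^{iωt} u(t) dt` of the
function `u`, defined by duality: `⟨û, η⟩ = ⟨u, η̂⟩`. -/
def IsTimeFourier (u : ℝ → ℂ) (T : 𝓢'(ℝ, ℂ)) : Prop :=
  ∀ η : 𝓢(ℝ, ℂ), Integrable (fun t : ℝ => u t * fourierOfTest η t) ∧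
    T η = ∫ t : ℝ, u t * fourierOfTest η t

/-- On the open set `S` the distribution `T` is the locally integrable function `g`. -/
def HasDensityOn (T : 𝓢'(ℝ, ℂ)) (g : ℝ → ℂ) (S : Set ℝ) : Prop :=
  LocallyIntegrableOn g S ∧
    ∀ η : 𝓢(ℝ, ℂ), HasCompactSupport η → tsupport η ⊆ S → T η = ∫ ν in S, g ν * η ν

/-- The frequencies `|ω| > a`. -/
def highFreq (a : ℝ) : Set ℝ := {ν : ℝ | a < |ν|}

/-- The distribution `T` is absolutely continuous for `|ω| > a`. -/
def AbsContAbove (T : 𝓢'(ℝ, ℂ)) (a : ℝ) : Prop :=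
  ∃ g : ℝ → ℂ, HasDensityOn T g (highFreq a)

/-- The distribution `T` is absolutely continuous for `|ω| > a`, and its density `g` satisfies
`∫_{|ω| > a + ε} |g(ω)|² w(ω) dω < ∞` for every `ε > 0`. -/
def AbsContAboveWithBound (T : 𝓢'(ℝ, ℂ)) (a : ℝ) (w : ℝ → ℝ) : Prop :=
  ∃ g : ℝ → ℂ, HasDensityOn T g (highFreq a) ∧
    ∀ ε : ℝ, 0 < ε → IntegrableOn (fun ν : ℝ => ‖g ν‖ ^ 2 * w ν) (highFreq (a + ε))

/-- The family `x ↦ T x` of tempered distributions has the one-sided derivative `D` at `a + 0`. -/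
def HasRightDeriv (T : ℝ → 𝓢'(ℝ, ℂ)) (D : 𝓢'(ℝ, ℂ)) (a : ℝ) : Prop :=
  ∀ η : 𝓢(ℝ, ℂ), HasDerivWithinAt (fun x : ℝ => T x η) (D η) (Ioi a) a

end KGOscillators

end

open scoped FourierTransform Convolution NNReal

noncomputable section

namespace KGOscillators

/-! The bounds are proved for `ψ` and `χ` separately and subtracted at the end. Let `κ_n(t) =
κ_0(t/(n+1))` be cutoffs in time with spectrum in `|ν| ≤ 1/(n+1)` (`cutoff`), and let `s_n(x, ξ)` be
the Fourier transform in time of `κ_n ψ(x, ·)` (`cutFt`). As a function of `x` it solves `s'' = -(ξ²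
- m²) s + r_n - ∑ c_J δ(x - X_J)`, where `r_n` collects the terms in which a derivative falls on
`κ_n`, and `c_J` is the transform of the cut-off force (`integral_cutFt_deriv2`). For `|ξ| > m` this
equation is oscillatory in `x`: between oscillators the "sideways" energy density `|s'|² + (ξ² -
m²)|s|²` changes only through `r_n` (`Slopes.sideEnergy_le`).

On the half-line to the left of `X_1` this density is averaged over an interval of length `n + 1`
(`sideEnergy_average`). By Plancherel, its integral over all `x` and `ξ` is controlled by the energy
bound times norms of the cutoff, of order `n + 1`. Division by the length leaves a bound independent
of `n`. The error also stays bounded, since `‖κ_n'‖²` is of order `1/(n+1)` (`sideConst_cutoff_le`).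
So the one-sided derivative and the weighted field are bounded in `L²` above every frequency larger
than `m`.

Next an oscillator is crossed. A bounded field with square integrable spectrum above `a` is a
low-pass part plus an `L²` function (`lintegral_sub_lowPass_lt_top`). The force is a polynomial of
degree at most `2p - 1` in `z` and its conjugate, so it maps the low-pass part to a function with
spectrum in a ball of radius just above `(2p - 1) a`; it is locally Lipschitz, so the `L²` error
stays in `L²` (`EvBdd.force`). The jump of `s'` is minus the transformed force, hence each crossing
multiplies the threshold by `2p - 1`. Induction from the left gives `μ_J`, from the right `μ'_J`
(`evBdd_left`, `evBdd_right`). Bounds uniform in `n` pass to a weak limit, which is the density of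
the distribution (`EvBdd.exists_density`).

All this requires an energy bound uniform in time. Finite energy alone does not permit multiplying
the equation by `ψ̇` at `X_J`, so the solution is mollified in space. The sideways estimate on a
bounded time window shows that `ψ` near `X_J` is `H¹` in time
(`exists_lintegral_time_difference_le`). Therefore the mollified velocity at `X_J` is bounded in
`L²`, and the work of the force converges to the drop of potential (`tendsto_energy_balance`). Since
each `U_J` is bounded below, the energy is bounded.

The one-sided derivative of the transform is recovered from Taylor's formula with integral
remainder, the second derivative being eliminated by the equation (`taylor_slope`). -/

/-! ### The Fourier transform on the line: Plancherel, duality and inversion -/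

/-- The Fourier transform `ξ ↦ ∫ e^{iξt} u(t) dt` of an integrable function. -/
def ft (u : ℝ → ℂ) (ξ : ℝ) : ℂ := ∫ t : ℝ, Complex.exp (Complex.I * ξ * t) * u t

theorem fourierOfTest_eq_ft (η : 𝓢(ℝ, ℂ)) (t : ℝ) : fourierOfTest η t = ft η t := by
  simp only [fourierOfTest, ft]
  congr 1; ext ν; congr 2; ring

theorem ft_eq_fourier (u : ℝ → ℂ) (ξ : ℝ) : ft u ξ = 𝓕 u (-(2 * Real.pi)⁻¹ * ξ) := by
  rw [Real.fourier_real_eq_integral_exp_smul, ft]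
  congr 1; ext t
  rw [smul_eq_mul]
  congr 2
  have : (Real.pi : ℂ) ≠ 0 := by exact_mod_cast Real.pi_ne_zero
  push_cast
  field_simp

theorem lintegral_comp_mul_left (g : ℝ → ℝ≥0∞) {a : ℝ} (ha : a ≠ 0) :
    ∫⁻ x, g (a * x) = ENNReal.ofReal |a⁻¹| * ∫⁻ x, g x := by
  have h := (Homeomorph.mulLeft₀ a ha).measurableEmbedding.lintegral_map (μ := volume) g
  simp only [Homeomorph.coe_mulLeft₀] at h
  rw [Real.map_volume_mul_left ha, lintegral_smul_measure] at h
  exact h.symm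

theorem continuous_fourier_of_integrable {u : ℝ → ℂ} (hu : Integrable u) : Continuous (𝓕 u) :=
  VectorFourier.fourierIntegral_continuous Real.continuous_fourierChar (by fun_prop) hu

theorem integral_fourier_smul_flip {f u : ℝ → ℂ} (hf : Integrable f) (hu : Integrable u) :
    ∫ x, (𝓕 f) x • u x = ∫ x, f x • (𝓕 u) x := by
  have := VectorFourier.integral_fourierIntegral_smul_eq_flip (L := innerₗ ℝ) (μ := volume)
    (ν := volume) Real.continuous_fourierChar (by fun_prop) hf hu
  simp only [flip_innerₗ] at this
  exact this

/-- The `L²` transform is compatible with the transform of tempered distributions, which is defined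
by this very duality. -/
theorem integral_fourier_toLp {u : ℝ → ℂ} (h2 : MemLp u 2) (G : 𝓢(ℝ, ℂ)) :
    ∫ x, (𝓕 G) x • (h2.toLp u : Lp ℂ 2 (volume : Measure ℝ)) x
      = ∫ x, G x • (𝓕 (h2.toLp u : Lp ℂ 2 (volume : Measure ℝ)) :
          Lp ℂ 2 (volume : Measure ℝ)) x := by
  have h0 := congrArg (fun T : 𝓢'(ℝ, ℂ) => T G)
    (Lp.fourier_toTemperedDistribution_eq (h2.toLp u))
  simp only [TemperedDistribution.fourier_apply, Lp.toTemperedDistribution_apply] at h0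
  exact h0

theorem exists_schwartz {g : ℝ → ℂ} (hg : ContDiff ℝ ∞ g) (hgs : HasCompactSupport g) :
    ∃ G : 𝓢(ℝ, ℂ), ∀ x, G x = g x := ⟨hgs.toSchwartzMap hg, fun _ => rfl⟩

theorem contDiff_ofReal_comp {g : ℝ → ℝ} (hg : ContDiff ℝ ∞ g) :
    ContDiff ℝ ∞ (fun x => (g x : ℂ)) := Complex.ofRealCLM.contDiff.comp hg

theorem hasCompactSupport_ofReal_comp {g : ℝ → ℝ} (hg : HasCompactSupport g) :
    HasCompactSupport (fun x => (g x : ℂ)) :=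
  hg.comp_left (g := Complex.ofReal) Complex.ofReal_zero

/-- Both transforms have the same pairing with every smooth compactly supported function: the `L²`
one by duality of tempered distributions, the integral one by Fubini. This lets Plancherel be used
with the pointwise formula. -/
theorem fourier_ae_eq {u : ℝ → ℂ} (hu : Integrable u) (h2 : MemLp u 2) :
    ⇑(𝓕 (h2.toLp u : Lp ℂ 2 (volume : Measure ℝ)) : Lp ℂ 2 (volume : Measure ℝ))
      =ᵐ[volume] (𝓕 u : ℝ → ℂ) := by
  have hc : Continuous (𝓕 u : ℝ → ℂ) := continuous_fourier_of_integrable hu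
  refine ae_eq_of_integral_contDiff_smul_eq ?_ hc.locallyIntegrable ?_
  · exact (Lp.memLp _).locallyIntegrable (by norm_num)
  intro g hg hgs
  obtain ⟨G, hG'⟩ := exists_schwartz (contDiff_ofReal_comp hg)
    (hasCompactSupport_ofReal_comp hgs)
  have h := integral_fourier_toLp h2 G
  have hG : ∀ (x : ℝ) (z : ℂ), G x • z = g x • z := fun x z => by
    rw [Complex.real_smul, hG', smul_eq_mul]
  simp only [hG] at h
  rw [← h]
  have e2 : ∫ x, (𝓕 G) x • (h2.toLp u : Lp ℂ 2 (volume : Measure ℝ)) x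
      = ∫ x, (𝓕 G) x • u x := by
    refine integral_congr_ae ?_
    filter_upwards [h2.coeFn_toLp] with x hx
    rw [hx]
  rw [e2, SchwartzMap.fourier_coe, integral_fourier_smul_flip G.integrable hu]
  simp only [hG]

theorem lintegral_fourier_sq {u : ℝ → ℂ} (hu : Integrable u) (h2 : MemLp u 2) :
    ∫⁻ ξ, ‖𝓕 u ξ‖ₑ ^ 2 = ∫⁻ t, ‖u t‖ₑ ^ 2 := by
  have h := Lp.norm_fourier_eq (h2.toLp u : Lp ℂ 2 (volume : Measure ℝ))
  rw [Lp.norm_def, Lp.norm_def] at h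
  have h' : eLpNorm (𝓕 u : ℝ → ℂ) 2 volume = eLpNorm u 2 volume := by
    rw [← eLpNorm_congr_ae (fourier_ae_eq hu h2), ← eLpNorm_congr_ae h2.coeFn_toLp]
    exact (ENNReal.toReal_eq_toReal_iff' (Lp.eLpNorm_ne_top _) (Lp.eLpNorm_ne_top _)).1 h
  have h3 := congrArg (fun x : ℝ≥0∞ => x ^ (2 : ℕ)) h'
  rw [eLpNorm_eq_lintegral_rpow_enorm_toReal (by norm_num) (by norm_num),
    eLpNorm_eq_lintegral_rpow_enorm_toReal (by norm_num) (by norm_num)] at h3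
  simp only [← ENNReal.rpow_natCast, ← ENNReal.rpow_mul] at h3
  simpa using h3

/-- Plancherel's identity. -/
theorem lintegral_ft_sq {u : ℝ → ℂ} (hu : Integrable u) (h2 : MemLp u 2) :
    ∫⁻ ξ, ‖ft u ξ‖ₑ ^ 2 = ENNReal.ofReal (2 * Real.pi) * ∫⁻ t, ‖u t‖ₑ ^ 2 := by
  simp_rw [ft_eq_fourier]
  have hp : (0:ℝ) < 2 * Real.pi := by positivity
  rw [lintegral_comp_mul_left (fun x => ‖𝓕 u x‖ₑ ^ 2) (neg_ne_zero.2 (inv_ne_zero hp.ne')),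
    lintegral_fourier_sq hu h2]
  congr 2
  rw [inv_neg, abs_neg, inv_inv, abs_of_pos hp]

theorem norm_exp_I_mul (ξ t : ℝ) : ‖Complex.exp (Complex.I * ξ * t)‖ = 1 := by
  rw [show Complex.I * ξ * t = ((ξ * t : ℝ) : ℂ) * Complex.I by push_cast; ring]
  exact Complex.norm_exp_ofReal_mul_I _

theorem integrable_exp_mul {u : ℝ → ℂ} (hu : Integrable u) (ξ : ℝ) :
    Integrable (fun t : ℝ => Complex.exp (Complex.I * ξ * t) * u t) := by
  refine hu.bdd_mul (c := 1) (by fun_prop) ?_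
  exact ae_of_all _ fun t => (norm_exp_I_mul ξ t).le

theorem norm_ft_le (u : ℝ → ℂ) (ξ : ℝ) : ‖ft u ξ‖ ≤ ∫ t, ‖u t‖ := by
  refine (norm_integral_le_integral_norm _).trans (le_of_eq ?_)
  congr 1; ext t
  rw [norm_mul, norm_exp_I_mul, one_mul]

theorem continuous_ft {u : ℝ → ℂ} (hu : Integrable u) : Continuous (ft u) := by
  have : ft u = fun ξ => 𝓕 u (-(2 * Real.pi)⁻¹ * ξ) := funext (ft_eq_fourier u)
  rw [this]
  exact (continuous_fourier_of_integrable hu).comp (by fun_prop)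

theorem ft_add {u v : ℝ → ℂ} (hu : Integrable u) (hv : Integrable v) (ξ : ℝ) :
    ft (fun t => u t + v t) ξ = ft u ξ + ft v ξ := by
  simp only [ft, mul_add]
  exact integral_add (integrable_exp_mul hu ξ) (integrable_exp_mul hv ξ)

theorem ft_sub {u v : ℝ → ℂ} (hu : Integrable u) (hv : Integrable v) (ξ : ℝ) :
    ft (fun t => u t - v t) ξ = ft u ξ - ft v ξ := by
  simp only [ft, mul_sub]
  exact integral_sub (integrable_exp_mul hu ξ) (integrable_exp_mul hv ξ)

theorem ft_const_mul (c : ℂ) (u : ℝ → ℂ) (ξ : ℝ) :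
    ft (fun t => c * u t) ξ = c * ft u ξ := by
  simp only [ft]
  rw [← integral_const_mul]
  congr 1; ext t; ring

theorem ft_comp_add (u : ℝ → ℂ) (h ξ : ℝ) :
    ft (fun t => u (t + h)) ξ = Complex.exp (-(Complex.I * ξ * h)) * ft u ξ := by
  simp only [ft]
  rw [← integral_add_right_eq_self (fun t : ℝ => Complex.exp (Complex.I * ξ * t) * u t) h,
    ← integral_const_mul]
  congr 1; ext t
  rw [← mul_assoc, ← Complex.exp_add]
  congr 2; push_cast; ring

/-- Duality: `∫ û v = ∫ u v̂`. -/
theorem integral_ft_mul {u v : ℝ → ℂ} (hu : Integrable u) (hv : Integrable v) :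
    ∫ ξ, ft u ξ * v ξ = ∫ t, u t * ft v t := by
  simp only [ft, ← integral_mul_const, ← integral_const_mul]
  rw [integral_integral_swap]
  · congr 1; ext t; congr 1; ext ξ; 
    rw [show Complex.I * (ξ:ℂ) * t = Complex.I * t * ξ by ring]; ring
  · have h := (hv.mul_prod hu)
    have : (Function.uncurry fun ξ t : ℝ => Complex.exp (Complex.I * ξ * t) * u t * v ξ)
      = fun p : ℝ × ℝ => Complex.exp (Complex.I * p.1 * p.2) * (v p.1 * u p.2) := by
      ext p; simp only [Function.uncurry]; ring
    rw [this]
    refine h.bdd_mul (c := 1) (by fun_prop) ?_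
    exact ae_of_all _ fun t => (norm_exp_I_mul _ _).le

/-- The Fourier transform as a map of Schwartz functions. -/
def ftS : 𝓢(ℝ, ℂ) →L[ℂ] 𝓢(ℝ, ℂ) :=
  (SchwartzMap.compCLMOfContinuousLinearEquiv ℂ (ContinuousLinearEquiv.unitsEquivAut ℝ
    (Units.mk0 (-(2 * Real.pi)⁻¹) (by simp [Real.pi_ne_zero])))).comp
    (FourierTransform.fourierCLM ℂ 𝓢(ℝ, ℂ))

theorem ftS_apply (η : 𝓢(ℝ, ℂ)) (t : ℝ) : ftS η t = ft η t := by
  rw [ft_eq_fourier, ← SchwartzMap.fourier_coe]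
  simp [ftS, mul_comm]

theorem coe_ftS (η : 𝓢(ℝ, ℂ)) : ⇑(ftS η) = ft η := funext (ftS_apply η)

theorem ftS_eq_fourierOfTest (η : 𝓢(ℝ, ℂ)) (t : ℝ) : ftS η t = fourierOfTest η t := by
  rw [ftS_apply, fourierOfTest_eq_ft]

/-- Fourier inversion for Schwartz functions. -/
theorem integral_ft_eq (η : 𝓢(ℝ, ℂ)) (ν : ℝ) :
    ∫ t : ℝ, Complex.exp (-(Complex.I * ν * t)) * ft η t = 2 * Real.pi * η ν := by
  have h : 𝓕⁻ (𝓕 η) = η := by simp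
  have h1 := DFunLike.congr_fun h ν
  rw [SchwartzMap.fourierInv_coe, Real.fourierInv_eq_fourier_neg] at h1
  rw [Real.fourier_real_eq_integral_exp_smul] at h1
  rw [← h1]
  have hp : (0:ℝ) < 2 * Real.pi := by positivity
  simp_rw [ft_eq_fourier, ← SchwartzMap.fourier_coe]
  have := Measure.integral_comp_mul_left (fun s : ℝ => 
    Complex.exp ((2 * Real.pi : ℝ) * Complex.I * ν * s) * (𝓕 η) s) (-(2 * Real.pi)⁻¹)
  rw [inv_neg, abs_neg, inv_inv, abs_of_pos hp] at this
  have e : (2 * (Real.pi:ℂ)) * ∫ v : ℝ, Complex.exp (↑(-2 * Real.pi * v * -ν) * Complex.I) • (𝓕 η) v = (2 * Real.pi : ℝ) •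
    ∫ s : ℝ, Complex.exp ((2 * Real.pi : ℝ) * Complex.I * ν * s) * (𝓕 η) s := by
    rw [Complex.real_smul]; push_cast
    congr 2; ext v; rw [smul_eq_mul]; congr 2; ring
  rw [e, ← this]
  congr 1; ext t
  congr 2
  have : (Real.pi : ℂ) ≠ 0 := by exact_mod_cast Real.pi_ne_zero
  push_cast
  field_simp

/-! ### Cauchy–Schwarz and translation estimates -/

theorem lintegral_mul_sq_le {α : Type*} [MeasurableSpace α] {μ : Measure α} {f g : α → ℝ≥0∞}
    (hf : AEMeasurable f μ) (hg : AEMeasurable g μ) :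
    (∫⁻ a, f a * g a ∂μ) ^ 2 ≤ (∫⁻ a, f a ^ 2 ∂μ) * ∫⁻ a, g a ^ 2 ∂μ := by
  have h := ENNReal.lintegral_mul_le_Lp_mul_Lq μ Real.HolderConjugate.two_two hf hg
  have h2 := pow_le_pow_left₀ zero_le h 2
  simp only [Pi.mul_apply] at h2
  refine h2.trans (le_of_eq ?_)
  rw [mul_pow, ← ENNReal.rpow_natCast, ← ENNReal.rpow_natCast, ← ENNReal.rpow_mul,
    ← ENNReal.rpow_mul]
  norm_num

theorem lintegral_sq_le_mul {s : Set ℝ} {f : ℝ → ℝ≥0∞} (hf : AEMeasurable f (volume.restrict s)) :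
    (∫⁻ a in s, f a) ^ 2 ≤ volume s * ∫⁻ a in s, f a ^ 2 := by
  have h := lintegral_mul_sq_le (μ := volume.restrict s) (f := fun _ => 1) (g := f)
    aemeasurable_const hf
  simpa using h

theorem enorm_add_sq_le {E : Type*} [NormedAddCommGroup E] (a b : E) :
    ‖a + b‖ₑ ^ 2 ≤ 2 * ‖a‖ₑ ^ 2 + 2 * ‖b‖ₑ ^ 2 := by
  refine (pow_le_pow_left₀ zero_le (enorm_add_le a b) 2).trans ?_
  rw [← mul_add]
  simp only [enorm_eq_nnnorm]
  norm_cast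
  exact add_sq_le

theorem enorm_sub_sq_le {E : Type*} [NormedAddCommGroup E] (a b : E) :
    ‖a - b‖ₑ ^ 2 ≤ 2 * ‖a‖ₑ ^ 2 + 2 * ‖b‖ₑ ^ 2 := by
  rw [sub_eq_add_neg]
  simpa using enorm_add_sq_le a (-b)

/-- Cauchy–Schwarz on the interval of length `h`, then Tonelli and translation invariance; the two
factors `h` come from these two steps. -/
theorem lintegral_translation_sq_le {g v : ℝ → ℂ} (hv : AEStronglyMeasurable v volume) {h : ℝ}
    (hh : 0 ≤ h) (hg : ∀ x, g (x + h) - g x = ∫ s in (0)..h, v (x + s)) :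
    ∫⁻ x, ‖g (x + h) - g x‖ₑ ^ 2 ≤ ENNReal.ofReal (h ^ 2) * ∫⁻ x, ‖v x‖ₑ ^ 2 := by
  have hv2 : AEMeasurable (fun p : ℝ × ℝ => ‖v (p.1 + p.2)‖ₑ ^ 2)
      (volume.prod (volume.restrict (Ioc 0 h))) := by
    have h1 : AEMeasurable (fun p : ℝ × ℝ => ‖v (p.1 + p.2)‖ₑ ^ 2) (volume.prod volume) := by
      have := (hv.enorm.pow_const 2).comp_quasiMeasurePreserving
        (quasiMeasurePreserving_add volume volume)
      exact this
    refine h1.mono_ac ?_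
    exact Measure.AbsolutelyContinuous.rfl.prod Measure.absolutelyContinuous_restrict
  have hvx : ∀ x, AEMeasurable (fun s => ‖v (x + s)‖ₑ) volume := fun x =>
    (hv.enorm).comp_quasiMeasurePreserving
      (measurePreserving_add_left volume x).quasiMeasurePreserving
  calc ∫⁻ x, ‖g (x + h) - g x‖ₑ ^ 2
      ≤ ∫⁻ x, ENNReal.ofReal h * ∫⁻ s in Ioc 0 h, ‖v (x + s)‖ₑ ^ 2 := by
        refine lintegral_mono fun x => ?_
        rw [hg x, intervalIntegral.integral_of_le hh]
        refine (pow_le_pow_left₀ zero_le (enorm_integral_le_lintegral_enorm _) 2).trans ?_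
        have := lintegral_sq_le_mul (s := Ioc 0 h) (hvx x).restrict
        rwa [Real.volume_Ioc, sub_zero] at this
    _ = ENNReal.ofReal h * ∫⁻ x, ∫⁻ s in Ioc 0 h, ‖v (x + s)‖ₑ ^ 2 :=
        lintegral_const_mul' _ _ ENNReal.ofReal_ne_top
    _ = ENNReal.ofReal h * ∫⁻ s in Ioc 0 h, ∫⁻ x, ‖v (x + s)‖ₑ ^ 2 := by
        rw [lintegral_lintegral_swap hv2]
    _ = ENNReal.ofReal h * ∫⁻ s in Ioc 0 h, ∫⁻ x, ‖v x‖ₑ ^ 2 := by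
        congr 1
        refine lintegral_congr fun s => ?_
        exact lintegral_add_right_eq_self (fun x => ‖v x‖ₑ ^ 2) s
    _ = ENNReal.ofReal (h ^ 2) * ∫⁻ x, ‖v x‖ₑ ^ 2 := by
        rw [lintegral_const, Measure.restrict_apply_univ, Real.volume_Ioc, sub_zero, sq,
          ENNReal.ofReal_mul hh]
        ring

/-! ### Test functions and mollifiers -/

theorem IsTestFunction.deriv {ρ : ℝ → ℂ} (hρ : IsTestFunction ρ) : IsTestFunction (deriv ρ) :=
  ⟨(contDiff_infty_iff_deriv.1 hρ.1).2, hρ.2.deriv⟩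

theorem IsTestFunction.continuous {ρ : ℝ → ℂ} (hρ : IsTestFunction ρ) : Continuous ρ :=
  hρ.1.continuous

theorem IsTestFunction.hasDerivAt {ρ : ℝ → ℂ} (hρ : IsTestFunction ρ) (x : ℝ) :
    HasDerivAt ρ (_root_.deriv ρ x) x :=
  (hρ.1.differentiable (by simp) x).hasDerivAt

theorem IsTestFunction.memLp {ρ : ℝ → ℂ} (hρ : IsTestFunction ρ) (q : ℝ≥0∞) :
    MemLp ρ q volume := hρ.continuous.memLp_of_hasCompactSupport hρ.2

theorem IsTestFunction.integrable {ρ : ℝ → ℂ} (hρ : IsTestFunction ρ) : Integrable ρ :=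
  hρ.continuous.integrable_of_hasCompactSupport hρ.2

theorem IsTestFunction.integrable_mul {ρ g : ℝ → ℂ} (hρ : IsTestFunction ρ)
    (hg : LocallyIntegrable g) : Integrable (fun x => g x * ρ x) := by
  have := hg.integrable_smul_left_of_hasCompactSupport hρ.continuous hρ.2
  simpa [mul_comm] using this

theorem IsTestFunction.comp_sub {ρ : ℝ → ℂ} (hρ : IsTestFunction ρ) (x : ℝ) :
    IsTestFunction (fun y => ρ (x - y)) :=
  ⟨hρ.1.comp (by fun_prop), hρ.2.comp_homeomorph (Homeomorph.subLeft x)⟩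

theorem deriv_comp_sub' (ρ : ℝ → ℂ) (x : ℝ) :
    deriv (fun y => ρ (x - y)) = fun y => -deriv ρ (x - y) := by
  ext y
  exact deriv_comp_const_sub ρ x y

theorem isTestFunction_ofReal {g : ℝ → ℝ} (hg : ContDiff ℝ ∞ g) (hgs : HasCompactSupport g) :
    IsTestFunction (fun x => (g x : ℂ)) :=
  ⟨contDiff_ofReal_comp hg, hasCompactSupport_ofReal_comp hgs⟩

/-- A sequence of bump functions concentrating at the origin. -/
def bump (n : ℕ) : ContDiffBump (0 : ℝ) where
  rIn := 1 / (2 * (n + 1))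
  rOut := 1 / (n + 1)
  rIn_pos := by positivity
  rIn_lt_rOut := by
    apply one_div_lt_one_div_of_lt <;> [positivity; skip]
    have : (0:ℝ) ≤ n := n.cast_nonneg
    linarith

theorem bump_rOut_tendsto : Tendsto (fun n => (bump n).rOut) atTop (𝓝 0) :=
  tendsto_one_div_add_atTop_nhds_zero_nat

/-- The mollifier attached to `bump n`. -/
def moll (n : ℕ) (x : ℝ) : ℂ := ((bump n).normed volume x : ℝ)

theorem isTestFunction_moll (n : ℕ) : IsTestFunction (moll n) :=
  isTestFunction_ofReal (bump n).contDiff_normed (bump n).hasCompactSupport_normed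

theorem moll_neg (n : ℕ) (x : ℝ) : moll n (-x) = moll n x := by
  simp [moll, ContDiffBump.normed_neg]

theorem integral_moll (n : ℕ) : ∫ x, moll n x = 1 := by
  simp only [moll]
  rw [integral_complex_ofReal, (bump n).integral_normed]; simp

theorem lintegral_moll (n : ℕ) : ∫⁻ x, ‖moll n x‖ₑ = 1 := by
  have h : ∀ x, ‖moll n x‖ₑ = ENNReal.ofReal ((bump n).normed volume x) := fun x => by
    rw [moll, ← ofReal_norm, Complex.norm_real, Real.norm_of_nonneg ((bump n).nonneg_normed x)]
  simp_rw [h]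
  rw [← ofReal_integral_eq_lintegral_ofReal (bump n).integrable_normed
    (ae_of_all _ (bump n).nonneg_normed), (bump n).integral_normed, ENNReal.ofReal_one]

theorem moll_eq_zero {n : ℕ} {x : ℝ} (h : (1 / (n + 1) : ℝ) ≤ |x|) : moll n x = 0 := by
  have : x ∉ Function.support ((bump n).normed volume) := by
    rw [(bump n).support_normed_eq]
    simpa [bump] using h
  simp only [Function.mem_support, not_not] at this
  simp [moll, this]

/-- Convolution `(g * ρ)(x) = ∫ g(y) ρ(x - y) dy`. -/
def conv (g ρ : ℝ → ℂ) (x : ℝ) : ℂ := ∫ y, g y * ρ (x - y)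

theorem conv_eq_convolution (g ρ : ℝ → ℂ) :
    conv g ρ = (ρ ⋆[ContinuousLinearMap.lsmul ℝ ℂ] g : ℝ → ℂ) := by
  ext x
  rw [convolution_eq_swap, conv]
  congr 1; ext y
  simp [mul_comm]

theorem conv_moll_eq (g : ℝ → ℂ) (n : ℕ) :
    conv g (moll n) = ((bump n).normed volume ⋆[ContinuousLinearMap.lsmul ℝ ℝ] g : ℝ → ℂ) := by
  ext x
  rw [convolution_eq_swap, conv]
  congr 1; ext y
  simp [moll, mul_comm]

theorem hasDerivAt_conv {g ρ : ℝ → ℂ} (hg : LocallyIntegrable g) (hρ : IsTestFunction ρ) (x : ℝ) :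
    HasDerivAt (conv g ρ) (conv g (deriv ρ) x) x := by
  rw [conv_eq_convolution, conv_eq_convolution]
  have := HasCompactSupport.hasDerivAt_convolution_left (μ := volume)
    (ContinuousLinearMap.lsmul ℝ ℂ : ℂ →L[ℝ] ℂ →L[ℝ] ℂ) hρ.2 (hρ.1.of_le (by simp)) hg x
  exact this

theorem continuous_conv {g ρ : ℝ → ℂ} (hg : LocallyIntegrable g) (hρ : IsTestFunction ρ) :
    Continuous (conv g ρ) :=
  continuous_iff_continuousAt.2 fun x => (hasDerivAt_conv hg hρ x).continuousAt

theorem tendsto_conv_moll {g : ℝ → ℂ} (hg : Continuous g) (x : ℝ) :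
    Tendsto (fun n => conv g (moll n) x) atTop (𝓝 (g x)) := by
  simp_rw [conv_moll_eq]
  exact ContDiffBump.convolution_tendsto_right_of_continuous bump_rOut_tendsto hg x

theorem ae_tendsto_conv_moll {g : ℝ → ℂ} (hg : LocallyIntegrable g) :
    ∀ᵐ x, Tendsto (fun n => conv g (moll n) x) atTop (𝓝 (g x)) := by
  simp_rw [conv_moll_eq]
  refine ContDiffBump.ae_convolution_tendsto_right_of_locallyIntegrable (K := 2) bump_rOut_tendsto
    (Eventually.of_forall fun n => ?_) hg
  simp only [bump]
  have : (n:ℝ) + 1 ≠ 0 := by positivity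
  apply le_of_eq; field_simp

/-- A continuous function whose second distributional derivative vanishes is affine. -/
theorem affine_of_weak_deriv2_eq_zero {w : ℝ → ℂ} (hw : Continuous w)
    (h : ∀ ρ, IsTestFunction ρ → ∫ x, w x * deriv (deriv ρ) x = 0) :
    ∀ x : ℝ, w x = w 0 + x * (w 1 - w 0) := by
  -- After mollification the second derivative is a classical one and vanishes, so the mollified
  -- function is affine; this form determines it by its values at 0 and 1 and survives the pointwise
  -- limit.
  have key : ∀ (n : ℕ) (x : ℝ), conv w (moll n) x = conv w (moll n) 0 +
      x * (conv w (moll n) 1 - conv w (moll n) 0) := by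
    intro n
    have hm := isTestFunction_moll n
    have h1 : ∀ x, HasDerivAt (conv w (deriv (moll n))) 0 x := by
      intro x
      have := hasDerivAt_conv hw.locallyIntegrable hm.deriv x
      have h0 : conv w (deriv (deriv (moll n))) x = 0 := by
        have h2 := h _ (hm.comp_sub x)
        rw [deriv_comp_sub'] at h2
        have h3 : deriv (fun y => -deriv (moll n) (x - y))
            = fun y => deriv (deriv (moll n)) (x - y) := by
          ext y
          rw [deriv.fun_neg, deriv_comp_const_sub, neg_neg]
        rw [h3] at h2
        exact h2
      rwa [h0] at this
    obtain ⟨c, hc⟩ : ∃ c, ∀ x, conv w (deriv (moll n)) x = c :=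
      ⟨_, fun x => is_const_of_deriv_eq_zero (fun x => (h1 x).differentiableAt)
        (fun x => (h1 x).deriv) x 0⟩
    have h2 : ∀ x : ℝ, HasDerivAt (fun x : ℝ => conv w (moll n) x - x * c) 0 x := by
      intro x
      have h3 := hasDerivAt_conv hw.locallyIntegrable hm x
      rw [hc] at h3
      have h4 : HasDerivAt (fun x : ℝ => (x : ℂ) * c) c x := by
        simpa using (Complex.ofRealCLM.hasDerivAt (x := x)).mul_const c
      simpa using h3.fun_sub h4
    have h3 : ∀ x y : ℝ, conv w (moll n) x - x * c = conv w (moll n) y - y * c := fun x y =>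
      is_const_of_deriv_eq_zero (fun x => (h2 x).differentiableAt)
        (fun x => (h2 x).deriv) x y
    intro x
    have e1 := h3 x 0
    have e2 := h3 1 0
    push_cast at e1 e2
    linear_combination e1 - x * e2
  intro x
  have hl := tendsto_conv_moll hw x
  have hr := (tendsto_conv_moll hw 0).add
    (((tendsto_conv_moll hw 1).sub (tendsto_conv_moll hw 0)).const_mul (x : ℂ))
  refine tendsto_nhds_unique hl (hr.congr fun n => (key n x).symm)

theorem memLp_two_locallyIntegrable {v : ℝ → ℂ} (hv : MemLp v 2 volume) : LocallyIntegrable v :=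
  hv.locallyIntegrable (by norm_num)

theorem MemLp.lintegral_sq_lt_top {v : ℝ → ℂ} (hv : MemLp v 2 volume) :
    ∫⁻ x, ‖v x‖ₑ ^ 2 < ⊤ := by
  have := lintegral_rpow_enorm_lt_top_of_eLpNorm_lt_top (by norm_num) (by norm_num) hv.2
  simpa using this

theorem integral_conv_moll {v : ℝ → ℂ} (hv : LocallyIntegrable v) {a b : ℝ} (hab : a ≤ b) (n : ℕ) :
    ∫ x in a..b, conv v (moll n) x = conv (fun t => ∫ x in a..b, v (x + t)) (moll n) 0 := by
  have hm := isTestFunction_moll n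
  have e1 : ∀ x, conv v (moll n) x = ∫ t, v (x + t) * moll n t := by
    intro x
    rw [conv, ← integral_add_left_eq_self (fun y => v y * moll n (x - y)) x]
    congr 1; ext t
    rw [show x - (x + t) = -t by ring, moll_neg]
  have e2 : ∀ t, (∫ x in a..b, v (x + t)) * moll n (0 - t) =
      ∫ x in a..b, v (x + t) * moll n t := by
    intro t
    rw [zero_sub, moll_neg, intervalIntegral.integral_mul_const]
  simp_rw [e1]
  rw [conv]
  simp_rw [e2, intervalIntegral.integral_of_le hab]
  rw [integral_integral_swap]
  have hint : IntegrableOn v (Icc (a - 1) (b + 1)) := hv.integrableOn_isCompact isCompact_Icc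
  -- Only local integrability is available. The mollifier is supported in `|t| ≤ 1`, so `v` may be
  -- truncated to `[a - 1, b + 1]` before Fubini is applied.
  set w : ℝ → ℂ := (Icc (a - 1) (b + 1)).indicator v with hw
  have hwi : Integrable w := (integrable_indicator_iff measurableSet_Icc).2 hint
  have h1 : Integrable (fun p : ℝ × ℝ => w (p.1 + p.2) * moll n p.2) (volume.prod volume) := by
    have h2 : Integrable (fun p : ℝ × ℝ => w p.1 * moll n p.2) (volume.prod volume) :=
      hwi.mul_prod hm.integrable
    have h3 := (measurePreserving_add_prod (volume : Measure ℝ) (volume : Measure ℝ)).integrable_comp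
      h2.aestronglyMeasurable
    exact h3.2 h2
  have h4 : Integrable (fun p : ℝ × ℝ => w (p.1 + p.2) * moll n p.2)
      ((volume.restrict (Ioc a b)).prod volume) := by
    refine h1.mono_measure ?_
    exact Measure.prod_mono Measure.restrict_le_self le_rfl
  refine h4.congr ?_
  have hae : ∀ᵐ p : ℝ × ℝ ∂((volume.restrict (Ioc a b)).prod volume), p.1 ∈ Ioc a b := by
    have : (volume.restrict (Ioc a b)).prod (volume : Measure ℝ)
        = (volume.prod volume).restrict (Ioc a b ×ˢ univ) := by
      rw [← Measure.prod_restrict, Measure.restrict_univ]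
    rw [this]
    filter_upwards [ae_restrict_mem (measurableSet_Ioc.prod MeasurableSet.univ)] with p hp
    exact hp.1
  filter_upwards [hae] with p hp
  simp only [Function.uncurry]
  by_cases ht : (1 / (n + 1) : ℝ) ≤ |p.2|
  · rw [moll_eq_zero ht]; simp
  · have h5 : |p.2| ≤ 1 := by
      refine (not_le.1 ht).le.trans ?_
      rw [div_le_one (by positivity)]
      linarith [(Nat.cast_nonneg n : (0:ℝ) ≤ n)]
    rw [hw, indicator_of_mem]
    rw [abs_le] at h5
    constructor <;> linarith [hp.1, hp.2]

/-- The fundamental theorem of calculus for a continuous function with a weak derivative. -/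
theorem IsWeakDeriv.sub_eq_integral {g v : ℝ → ℂ} (h : IsWeakDeriv g v) (hg : Continuous g)
    (hv : LocallyIntegrable v) {a b : ℝ} (hab : a ≤ b) : g b - g a = ∫ x in a..b, v x := by
  have hconv : ∀ n x, conv g (deriv (moll n)) x = conv v (moll n) x := by
    intro n x
    have h1 := h _ ((isTestFunction_moll n).comp_sub x)
    rw [deriv_comp_sub'] at h1
    simp only [mul_neg, integral_neg, neg_inj] at h1
    exact h1
  -- The mollified function is smooth, and the classical fundamental theorem applies to it. The
  -- mollification is then moved onto the integral of `v` over the shifted interval, which is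
  -- continuous in the shift, so that both sides converge.
  have key : ∀ n, conv g (moll n) b - conv g (moll n) a =
      conv (fun t => ∫ x in a..b, v (x + t)) (moll n) 0 := by
    intro n
    rw [← integral_conv_moll hv hab n]
    refine (intervalIntegral.integral_eq_sub_of_hasDerivAt (fun x _ => ?_) ?_).symm
    · rw [← hconv]
      exact hasDerivAt_conv hg.locallyIntegrable (isTestFunction_moll n) x
    · exact (continuous_conv hv (isTestFunction_moll n)).intervalIntegrable _ _
  have hW : Continuous (fun t => ∫ x in a..b, v (x + t)) := by
    have hvi : ∀ c d : ℝ, IntervalIntegrable v volume c d := fun c d =>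
      (hv.integrableOn_isCompact isCompact_uIcc).intervalIntegrable
    have hP : Continuous (fun c => ∫ x in (0)..c, v x) :=
      intervalIntegral.continuous_primitive hvi 0
    have : (fun t => ∫ x in a..b, v (x + t)) =
        fun t => (∫ x in (0)..(b + t), v x) - ∫ x in (0)..(a + t), v x := by
      ext t
      rw [intervalIntegral.integral_comp_add_right, intervalIntegral.integral_interval_sub_left
        (hvi _ _) (hvi _ _)]
    rw [this]
    exact (hP.comp (by fun_prop)).sub (hP.comp (by fun_prop))
  have h1 := (tendsto_conv_moll hg b).sub (tendsto_conv_moll hg a)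
  have h2 := tendsto_conv_moll hW 0
  simp only [add_zero] at h2
  exact tendsto_nhds_unique h1 (h2.congr fun n => (key n).symm)

/-! ### States of finite energy -/

namespace EnergyState

/-- The squared energy norm of a state. -/
def energy (m : ℝ) (S : EnergyState) : ℝ≥0∞ := energyNormSq m S.fld S.dfld S.mom

theorem isWeakDeriv_sub {g₁ v₁ g₂ v₂ : ℝ → ℂ} (h₁ : IsWeakDeriv g₁ v₁) (h₂ : IsWeakDeriv g₂ v₂)
    (hg₁ : LocallyIntegrable g₁) (hv₁ : LocallyIntegrable v₁)
    (hg₂ : LocallyIntegrable g₂) (hv₂ : LocallyIntegrable v₂) :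
    IsWeakDeriv (g₁ - g₂) (v₁ - v₂) := by
  intro ρ hρ
  simp only [Pi.sub_apply, sub_mul]
  rw [integral_sub (hρ.deriv.integrable_mul hg₁) (hρ.deriv.integrable_mul hg₂),
    integral_sub (hρ.integrable_mul hv₁) (hρ.integrable_mul hv₂), h₁ ρ hρ, h₂ ρ hρ]
  ring

/-- The difference of two states. -/
def sub (S T : EnergyState) : EnergyState where
  fld := S.fld - T.fld
  dfld := S.dfld - T.dfld
  mom := S.mom - T.mom
  continuous_fld := S.continuous_fld.sub T.continuous_fld
  memLp_fld := S.memLp_fld.sub T.memLp_fld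
  memLp_dfld := S.memLp_dfld.sub T.memLp_dfld
  isWeakDeriv := isWeakDeriv_sub S.isWeakDeriv T.isWeakDeriv
    S.continuous_fld.locallyIntegrable (memLp_two_locallyIntegrable S.memLp_dfld)
    T.continuous_fld.locallyIntegrable (memLp_two_locallyIntegrable T.memLp_dfld)
  memLp_mom := S.memLp_mom.sub T.memLp_mom

theorem energy_eq (m : ℝ) (S : EnergyState) : S.energy m = (∫⁻ x, ‖S.mom x‖ₑ ^ 2) +
    (∫⁻ x, ‖S.dfld x‖ₑ ^ 2) + ENNReal.ofReal (m ^ 2) * ∫⁻ x, ‖S.fld x‖ₑ ^ 2 := by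
  rw [energy, energyNormSq, lintegral_add_left', lintegral_add_left',
    lintegral_const_mul' _ _ ENNReal.ofReal_ne_top]
  · exact S.memLp_mom.1.enorm.pow_const 2
  · exact (S.memLp_mom.1.enorm.pow_const 2).add (S.memLp_dfld.1.enorm.pow_const 2)

theorem energy_lt_top (m : ℝ) (S : EnergyState) : S.energy m < ⊤ := by
  rw [energy_eq]
  have := MemLp.lintegral_sq_lt_top S.memLp_mom
  have := MemLp.lintegral_sq_lt_top S.memLp_dfld
  have := ENNReal.mul_lt_top (a := ENNReal.ofReal (m ^ 2)) (by simp)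
    (MemLp.lintegral_sq_lt_top S.memLp_fld)
  simp [ENNReal.add_lt_top, *]

theorem lintegral_mom_le (m : ℝ) (S : EnergyState) : ∫⁻ x, ‖S.mom x‖ₑ ^ 2 ≤ S.energy m := by
  rw [energy_eq, add_assoc]; exact le_self_add

theorem lintegral_dfld_le (m : ℝ) (S : EnergyState) : ∫⁻ x, ‖S.dfld x‖ₑ ^ 2 ≤ S.energy m := by
  rw [energy_eq, add_assoc]; exact le_self_add.trans le_add_self

theorem lintegral_fld_le {m : ℝ} (hm : 0 < m) (S : EnergyState) :
    ∫⁻ x, ‖S.fld x‖ₑ ^ 2 ≤ ENNReal.ofReal (1 / m ^ 2) * S.energy m := by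
  have h : ENNReal.ofReal (1 / m ^ 2) * (ENNReal.ofReal (m ^ 2) * ∫⁻ x, ‖S.fld x‖ₑ ^ 2)
      ≤ ENNReal.ofReal (1 / m ^ 2) * S.energy m := by
    gcongr
    rw [energy_eq]; exact le_add_self
  rwa [← mul_assoc, ← ENNReal.ofReal_mul (by positivity), one_div_mul_cancel (by positivity),
    ENNReal.ofReal_one, one_mul] at h

theorem energy_le (m : ℝ) (S T : EnergyState) :
    S.energy m ≤ 2 * T.energy m + 2 * (S.sub T).energy m := by
  have h : ∀ (f g : ℝ → ℂ), MemLp g 2 volume → ∫⁻ x, ‖f x‖ₑ ^ 2 ≤ 2 * (∫⁻ x, ‖g x‖ₑ ^ 2) +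
      2 * ∫⁻ x, ‖(f - g) x‖ₑ ^ 2 := by
    intro f g hg
    rw [← lintegral_const_mul' _ _ (by simp), ← lintegral_const_mul' _ _ (by simp),
      ← lintegral_add_left' ((hg.1.enorm.pow_const 2).const_mul 2)]
    refine lintegral_mono fun x => ?_
    have := enorm_add_sq_le (g x) ((f - g) x)
    simpa using this
  simp only [energy_eq]
  have h1 := h S.mom T.mom T.memLp_mom
  have h2 := h S.dfld T.dfld T.memLp_dfld
  have h3 := h S.fld T.fld T.memLp_fld
  calc _ ≤ _ := add_le_add (add_le_add h1 h2) (mul_le_mul_right h3 _)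
    _ = _ := by simp only [sub]; ring

theorem fld_sub_eq (S : EnergyState) (x : ℝ) {h : ℝ} (hh : 0 ≤ h) :
    S.fld (x + h) - S.fld x = ∫ s in (0)..h, S.dfld (x + s) := by
  rw [S.isWeakDeriv.sub_eq_integral S.continuous_fld (memLp_two_locallyIntegrable S.memLp_dfld)
    (by linarith : x ≤ x + h), intervalIntegral.integral_comp_add_left (fun y => S.dfld y) x,
    add_zero]

theorem lintegral_fld_translate_le (S : EnergyState) {h : ℝ} (hh : 0 ≤ h) :
    ∫⁻ x, ‖S.fld (x + h) - S.fld x‖ₑ ^ 2 ≤ ENNReal.ofReal (h ^ 2) * ∫⁻ x, ‖S.dfld x‖ₑ ^ 2 :=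
  lintegral_translation_sq_le S.memLp_dfld.1 hh fun x => S.fld_sub_eq x hh

/-- The value at `x` is compared with the value at `y` through the integral of the derivative, and
the comparison is averaged over `y` in the unit interval to the right of `x`. -/
theorem fld_sq_le_lintegral (S : EnergyState) (x : ℝ) :
    ‖S.fld x‖ₑ ^ 2 ≤ 2 * (∫⁻ x, ‖S.fld x‖ₑ ^ 2) + 2 * ∫⁻ x, ‖S.dfld x‖ₑ ^ 2 := by
  have h1 : ∀ y ∈ Ioc x (x + 1), ‖S.fld x‖ₑ ^ 2 ≤ 2 * ‖S.fld y‖ₑ ^ 2 +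
      2 * ∫⁻ x, ‖S.dfld x‖ₑ ^ 2 := by
    intro y hy
    have e := S.isWeakDeriv.sub_eq_integral S.continuous_fld
      (memLp_two_locallyIntegrable S.memLp_dfld) hy.1.le
    have e' : S.fld x = S.fld y - ∫ x in x..y, S.dfld x := by rw [← e]; ring
    rw [e']
    refine (enorm_sub_sq_le _ _).trans ?_
    gcongr
    rw [intervalIntegral.integral_of_le hy.1.le]
    refine (pow_le_pow_left₀ zero_le (enorm_integral_le_lintegral_enorm _) 2).trans ?_
    refine (lintegral_sq_le_mul S.memLp_dfld.1.enorm.restrict).trans ?_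
    rw [Real.volume_Ioc]
    calc _ ≤ 1 * ∫⁻ x, ‖S.dfld x‖ₑ ^ 2 := by
          gcongr
          · exact ENNReal.ofReal_le_one.2 (by linarith [hy.2])
          · exact Measure.restrict_le_self
      _ = _ := one_mul _
  have h2 := setLIntegral_mono' (μ := volume) measurableSet_Ioc h1
  rw [setLIntegral_const, Real.volume_Ioc, add_sub_cancel_left, ENNReal.ofReal_one, mul_one,
    lintegral_add_right _ measurable_const, setLIntegral_const, Real.volume_Ioc,
    add_sub_cancel_left, ENNReal.ofReal_one, mul_one, lintegral_const_mul' _ _ (by simp)] at h2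
  refine h2.trans ?_
  gcongr
  exact Measure.restrict_le_self

/-- The constant of the Sobolev inequality in terms of the energy. -/
def sobolevConst (m : ℝ) : ℝ≥0∞ := 2 * ENNReal.ofReal (1 / m ^ 2) + 2

theorem sobolevConst_lt_top (m : ℝ) : sobolevConst m < ⊤ := by
  simp [sobolevConst, ENNReal.add_lt_top, ENNReal.mul_lt_top]

theorem fld_sq_le {m : ℝ} (hm : 0 < m) (S : EnergyState) (x : ℝ) :
    ‖S.fld x‖ₑ ^ 2 ≤ sobolevConst m * S.energy m := by
  refine (S.fld_sq_le_lintegral x).trans ?_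
  rw [sobolevConst, add_mul, mul_assoc]
  gcongr
  · exact S.lintegral_fld_le hm
  · exact S.lintegral_dfld_le m

end EnergyState

/-! ### Duality in `L²` -/

theorem lintegral_sq_eq_ofReal_norm_sq {μ : Measure ℝ} {f : ℝ → ℂ} (hf : MemLp f 2 μ) :
    ∫⁻ x, ‖f x‖ₑ ^ 2 ∂μ = ENNReal.ofReal (‖hf.toLp f‖ ^ 2) := by
  rw [Lp.norm_toLp, ← ENNReal.toReal_pow, ENNReal.ofReal_toReal (ENNReal.pow_ne_top hf.2.ne),
    eLpNorm_eq_lintegral_rpow_enorm_toReal (by norm_num) (by norm_num), ← ENNReal.rpow_natCast,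
    ← ENNReal.rpow_mul]
  simp

/-- The pairing bound extends by density from test functions to all of `L²`, where it is applied to
the conjugate of `g` itself. It serves to bound functions known only through their pairings. -/
theorem lintegral_sq_le_of_forall_test {g : ℝ → ℂ} (hg : MemLp g 2 volume) {A : ℝ} (hA : 0 ≤ A)
    (h : ∀ ρ, IsTestFunction ρ → ENNReal.ofReal (‖∫ x, g x * ρ x‖ ^ 2) ≤
      ENNReal.ofReal (A ^ 2) * ∫⁻ x, ‖ρ x‖ₑ ^ 2) :
    ∫⁻ x, ‖g x‖ₑ ^ 2 ≤ ENNReal.ofReal (A ^ 2) := by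
  have hgs : MemLp (fun x => (starRingEnd ℂ) (g x)) 2 volume := hg.star
  set G := hgs.toLp _ with hG
  have key : ∀ F : Lp ℂ 2 (volume : Measure ℝ), ‖inner ℂ G F‖ ≤ A * ‖F‖ := by
    intro F
    have hcl : IsClosed {F : Lp ℂ 2 (volume : Measure ℝ) | ‖inner ℂ G F‖ ≤ A * ‖F‖} :=
      isClosed_le (by fun_prop) (by fun_prop)
    have hd : Dense {f : Lp ℂ 2 (volume : Measure ℝ) |
        ∃ (g : ℝ → ℂ), f =ᵐ[volume] g ∧ HasCompactSupport g ∧ ContDiff ℝ ∞ g} :=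
      Lp.dense_hasCompactSupport_contDiff (by norm_num)
    refine hcl.closure_subset_iff.2 ?_ (hd F)
    rintro F ⟨ρ, hFρ, hρs, hρ⟩
    have hρt : IsTestFunction ρ := ⟨hρ, hρs⟩
    have h1 := h ρ hρt
    have e1 : inner ℂ G F = ∫ x, g x * ρ x := by
      rw [L2.inner_def]
      refine integral_congr_ae ?_
      filter_upwards [hFρ, hgs.coeFn_toLp] with x hx hx'
      rw [hx, hx', RCLike.inner_apply]
      simp [mul_comm]
    have e2 : ‖F‖ = ‖(hρt.memLp 2).toLp ρ‖ := by
      congr 1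
      exact Lp.ext (hFρ.trans (hρt.memLp 2).coeFn_toLp.symm)
    simp only [Set.mem_ofPred_eq]
    rw [e1, e2]
    rw [lintegral_sq_eq_ofReal_norm_sq (hρt.memLp 2), ← ENNReal.ofReal_mul (by positivity),
      ← mul_pow, ENNReal.ofReal_le_ofReal_iff (by positivity)] at h1
    exact le_of_sq_le_sq h1 (by positivity)
  have h1 := key G
  -- Testing with `G` itself gives `‖G‖² ≤ A ‖G‖`.
  rw [inner_self_eq_norm_sq_to_K] at h1
  have h2 : ‖G‖ ^ 2 ≤ A * ‖G‖ := by simpa using h1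
  have h3 : ‖G‖ ≤ A := by
    rcases eq_or_lt_of_le (norm_nonneg G) with h | h
    · rw [← h]; exact hA
    · nlinarith
  have h4 : ∫⁻ x, ‖g x‖ₑ ^ 2 = ∫⁻ x, ‖(starRingEnd ℂ) (g x)‖ₑ ^ 2 := by
    congr 1; ext x; simp
  rw [h4, lintegral_sq_eq_ofReal_norm_sq hgs]
  gcongr

theorem enorm_integral_mul_sq_le {f g : ℝ → ℂ} (hf : MemLp f 2 volume) (hg : MemLp g 2 volume) :
    ‖∫ x, f x * g x‖ₑ ^ 2 ≤ (∫⁻ x, ‖f x‖ₑ ^ 2) * ∫⁻ x, ‖g x‖ₑ ^ 2 := by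
  refine (pow_le_pow_left₀ zero_le (enorm_integral_le_lintegral_enorm _) 2).trans ?_
  simp only [enorm_mul]
  exact lintegral_mul_sq_le hf.1.enorm hg.1.enorm

/-! ### Continuity of a finite energy trajectory -/

section Trajectory

variable {m : ℝ} {Ψ : ℝ → EnergyState}

theorem ContinuousInEnergy.tendsto (h : ContinuousInEnergy m Ψ) (t : ℝ) :
    Tendsto (fun s => ((Ψ s).sub (Ψ t)).energy m) (𝓝 t) (𝓝 0) := h t

/-- Compactness: near each time `t` the energy is at most twice the energy at `t` plus 2, by the
quasi-triangle inequality `energy_le`. -/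
theorem ContinuousInEnergy.exists_bound (h : ContinuousInEnergy m Ψ) (a b : ℝ) :
    ∃ B : ℝ≥0, ∀ t ∈ Icc a b, (Ψ t).energy m ≤ B := by
  refine isCompact_Icc.induction_on (p := fun S => ∃ B : ℝ≥0, ∀ t ∈ S, (Ψ t).energy m ≤ B)
    ⟨0, by simp⟩ (fun s t hst ⟨B, hB⟩ => ⟨B, fun x hx => hB x (hst hx)⟩)
    (fun s t ⟨B, hB⟩ ⟨B', hB'⟩ => ⟨max B B', ?_⟩) (fun t _ => ?_)
  · rintro x (hx | hx)
    · exact (hB x hx).trans (by exact_mod_cast le_max_left _ _)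
    · exact (hB' x hx).trans (by exact_mod_cast le_max_right _ _)
  · have h1 := (h.tendsto t).eventually (ge_mem_nhds (show (0 : ℝ≥0∞) < 1 by simp))
    lift (Ψ t).energy m to ℝ≥0 using ((Ψ t).energy_lt_top m).ne with E hE
    refine ⟨_, mem_nhdsWithin_of_mem_nhds h1, 2 * E + 2, fun s hs => ?_⟩
    refine ((Ψ s).energy_le m (Ψ t)).trans ?_
    rw [← hE]
    push_cast
    gcongr
    calc 2 * ((Ψ s).sub (Ψ t)).energy m ≤ 2 * 1 := by gcongr; exact hs
      _ = 2 := mul_one _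

/-- By the Sobolev inequality, convergence in energy is uniform in `x`; together with continuity of
each field in `x` this gives joint continuity. -/
theorem ContinuousInEnergy.continuous_fld (h : ContinuousInEnergy m Ψ) (hm : 0 < m) :
    Continuous (fun p : ℝ × ℝ => (Ψ p.2).fld p.1) := by
  rw [continuous_iff_continuousAt]
  rintro ⟨x, t⟩
  have h1 : Tendsto (fun s => EnergyState.sobolevConst m * ((Ψ s).sub (Ψ t)).energy m) (𝓝 t)
      (𝓝 0) := by
    simpa using ENNReal.Tendsto.const_mul (h.tendsto t)
      (Or.inr (EnergyState.sobolevConst_lt_top m).ne)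
  have h2 : Tendsto (fun p : ℝ × ℝ => (Ψ p.2).fld p.1 - (Ψ t).fld p.1) (𝓝 (x, t)) (𝓝 0) := by
    rw [tendsto_zero_iff_enorm_tendsto_zero]
    have h3 : Tendsto (fun p : ℝ × ℝ => ‖(Ψ p.2).fld p.1 - (Ψ t).fld p.1‖ₑ ^ 2)
        (𝓝 (x, t)) (𝓝 0) := by
      refine tendsto_of_tendsto_of_tendsto_of_le_of_le tendsto_const_nhds
        (h1.comp (continuous_snd.tendsto (x, t))) (fun _ => zero_le) fun p => ?_
      exact ((Ψ p.2).sub (Ψ t)).fld_sq_le hm p.1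
    have h4 := (ENNReal.continuous_rpow_const (y := (1 / 2 : ℝ))).tendsto 0 |>.comp h3
    simp only [Function.comp_def, ← ENNReal.rpow_natCast, ← ENNReal.rpow_mul] at h4
    simpa using h4
  have h5 := ((Ψ t).continuous_fld.comp continuous_fst).tendsto (x, t)
  have h6 := h2.add h5
  simpa [ContinuousAt] using h6

/-- Only pairings of the field with test functions are known to be differentiable in time. The mean
value inequality bounds the increment of each pairing by `h` times the norm of the momentum, and
duality turns this into an `L²` bound. -/
theorem lintegral_fld_time_le {N : ℕ} {X : Fin N → ℝ}
    {f : Fin N → ℝ → ℂ} (hΨ : SolvesForcedKG m X f Ψ) {t h : ℝ} (hh : 0 ≤ h) {B : ℝ≥0}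
    (hB : ∀ s ∈ Icc t (t + h), (Ψ s).energy m ≤ B) :
    ∫⁻ x, ‖(Ψ (t + h)).fld x - (Ψ t).fld x‖ₑ ^ 2 ≤ ENNReal.ofReal (h ^ 2) * B := by
  have e : ENNReal.ofReal (h ^ 2) * B = ENNReal.ofReal ((h * Real.sqrt B) ^ 2) := by
    rw [mul_pow, Real.sq_sqrt B.coe_nonneg, ENNReal.ofReal_mul (by positivity), ENNReal.ofReal_coe_nnreal]
  rw [e]
  refine lintegral_sq_le_of_forall_test ((Ψ (t + h)).memLp_fld.sub (Ψ t).memLp_fld)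
    (by positivity) fun ρ hρ => ?_
  set R : ℝ := (∫⁻ x, ‖ρ x‖ₑ ^ 2).toReal with hR
  have hRf : ∫⁻ x, ‖ρ x‖ₑ ^ 2 < ⊤ := MemLp.lintegral_sq_lt_top (hρ.memLp 2)
  have hR0 : 0 ≤ R := ENNReal.toReal_nonneg
  have hder : ∀ s ∈ Icc t (t + h), ‖∫ x, (Ψ s).mom x * ρ x‖ ≤ Real.sqrt B * Real.sqrt R := by
    intro s hs
    have h1 := enorm_integral_mul_sq_le (Ψ s).memLp_mom (hρ.memLp 2)
    have h2 : ‖∫ x, (Ψ s).mom x * ρ x‖ₑ ^ 2 ≤ B * ∫⁻ x, ‖ρ x‖ₑ ^ 2 := by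
      refine h1.trans ?_
      gcongr
      exact ((Ψ s).lintegral_mom_le m).trans (hB s hs)
    rw [← ENNReal.ofReal_toReal hRf.ne, ← ENNReal.ofReal_coe_nnreal,
      ← ENNReal.ofReal_mul B.coe_nonneg, ← ofReal_norm, ← ENNReal.ofReal_pow (norm_nonneg _),
      ENNReal.ofReal_le_ofReal_iff (mul_nonneg B.coe_nonneg hR0)] at h2
    rw [← Real.sqrt_mul B.coe_nonneg]
    exact Real.le_sqrt_of_sq_le h2
  have hmv := norm_image_sub_le_of_norm_deriv_le_segment' (a := t) (b := t + h)
    (f := fun s => ∫ x, (Ψ s).fld x * ρ x)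
    (fun s hs => (hΨ.hasDerivAt_fld ρ hρ s).hasDerivWithinAt)
    (fun s hs => hder s (Ico_subset_Icc_self hs)) (t + h) (by constructor <;> linarith)
  have e2 : ∫ x, ((Ψ (t + h)).fld - (Ψ t).fld) x * ρ x =
      (∫ x, (Ψ (t + h)).fld x * ρ x) - ∫ x, (Ψ t).fld x * ρ x := by
    simp only [Pi.sub_apply, sub_mul]
    exact integral_sub (hρ.integrable_mul (Ψ (t + h)).continuous_fld.locallyIntegrable)
      (hρ.integrable_mul (Ψ t).continuous_fld.locallyIntegrable)
  rw [e2, ← ENNReal.ofReal_toReal hRf.ne, ← ENNReal.ofReal_mul (by positivity)]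
  refine ENNReal.ofReal_le_ofReal ?_
  calc _ ≤ (Real.sqrt B * Real.sqrt R * (t + h - t)) ^ 2 := by gcongr
    _ = (h * Real.sqrt B) ^ 2 * R := by
      rw [add_sub_cancel_left, mul_pow, mul_pow, mul_pow, Real.sq_sqrt hR0]; ring

end Trajectory

/-! ### Fourier transforms in time of cut-off fields -/

theorem integrable_schwartz_mul {κ : 𝓢(ℝ, ℂ)} {g : ℝ → ℂ} (hg : Continuous g) {M : ℝ}
    (hM : ∀ t ∈ tsupport κ, ‖g t‖ ≤ M) : Integrable (fun t => κ t * g t) := by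
  refine Integrable.mono' (κ.integrable.norm.mul_const M)
    (κ.continuous.mul hg).aestronglyMeasurable (ae_of_all _ fun t => ?_)
  rw [norm_mul]
  by_cases ht : t ∈ tsupport κ
  · gcongr; exact hM t ht
  · simp [image_eq_zero_of_notMem_tsupport ht]

theorem memLp_schwartz_mul {κ : 𝓢(ℝ, ℂ)} {g : ℝ → ℂ} (hg : Continuous g) {M : ℝ}
    (hM : ∀ t ∈ tsupport κ, ‖g t‖ ≤ M) : MemLp (fun t => κ t * g t) 2 := by
  refine MemLp.of_le_mul (c := M) (κ.memLp 2)
    (κ.continuous.mul hg).aestronglyMeasurable (ae_of_all _ fun t => ?_)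
  rw [norm_mul, mul_comm]
  by_cases ht : t ∈ tsupport κ
  · gcongr; exact hM t ht
  · simp [image_eq_zero_of_notMem_tsupport ht]

/-- Fatou's lemma for iterated integrals. -/
theorem lintegral_lintegral_le_of_tendsto {F : ℕ → ℝ → ℝ → ℝ≥0∞} {G : ℝ → ℝ → ℝ≥0∞} {A : ℝ≥0∞}
    (hF : ∀ n, Measurable (Function.uncurry (F n)))
    (hlim : ∀ x y, Tendsto (fun n => F n x y) atTop (𝓝 (G x y)))
    (hA : ∀ n, ∫⁻ x, ∫⁻ y, F n x y ≤ A) : ∫⁻ x, ∫⁻ y, G x y ≤ A := by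
  have hG : Measurable (Function.uncurry G) :=
    measurable_of_tendsto_metrizable hF (tendsto_pi_nhds.2 fun p => hlim p.1 p.2)
  have h1 : ∀ n, ∫⁻ p, Function.uncurry (F n) p ∂(volume.prod volume) ≤ A := fun n => by
    rw [lintegral_prod _ (hF n).aemeasurable]; exact hA n
  have h2 : ∫⁻ p, Function.uncurry G p ∂(volume.prod volume) ≤ A := by
    have h3 : ∀ p, Function.uncurry G p = liminf (fun n => Function.uncurry (F n) p) atTop :=
      fun p => (hlim p.1 p.2).liminf_eq.symm
    simp_rw [h3]
    refine (lintegral_liminf_le hF).trans ?_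
    refine liminf_le_of_frequently_le' (Eventually.of_forall h1).frequently
  rwa [lintegral_prod _ hG.aemeasurable] at h2

theorem lintegral_lintegral_ft_sq {G : ℝ → ℝ → ℂ} (hG : Continuous (Function.uncurry G))
    (h1 : ∀ x, Integrable (G x)) (h2 : ∀ x, MemLp (G x) 2) :
    ∫⁻ x, ∫⁻ ξ, ‖ft (G x) ξ‖ₑ ^ 2 =
      ENNReal.ofReal (2 * Real.pi) * ∫⁻ t, ∫⁻ x, ‖G x t‖ₑ ^ 2 := by
  have : ∀ x, ∫⁻ ξ, ‖ft (G x) ξ‖ₑ ^ 2 = ENNReal.ofReal (2 * Real.pi) * ∫⁻ t, ‖G x t‖ₑ ^ 2 :=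
    fun x => lintegral_ft_sq (h1 x) (h2 x)
  simp_rw [this]
  rw [lintegral_const_mul' _ _ ENNReal.ofReal_ne_top, lintegral_lintegral_swap]
  exact (hG.enorm.measurable.pow_const 2).aemeasurable

/-- The Fourier transform in time of the field cut off by `κ`. -/
def cutFt (Ψ : ℝ → EnergyState) (κ : 𝓢(ℝ, ℂ)) (x ξ : ℝ) : ℂ :=
  ft (fun t => κ t * (Ψ t).fld x) ξ

/-- `B` bounds the energy in the unit neighbourhood of the support of `κ`. -/
def EnergyBoundNear (m : ℝ) (Ψ : ℝ → EnergyState) (κ : 𝓢(ℝ, ℂ)) (B : ℝ≥0) : Prop :=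
  ∀ t, (∃ s ∈ tsupport κ, |t - s| ≤ 1) → (Ψ t).energy m ≤ B

/-- The derivative of a Schwartz function. -/
def dS (κ : 𝓢(ℝ, ℂ)) : 𝓢(ℝ, ℂ) := SchwartzMap.derivCLM ℂ ℂ κ

theorem coe_dS (κ : 𝓢(ℝ, ℂ)) : ⇑(dS κ) = deriv κ := rfl

theorem hasDerivAt_schwartz (κ : 𝓢(ℝ, ℂ)) (t : ℝ) : HasDerivAt κ (dS κ t) t :=
  (κ.differentiableAt).hasDerivAt

theorem tsupport_dS_subset (κ : 𝓢(ℝ, ℂ)) : tsupport (dS κ) ⊆ tsupport κ := by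
  rw [coe_dS]
  exact closure_minimal (support_deriv_subset) (isClosed_tsupport _)

theorem lintegral_schwartz_translate_le (κ : 𝓢(ℝ, ℂ)) {h : ℝ} (hh : 0 ≤ h) :
    ∫⁻ t, ‖κ (t + h) - κ t‖ₑ ^ 2 ≤ ENNReal.ofReal (h ^ 2) * ∫⁻ t, ‖dS κ t‖ₑ ^ 2 := by
  refine lintegral_translation_sq_le (dS κ).continuous.aestronglyMeasurable hh fun t => ?_
  rw [intervalIntegral.integral_comp_add_left (fun y => dS κ y) t, add_zero]
  refine (intervalIntegral.integral_eq_sub_of_hasDerivAt (fun x _ => hasDerivAt_schwartz κ x)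
    ((dS κ).continuous.intervalIntegrable _ _)).symm

section CutFt

variable {m : ℝ} {Ψ : ℝ → EnergyState} {κ : 𝓢(ℝ, ℂ)} {B : ℝ≥0}

theorem EnergyBoundNear.deriv (h : EnergyBoundNear m Ψ κ B) : EnergyBoundNear m Ψ (dS κ) B :=
  fun t ⟨s, hs, hst⟩ => h t ⟨s, tsupport_dS_subset κ hs, hst⟩

theorem EnergyBoundNear.of_mem (h : EnergyBoundNear m Ψ κ B) {t : ℝ} (ht : t ∈ tsupport κ) :
    (Ψ t).energy m ≤ B := h t ⟨t, ht, by simp⟩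

/-- A bound for the field where the energy is at most `B`. -/
def fldBound (m : ℝ) (B : ℝ≥0) : ℝ := Real.sqrt (EnergyState.sobolevConst m * B).toReal

theorem norm_fld_le_fldBound (hm : 0 < m) {S : EnergyState} (h : S.energy m ≤ B) (x : ℝ) :
    ‖S.fld x‖ ≤ fldBound m B := by
  refine Real.le_sqrt_of_sq_le ?_
  have h1 : ‖S.fld x‖ₑ ^ 2 ≤ EnergyState.sobolevConst m * B :=
    (S.fld_sq_le hm x).trans (by gcongr)
  have h2 := ENNReal.toReal_mono (ENNReal.mul_ne_top (EnergyState.sobolevConst_lt_top m).ne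
    ENNReal.coe_ne_top) h1
  simpa using h2

theorem EnergyBoundNear.norm_fld_le (hm : 0 < m) (h : EnergyBoundNear m Ψ κ B) (x : ℝ) :
    ∀ t ∈ tsupport κ, ‖(Ψ t).fld x‖ ≤ fldBound m B :=
  fun _ ht => norm_fld_le_fldBound hm (h.of_mem ht) x

theorem ContinuousInEnergy.continuous_fld_right (hE : ContinuousInEnergy m Ψ) (hm : 0 < m) (x : ℝ) :
    Continuous (fun t => (Ψ t).fld x) :=
  (hE.continuous_fld hm).comp (Continuous.prodMk_right x)

theorem integrable_cut (hm : 0 < m) (hE : ContinuousInEnergy m Ψ) (hB : EnergyBoundNear m Ψ κ B)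
    (x : ℝ) : Integrable (fun t => κ t * (Ψ t).fld x) :=
  integrable_schwartz_mul (hE.continuous_fld_right hm x) (hB.norm_fld_le hm x)

theorem memLp_cut (hm : 0 < m) (hE : ContinuousInEnergy m Ψ) (hB : EnergyBoundNear m Ψ κ B)
    (x : ℝ) : MemLp (fun t => κ t * (Ψ t).fld x) 2 :=
  memLp_schwartz_mul (hE.continuous_fld_right hm x) (hB.norm_fld_le hm x)

theorem continuous_cut (hm : 0 < m) (hE : ContinuousInEnergy m Ψ) :
    Continuous (Function.uncurry fun x t => κ t * (Ψ t).fld x) :=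
  (κ.continuous.comp continuous_snd).mul (hE.continuous_fld hm)

theorem continuous_cutFt (hm : 0 < m) (hE : ContinuousInEnergy m Ψ)
    (hB : EnergyBoundNear m Ψ κ B) : Continuous (Function.uncurry (cutFt Ψ κ)) := by
  refine continuous_of_dominated (bound := fun t => ‖κ t‖ * fldBound m B) (fun p => ?_)
    (fun p => ae_of_all _ fun t => ?_) (κ.integrable.norm.mul_const _)
    (ae_of_all _ fun t => ?_)
  · exact (integrable_exp_mul (integrable_cut hm hE hB p.1) p.2).aestronglyMeasurable
  · rw [norm_mul, norm_exp_I_mul, one_mul, norm_mul]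
    by_cases ht : t ∈ tsupport κ
    · gcongr; exact hB.norm_fld_le hm _ t ht
    · simp [image_eq_zero_of_notMem_tsupport ht]
  · have := (Ψ t).continuous_fld
    fun_prop

/-- The squared `L²` norm of a cutoff. -/
def cutNorm (κ : 𝓢(ℝ, ℂ)) : ℝ≥0∞ := ∫⁻ t, ‖κ t‖ₑ ^ 2

theorem lintegral_weight_le (κ : ℝ → ℂ) {g : ℝ → ℝ → ℂ} {A : ℝ≥0∞} (hA' : A ≠ ⊤)
    (hA : ∀ t, κ t ≠ 0 → ∫⁻ x, ‖g x t‖ₑ ^ 2 ≤ A) :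
    ∫⁻ t, ∫⁻ x, ‖κ t * g x t‖ₑ ^ 2 ≤ (∫⁻ t, ‖κ t‖ₑ ^ 2) * A := by
  rw [← lintegral_mul_const' _ _ hA']
  refine lintegral_mono fun t => ?_
  simp only [enorm_mul, mul_pow]
  rw [lintegral_const_mul' _ _ (by simp)]
  by_cases ht : κ t = 0
  · simp [ht]
  · gcongr; exact hA t ht

theorem mem_tsupport_of_ne {κ : 𝓢(ℝ, ℂ)} {t : ℝ} (h : κ t ≠ 0) : t ∈ tsupport κ :=
  subset_tsupport _ h

theorem lintegral_cutFt_le (hm : 0 < m) (hE : ContinuousInEnergy m Ψ)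
    (hB : EnergyBoundNear m Ψ κ B) :
    ∫⁻ x, ∫⁻ ξ, ‖cutFt Ψ κ x ξ‖ₑ ^ 2 ≤
      ENNReal.ofReal (2 * Real.pi) * (cutNorm κ * (ENNReal.ofReal (1 / m ^ 2) * B)) := by
  simp only [cutFt]
  rw [lintegral_lintegral_ft_sq (G := fun x t => κ t * (Ψ t).fld x) (continuous_cut hm hE)
    (integrable_cut hm hE hB) (memLp_cut hm hE hB)]
  gcongr
  refine lintegral_weight_le κ (by finiteness) fun t ht => ?_
  refine ((Ψ t).lintegral_fld_le hm).trans ?_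
  gcongr
  exact hB.of_mem (mem_tsupport_of_ne ht)

/-- Plancherel in time and the translation estimate in space at each fixed time. Divided by `h²`,
this is a bound for the space derivative that does not presuppose its existence. -/
theorem lintegral_cutFt_translate_le (hm : 0 < m) (hE : ContinuousInEnergy m Ψ)
    (hB : EnergyBoundNear m Ψ κ B) {h : ℝ} (hh : 0 ≤ h) :
    ∫⁻ x, ∫⁻ ξ, ‖cutFt Ψ κ (x + h) ξ - cutFt Ψ κ x ξ‖ₑ ^ 2 ≤
      ENNReal.ofReal (2 * Real.pi) * (cutNorm κ * (ENNReal.ofReal (h ^ 2) * B)) := by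
  have e : ∀ x ξ, cutFt Ψ κ (x + h) ξ - cutFt Ψ κ x ξ =
      ft (fun t => κ t * ((Ψ t).fld (x + h) - (Ψ t).fld x)) ξ := by
    intro x ξ
    simp only [cutFt, mul_sub]
    rw [ft_sub (integrable_cut hm hE hB _) (integrable_cut hm hE hB _)]
  simp_rw [e]
  have hc := continuous_cut (κ := κ) hm hE
  rw [lintegral_lintegral_ft_sq (G := fun x t => κ t * ((Ψ t).fld (x + h) - (Ψ t).fld x))]
  rotate_left
  · simp only [mul_sub]
    have h1 : Continuous (fun p : ℝ × ℝ => (p.1 + h, p.2)) := by fun_prop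
    exact (hc.comp h1).sub hc
  · intro x; simp only [mul_sub]
    exact (integrable_cut hm hE hB _).sub (integrable_cut hm hE hB _)
  · intro x; simp only [mul_sub]
    exact (memLp_cut hm hE hB _).sub (memLp_cut hm hE hB _)
  gcongr
  refine lintegral_weight_le (g := fun x t => (Ψ t).fld (x + h) - (Ψ t).fld x)
    κ (by finiteness) fun t ht => ?_
  refine ((Ψ t).lintegral_fld_translate_le hh).trans ?_
  gcongr
  exact ((Ψ t).lintegral_dfld_le m).trans (hB.of_mem (mem_tsupport_of_ne ht))

/-- Multiplication by `e^{-iξh} - 1` is a time difference of the cut-off field. Its discrete product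
rule has one term with a difference of the field and one with a difference of the cutoff. As `h ≤
1`, the times involved stay in the unit neighbourhood of the support. -/
theorem lintegral_cutFt_time_translate_le {N : ℕ} {X : Fin N → ℝ} {f : Fin N → ℝ → ℂ}
    (hm : 0 < m) (hΨ : SolvesForcedKG m X f Ψ)
    (hB : EnergyBoundNear m Ψ κ B) {h : ℝ} (hh : 0 ≤ h) (hh1 : h ≤ 1) :
    ∫⁻ x, ∫⁻ ξ : ℝ, ‖(Complex.exp (-(Complex.I * ξ * h)) - 1) * cutFt Ψ κ x ξ‖ₑ ^ 2 ≤
      ENNReal.ofReal (h ^ 2) * (ENNReal.ofReal (2 * Real.pi) * (2 * (cutNorm κ * B) +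
        2 * (cutNorm (dS κ) * (ENNReal.ofReal (1 / m ^ 2) * B)))) := by
  have hE := hΨ.continuousInEnergy
  have e : ∀ (x ξ : ℝ), (Complex.exp (-(Complex.I * ξ * h)) - 1) * cutFt Ψ κ x ξ =
      ft (fun t => κ (t + h) * (Ψ (t + h)).fld x - κ t * (Ψ t).fld x) ξ := by
    intro x ξ
    rw [ft_sub ((integrable_cut hm hE hB x).comp_add_right h) (integrable_cut hm hE hB x),
      ft_comp_add (fun t => κ t * (Ψ t).fld x)]
    simp only [cutFt]; ring
  simp_rw [e]
  have hc := continuous_cut (κ := κ) hm hE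
  rw [lintegral_lintegral_ft_sq
    (G := fun x t => κ (t + h) * (Ψ (t + h)).fld x - κ t * (Ψ t).fld x)]
  rotate_left
  · have h1 : Continuous (fun p : ℝ × ℝ => (p.1, p.2 + h)) := by fun_prop
    exact (hc.comp h1).sub hc
  · intro x
    exact ((integrable_cut hm hE hB x).comp_add_right h).sub (integrable_cut hm hE hB x)
  · intro x
    refine MemLp.sub ?_ (memLp_cut hm hE hB x)
    exact (memLp_cut hm hE hB x).comp_measurePreserving (measurePreserving_add_right volume h)
  rw [mul_left_comm]
  gcongr
  have hc1 : Continuous (Function.uncurry fun t x : ℝ =>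
      κ (t + h) * ((Ψ (t + h)).fld x - (Ψ t).fld x)) := by
    have h1 : Continuous (fun p : ℝ × ℝ => (p.2, p.1 + h)) := by fun_prop
    have h2 : Continuous (fun p : ℝ × ℝ => (p.2, p.1)) := by fun_prop
    exact (κ.continuous.comp (by fun_prop : Continuous fun p : ℝ × ℝ => p.1 + h)).mul
      (((hE.continuous_fld hm).comp h1).sub ((hE.continuous_fld hm).comp h2))
  have key1 : ∫⁻ t, ∫⁻ x, ‖κ (t + h) * ((Ψ (t + h)).fld x - (Ψ t).fld x)‖ₑ ^ 2 ≤
      cutNorm κ * (ENNReal.ofReal (h ^ 2) * B) := by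
    have e1 : cutNorm κ = ∫⁻ t, ‖κ (t + h)‖ₑ ^ 2 :=
      (lintegral_add_right_eq_self (fun t => ‖κ t‖ₑ ^ 2) h).symm
    rw [e1]
    refine lintegral_weight_le (g := fun x t => (Ψ (t + h)).fld x - (Ψ t).fld x)
      (fun t => κ (t + h)) (by finiteness) fun t ht => ?_
    refine lintegral_fld_time_le hΨ hh fun s hs => hB s ⟨t + h, mem_tsupport_of_ne ht, ?_⟩
    rw [abs_le]; constructor <;> linarith [hs.1, hs.2]
  have key2 : ∫⁻ t, ∫⁻ x, ‖(κ (t + h) - κ t) * (Ψ t).fld x‖ₑ ^ 2 ≤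
      (∫⁻ t, ‖κ (t + h) - κ t‖ₑ ^ 2) * (ENNReal.ofReal (1 / m ^ 2) * B) := by
    refine lintegral_weight_le (g := fun x t => (Ψ t).fld x)
      (fun t => κ (t + h) - κ t) (by finiteness) fun t ht => ?_
    refine ((Ψ t).lintegral_fld_le hm).trans ?_
    gcongr
    by_cases h0 : κ t = 0
    · have h2 : κ (t + h) ≠ 0 := by
        intro h3; simp [h0, h3] at ht
      exact hB t ⟨t + h, mem_tsupport_of_ne h2, by
        rw [sub_add_cancel_left, abs_neg, abs_of_nonneg hh]; exact hh1⟩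
    · exact hB.of_mem (mem_tsupport_of_ne h0)
  calc ∫⁻ t, ∫⁻ x, ‖κ (t + h) * (Ψ (t + h)).fld x - κ t * (Ψ t).fld x‖ₑ ^ 2
      ≤ ∫⁻ t, ∫⁻ x, (2 * ‖κ (t + h) * ((Ψ (t + h)).fld x - (Ψ t).fld x)‖ₑ ^ 2 +
          2 * ‖(κ (t + h) - κ t) * (Ψ t).fld x‖ₑ ^ 2) := by
        refine lintegral_mono fun t => lintegral_mono fun x => ?_
        refine le_trans (le_of_eq ?_) (enorm_add_sq_le _ _)
        congr 2; ring
    _ = 2 * (∫⁻ t, ∫⁻ x, ‖κ (t + h) * ((Ψ (t + h)).fld x - (Ψ t).fld x)‖ₑ ^ 2) +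
          2 * ∫⁻ t, ∫⁻ x, ‖(κ (t + h) - κ t) * (Ψ t).fld x‖ₑ ^ 2 := by
        rw [← lintegral_const_mul' _ _ (by simp), ← lintegral_const_mul' _ _ (by simp),
          ← lintegral_add_left]
        · refine lintegral_congr fun t => ?_
          rw [lintegral_add_left, lintegral_const_mul' _ _ (by simp),
            lintegral_const_mul' _ _ (by simp)]
          exact ((hc1.comp (Continuous.prodMk_right t)).enorm.measurable.pow_const 2).const_mul 2
        · exact ((hc1.enorm.measurable.pow_const 2).lintegral_prod_right').const_mul 2
    _ ≤ 2 * (cutNorm κ * (ENNReal.ofReal (h ^ 2) * B)) + 2 * ((ENNReal.ofReal (h ^ 2) *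
          cutNorm (dS κ)) * (ENNReal.ofReal (1 / m ^ 2) * B)) := by
        gcongr
        exact key2.trans (by gcongr; exact lintegral_schwartz_translate_le κ hh)
    _ = _ := by ring

theorem tendsto_exp_diff_quotient (ξ : ℝ) :
    Tendsto (fun n : ℕ => ((n : ℂ) + 1) * (Complex.exp (-(Complex.I * ξ * (1 / (n + 1) : ℝ))) - 1))
      atTop (𝓝 (-(Complex.I * ξ))) := by
  have h1 : HasDerivAt (fun h : ℝ => Complex.exp (-(Complex.I * ξ * h))) (-(Complex.I * ξ)) 0 := by
    have h2 : HasDerivAt (fun h : ℝ => -(Complex.I * ξ * (h : ℂ))) (-(Complex.I * ξ)) 0 := by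
      simpa using ((Complex.ofRealCLM.hasDerivAt (x := (0 : ℝ))).const_mul (Complex.I * ξ)).fun_neg
    simpa using h2.cexp
  have h2 := h1.tendsto_slope_zero
  have h3 : Tendsto (fun n : ℕ => (1 / ((n : ℝ) + 1))) atTop (𝓝[≠] 0) :=
    tendsto_nhdsWithin_iff.2 ⟨tendsto_one_div_add_atTop_nhds_zero_nat,
      Eventually.of_forall fun n => by simp; positivity⟩
  refine (h2.comp h3).congr fun n => ?_
  simp [Complex.real_smul]

/-- The preceding estimate with `h = 1/(n+1)`, divided by `h²`; Fatou's lemma turns the difference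
quotient of the exponential into multiplication by `ξ`. -/
theorem lintegral_sq_mul_cutFt_le {N : ℕ} {X : Fin N → ℝ} {f : Fin N → ℝ → ℂ}
    (hm : 0 < m) (hΨ : SolvesForcedKG m X f Ψ) (hB : EnergyBoundNear m Ψ κ B) :
    ∫⁻ x, ∫⁻ ξ : ℝ, ‖(ξ : ℂ) * cutFt Ψ κ x ξ‖ₑ ^ 2 ≤
      (ENNReal.ofReal (2 * Real.pi) * (2 * (cutNorm κ * B) +
        2 * (cutNorm (dS κ) * (ENNReal.ofReal (1 / m ^ 2) * B)))) := by
  have hcS := continuous_cutFt hm hΨ.continuousInEnergy hB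
  refine lintegral_lintegral_le_of_tendsto (F := fun n x (ξ : ℝ) => ‖(((n : ℂ) + 1) *
    (Complex.exp (-(Complex.I * ξ * (1 / (n + 1) : ℝ))) - 1)) * cutFt Ψ κ x ξ‖ₑ ^ 2)
    (fun n => ?_) (fun x ξ => ?_) (fun n => ?_)
  · refine Measurable.pow_const ?_ 2
    refine (Continuous.mul ?_ hcS).enorm.measurable
    fun_prop
  · have h1 := ((tendsto_exp_diff_quotient ξ).mul_const (cutFt Ψ κ x ξ)).enorm
    have h2 := (ENNReal.continuous_pow 2).tendsto _ |>.comp h1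
    have h3 : ‖(ξ : ℂ) * cutFt Ψ κ x ξ‖ₑ = ‖-(Complex.I * ξ) * cutFt Ψ κ x ξ‖ₑ := by
      rw [← ofReal_norm, ← ofReal_norm]; simp
    rw [h3]
    exact h2
  · have hn : (0:ℝ) < (n:ℝ) + 1 := by positivity
    have h1 := lintegral_cutFt_time_translate_le hm hΨ hB (h := 1 / ((n : ℝ) + 1)) (by positivity)
      (by rw [div_le_one hn]; linarith [(Nat.cast_nonneg n : (0:ℝ) ≤ n)])
    have hnn : ‖((n : ℂ) + 1)‖ₑ ^ 2 = ENNReal.ofReal (((n : ℝ) + 1) ^ 2) := by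
      rw [← ofReal_norm, ← ENNReal.ofReal_pow (norm_nonneg _)]
      congr 2
      rw [show ((n : ℂ) + 1) = (((n : ℝ) + 1 : ℝ) : ℂ) by push_cast; rfl, Complex.norm_real,
        Real.norm_of_nonneg hn.le]
    simp_rw [mul_assoc ((n : ℂ) + 1), enorm_mul ((n : ℂ) + 1), mul_pow, hnn]
    simp_rw [lintegral_const_mul' _ _ ENNReal.ofReal_ne_top]
    refine (mul_le_mul_right h1 _).trans (le_of_eq ?_)
    rw [← mul_assoc, ← ENNReal.ofReal_mul (by positivity), ← mul_pow, mul_one_div_cancel hn.ne',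
      one_pow, ENNReal.ofReal_one, one_mul]

end CutFt

/-! ### The weak equation in the space variable -/

section WeakODE

variable {m : ℝ} {Ψ : ℝ → EnergyState} {κ : 𝓢(ℝ, ℂ)} {B : ℝ≥0}

theorem continuous_pairing (hm : 0 < m) (hE : ContinuousInEnergy m Ψ) {σ : ℝ → ℂ}
    (hσ : IsTestFunction σ) : Continuous (fun t => ∫ x, (Ψ t).fld x * σ x) := by
  refine continuous_iff_continuousAt.2 fun t => ?_
  obtain ⟨B, hB⟩ := hE.exists_bound (t - 1) (t + 1)
  refine continuousAt_of_dominated (bound := fun x => fldBound m B * ‖σ x‖)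
    (Eventually.of_forall fun s => ?_) ?_ (hσ.integrable.norm.const_mul _)
    (ae_of_all _ fun x => ?_)
  · exact ((Ψ s).continuous_fld.mul hσ.continuous).aestronglyMeasurable
  · filter_upwards [Icc_mem_nhds (by linarith : t - 1 < t) (by linarith : t < t + 1)] with s hs
    refine ae_of_all _ fun x => ?_
    rw [norm_mul]
    gcongr
    exact norm_fld_le_fldBound hm (hB s hs) x
  · exact ((hE.continuous_fld_right hm x).mul continuous_const).continuousAt

theorem norm_pairing_le (hm : 0 < m) {S : EnergyState} (hS : S.energy m ≤ B) {σ : ℝ → ℂ}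
    (hσ : IsTestFunction σ) : ‖∫ x, S.fld x * σ x‖ ≤ fldBound m B * ∫ x, ‖σ x‖ := by
  rw [← integral_const_mul]
  refine norm_integral_le_of_norm_le (hσ.integrable.norm.const_mul _) (ae_of_all _ fun x => ?_)
  rw [norm_mul]
  gcongr
  exact norm_fld_le_fldBound hm hS x

theorem norm_pairing_mom_le {S : EnergyState} (hS : S.energy m ≤ B) {σ : ℝ → ℂ}
    (hσ : IsTestFunction σ) :
    ‖∫ x, S.mom x * σ x‖ ≤ Real.sqrt (B * (∫⁻ x, ‖σ x‖ₑ ^ 2).toReal) := by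
  have hRf : ∫⁻ x, ‖σ x‖ₑ ^ 2 < ⊤ := MemLp.lintegral_sq_lt_top (hσ.memLp 2)
  have h2 : ‖∫ x, S.mom x * σ x‖ₑ ^ 2 ≤ B * ∫⁻ x, ‖σ x‖ₑ ^ 2 := by
    refine (enorm_integral_mul_sq_le S.memLp_mom (hσ.memLp 2)).trans ?_
    gcongr
    exact (S.lintegral_mom_le m).trans hS
  have h3 := ENNReal.toReal_mono (ENNReal.mul_ne_top ENNReal.coe_ne_top hRf.ne) h2
  refine Real.le_sqrt_of_sq_le ?_
  simpa using h3

theorem integral_cutFt_mul (hm : 0 < m) (hE : ContinuousInEnergy m Ψ)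
    (hB : EnergyBoundNear m Ψ κ B) {σ : ℝ → ℂ} (hσ : IsTestFunction σ) (ξ : ℝ) :
    ∫ x, cutFt Ψ κ x ξ * σ x = ft (fun t => κ t * ∫ x, (Ψ t).fld x * σ x) ξ := by
  simp only [cutFt, ft, ← integral_mul_const, ← integral_const_mul]
  rw [integral_integral_swap]
  · congr 1; ext t; congr 1; ext x; ring
  · refine Integrable.mono' ((hσ.integrable.norm.mul_prod κ.integrable.norm).const_mul
      (fldBound m B)) ?_ (ae_of_all _ fun p => ?_)
    · have h1 := continuous_cut (κ := κ) hm hE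
      have h2 := hσ.continuous
      refine Continuous.aestronglyMeasurable ?_
      exact ((by fun_prop : Continuous fun p : ℝ × ℝ => Complex.exp (Complex.I * ξ * p.2)).mul
        h1).mul (h2.comp continuous_fst)
    · simp only [Function.uncurry]
      rw [norm_mul, norm_mul, norm_exp_I_mul, one_mul, norm_mul]
      by_cases ht : p.2 ∈ tsupport κ
      · have := hB.norm_fld_le hm p.1 _ ht
        calc _ ≤ ‖κ p.2‖ * fldBound m B * ‖σ p.1‖ := by gcongr
          _ = _ := by ring
      · simp [image_eq_zero_of_notMem_tsupport ht]

theorem hasDerivAt_exp_mul {g : ℝ → ℂ} {g' : ℂ} {t : ℝ} (ξ : ℝ) (hg : HasDerivAt g g' t) :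
    HasDerivAt (fun s : ℝ => Complex.exp (Complex.I * ξ * s) * g s)
      (Complex.exp (Complex.I * ξ * t) * (Complex.I * ξ * g t + g')) t := by
  have h2 : HasDerivAt (fun s : ℝ => Complex.I * ξ * (s : ℂ)) (Complex.I * ξ) t := by
    simpa using (Complex.ofRealCLM.hasDerivAt (x := t)).const_mul (Complex.I * ξ)
  exact (h2.cexp.fun_mul hg).congr_deriv (by ring)

/-- Integration by parts for the Fourier transform of a cut-off function. -/
theorem ft_cut_deriv {y y1 : ℝ → ℂ} (hy : ∀ t, HasDerivAt y (y1 t) t) (hy1 : Continuous y1)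
    {M M1 : ℝ} (hM : ∀ t ∈ tsupport κ, ‖y t‖ ≤ M) (hM1 : ∀ t ∈ tsupport κ, ‖y1 t‖ ≤ M1) (ξ : ℝ) :
    ft (fun t => κ t * y1 t) ξ =
      -(Complex.I * ξ * ft (fun t => κ t * y t) ξ + ft (fun t => dS κ t * y t) ξ) := by
  have hyc : Continuous y := continuous_iff_continuousAt.2 fun t => (hy t).continuousAt
  have hMd : ∀ t ∈ tsupport (dS κ), ‖y t‖ ≤ M := fun t ht => hM t (tsupport_dS_subset κ ht)
  have i1 := integrable_exp_mul (integrable_schwartz_mul hy1 hM1) ξ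
  have i2 := integrable_exp_mul (integrable_schwartz_mul hyc hM) ξ
  have i3 := integrable_exp_mul (integrable_schwartz_mul hyc hMd) ξ
  have h := integral_mul_deriv_eq_deriv_mul_of_integrable
    (u := fun t : ℝ => Complex.exp (Complex.I * ξ * t) * κ t) (v := y)
    (fun t _ => hasDerivAt_exp_mul ξ (hasDerivAt_schwartz κ t)) (fun t _ => hy t)
    (by refine i1.congr (ae_of_all _ fun t => ?_); simp [mul_assoc])
    (by
      refine ((i2.const_mul (Complex.I * ξ)).add i3).congr (ae_of_all _ fun t => ?_)
      simp only [Pi.add_apply, Pi.mul_apply]; ring)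
    (by refine i2.congr (ae_of_all _ fun t => ?_); simp [mul_assoc])
  simp only [ft]
  rw [← integral_const_mul, ← integral_add (i2.const_mul _) i3]
  calc _ = ∫ t : ℝ, Complex.exp (Complex.I * ξ * t) * κ t * y1 t := by
        congr 1; ext t; ring
    _ = _ := h
    _ = _ := by congr 2; ext t; ring

/-- The commutator term created by the cutoff in time. -/
def remFt (Ψ : ℝ → EnergyState) (κ : 𝓢(ℝ, ℂ)) (x ξ : ℝ) : ℂ :=
  2 * Complex.I * (ξ * cutFt Ψ (dS κ) x ξ) + cutFt Ψ (dS (dS κ)) x ξ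

/-- The second derivative in space of `cutFt` off the points of coupling. -/
def curvFt (m : ℝ) (Ψ : ℝ → EnergyState) (κ : 𝓢(ℝ, ℂ)) (x ξ : ℝ) : ℂ :=
  -((ξ ^ 2 - m ^ 2 : ℝ) * cutFt Ψ κ x ξ) + remFt Ψ κ x ξ

theorem continuous_remFt (hm : 0 < m) (hE : ContinuousInEnergy m Ψ)
    (hB : EnergyBoundNear m Ψ κ B) : Continuous (Function.uncurry (remFt Ψ κ)) := by
  have h1 := continuous_cutFt hm hE hB.deriv
  have h2 := continuous_cutFt hm hE hB.deriv.deriv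
  exact (continuous_const.mul ((by fun_prop : Continuous fun p : ℝ × ℝ => (p.2 : ℂ)).mul h1)).add h2

theorem continuous_curvFt (hm : 0 < m) (hE : ContinuousInEnergy m Ψ)
    (hB : EnergyBoundNear m Ψ κ B) : Continuous (Function.uncurry (curvFt m Ψ κ)) := by
  have h1 := continuous_cutFt hm hE hB
  exact ((by fun_prop : Continuous fun p : ℝ × ℝ => ((p.2 ^ 2 - m ^ 2 : ℝ) : ℂ)).mul h1).neg.add
    (continuous_remFt hm hE hB)

theorem continuous_section {g : ℝ → ℝ → ℂ} (hg : Continuous (Function.uncurry g)) (ξ : ℝ) :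
    Continuous (fun x => g x ξ) := hg.comp (Continuous.prodMk_left ξ)

variable {N : ℕ} {X : Fin N → ℝ} {f : Fin N → ℝ → ℂ}

/-- This is the equation in `x` obtained by a Fourier transform in time. For fixed `ρ` the pairings
satisfy a second order equation in `t`; two integrations by parts against `e^{iξt} κ` produce `-ξ²`
and the commutator terms with `κ'` and `κ''`. -/
theorem integral_cutFt_deriv2 (hm : 0 < m) (hΨ : SolvesForcedKG m X f Ψ)
    (hB : EnergyBoundNear m Ψ κ B) (hfc : ∀ J, Continuous (f J)) {M : ℝ}
    (hf : ∀ J, ∀ t ∈ tsupport κ, ‖f J t‖ ≤ M) {ρ : ℝ → ℂ} (hρ : IsTestFunction ρ) (ξ : ℝ) :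
    ∫ x, cutFt Ψ κ x ξ * deriv (deriv ρ) x =
      (∫ x, curvFt m Ψ κ x ξ * ρ x) - ∑ J, ft (fun t => κ t * f J t) ξ * ρ (X J) := by
  have hE := hΨ.continuousInEnergy
  set y : ℝ → ℂ := fun t => ∫ x, (Ψ t).fld x * ρ x with hy
  set y1 : ℝ → ℂ := fun t => ∫ x, (Ψ t).mom x * ρ x with hy1
  set p : ℝ → ℂ := fun t => ∫ x, (Ψ t).fld x * deriv (deriv ρ) x with hp
  set y2 : ℝ → ℂ := fun t => p t - (m : ℂ) ^ 2 * y t + ∑ J, f J t * ρ (X J) with hy2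
  have hyc : Continuous y := continuous_pairing hm hE hρ
  have hpc : Continuous p := continuous_pairing hm hE hρ.deriv.deriv
  have hy2c : Continuous y2 := by
    refine (hpc.sub (hyc.const_mul _)).add ?_
    exact continuous_finsetSum _ fun J _ => (hfc J).mul continuous_const
  have hd1 : ∀ t, HasDerivAt y (y1 t) t := hΨ.hasDerivAt_fld ρ hρ
  have hd2 : ∀ t, HasDerivAt y1 (y2 t) t := hΨ.hasDerivAt_mom ρ hρ
  have hy1c : Continuous y1 := continuous_iff_continuousAt.2 fun t => (hd2 t).continuousAt
  have by0 : ∀ t ∈ tsupport κ, ‖y t‖ ≤ fldBound m B * ∫ x, ‖ρ x‖ := fun t ht =>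
    norm_pairing_le hm (hB.of_mem ht) hρ
  have bp : ∀ t ∈ tsupport κ, ‖p t‖ ≤ fldBound m B * ∫ x, ‖deriv (deriv ρ) x‖ := fun t ht =>
    norm_pairing_le hm (hB.of_mem ht) hρ.deriv.deriv
  have by1 : ∀ t ∈ tsupport κ, ‖y1 t‖ ≤ Real.sqrt (B * (∫⁻ x, ‖ρ x‖ₑ ^ 2).toReal) :=
    fun t ht => norm_pairing_mom_le (hB.of_mem ht) hρ
  have by2 : ∀ t ∈ tsupport κ, ‖y2 t‖ ≤ fldBound m B * (∫ x, ‖deriv (deriv ρ) x‖) +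
      m ^ 2 * (fldBound m B * ∫ x, ‖ρ x‖) + ∑ J, M * ‖ρ (X J)‖ := by
    intro t ht
    refine (norm_add_le _ _).trans (add_le_add ((norm_sub_le _ _).trans (add_le_add (bp t ht) ?_))
      ((norm_sum_le _ _).trans (Finset.sum_le_sum fun J _ => ?_)))
    · rw [norm_mul, norm_pow, Complex.norm_real, Real.norm_eq_abs, sq_abs]
      gcongr; exact by0 t ht
    · rw [norm_mul]; gcongr; exact hf J t ht
  have e1 := ft_cut_deriv (κ := κ) hd2 hy2c by1 by2 ξ
  have e2 := ft_cut_deriv (κ := κ) hd1 hy1c by0 by1 ξ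
  have e3 := ft_cut_deriv (κ := dS κ) hd1 hy1c (fun t ht => by0 t (tsupport_dS_subset κ ht))
    (fun t ht => by1 t (tsupport_dS_subset κ ht)) ξ
  have ik : ∀ J, Integrable (fun t => κ t * f J t) := fun J =>
    integrable_schwartz_mul (hfc J) (hf J)
  have e4 : ft (fun t => κ t * y2 t) ξ = ft (fun t => κ t * p t) ξ
      - m ^ 2 * ft (fun t => κ t * y t) ξ + ∑ J, ft (fun t => κ t * f J t) ξ * ρ (X J) := by
    have i1 := integrable_schwartz_mul hpc bp
    have i2 := integrable_schwartz_mul hyc by0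
    have e5 : (fun t => κ t * y2 t) = fun t => (κ t * p t - m ^ 2 * (κ t * y t)) +
        ∑ J, ρ (X J) * (κ t * f J t) := by
      ext t; simp only [hy2, mul_add, mul_sub, Finset.mul_sum]
      congr 1
      · ring
      · exact Finset.sum_congr rfl fun J _ => by ring
    have i3 : Integrable (fun t => κ t * p t - m ^ 2 * (κ t * y t)) := i1.sub (i2.const_mul _)
    have i4 : Integrable (fun t => ∑ J, ρ (X J) * (κ t * f J t)) :=
      integrable_finsetSum _ fun J _ => (ik J).const_mul _
    rw [e5, ft_add i3 i4, ft_sub i1 (i2.const_mul _), ft_const_mul]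
    congr 1
    simp only [ft, Finset.mul_sum]
    rw [integral_finsetSum _ fun J _ => integrable_exp_mul ((ik J).const_mul _) ξ]
    refine Finset.sum_congr rfl fun J _ => ?_
    rw [← integral_mul_const]
    congr 1; ext t; ring
  have c0 := integral_cutFt_mul hm hE hB hρ ξ
  have c1 := integral_cutFt_mul hm hE hB.deriv hρ ξ
  have c2 := integral_cutFt_mul hm hE hB.deriv.deriv hρ ξ
  have cp := integral_cutFt_mul hm hE hB hρ.deriv.deriv ξ
  have hint : ∀ κ' : 𝓢(ℝ, ℂ), EnergyBoundNear m Ψ κ' B →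
      Integrable (fun x => cutFt Ψ κ' x ξ * ρ x) := fun κ' h =>
    hρ.integrable_mul (continuous_section (continuous_cutFt hm hE h) ξ).locallyIntegrable
  have ecurv : ∫ x, curvFt m Ψ κ x ξ * ρ x = -((ξ ^ 2 - m ^ 2 : ℝ) * ∫ x, cutFt Ψ κ x ξ * ρ x) +
      (2 * Complex.I * ξ * (∫ x, cutFt Ψ (dS κ) x ξ * ρ x) +
        ∫ x, cutFt Ψ (dS (dS κ)) x ξ * ρ x) := by
    rw [← integral_const_mul, ← integral_const_mul, ← integral_neg, ← integral_add, ← integral_add]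
    · congr 1; ext x; simp only [curvFt, remFt]; ring
    · exact ((hint _ hB).const_mul _).neg
    · exact ((hint _ hB.deriv).const_mul _).add (hint _ hB.deriv.deriv)
    · exact (hint _ hB.deriv).const_mul _
    · exact hint _ hB.deriv.deriv
  rw [ecurv, c0, c1, c2, cp]
  rw [e2, e3] at e1
  rw [e4] at e1
  push_cast
  linear_combination e1 + (ξ : ℂ) ^ 2 * ft (fun t => κ t * y t) ξ * Complex.I_sq

end WeakODE

/-! ### A second order equation with point sources -/

theorem integral_primitive_mul_deriv {P q σ : ℝ → ℂ} (hP : ∀ x, HasDerivAt P (q x) x)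
    (hq : Continuous q) (hσ : IsTestFunction σ) :
    ∫ x, P x * deriv σ x = -∫ x, q x * σ x := by
  have hPc : Continuous P := continuous_iff_continuousAt.2 fun x => (hP x).continuousAt
  exact integral_mul_deriv_eq_deriv_mul_of_integrable (fun x _ => hP x)
    (fun x _ => hσ.hasDerivAt x) (hσ.deriv.integrable_mul hPc.locallyIntegrable)
    (hσ.integrable_mul hq.locallyIntegrable) (hσ.integrable_mul hPc.locallyIntegrable)

/-- The positive part of `x - a` is a fundamental solution of the second derivative with pole at
`a`. -/
theorem integral_hinge_mul {σ : ℝ → ℂ} (hσ : IsTestFunction σ) (a : ℝ) :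
    ∫ x, ((max (x - a) 0 : ℝ) : ℂ) * deriv (deriv σ) x = σ a := by
  have h0 : ∀ x, HasDerivAt (fun x : ℝ => ((x - a : ℝ) : ℂ) * deriv σ x - σ x)
      (((x - a : ℝ) : ℂ) * deriv (deriv σ) x) x := by
    intro x
    have h1 : HasDerivAt (fun x : ℝ => ((x - a : ℝ) : ℂ)) 1 x := by
      simpa using (((hasDerivAt_id x).sub_const a).ofReal_comp)
    exact ((h1.fun_mul (hσ.deriv.hasDerivAt x)).fun_sub (hσ.hasDerivAt x)).congr_deriv (by ring)
  have hc : HasCompactSupport (fun x : ℝ => ((x - a : ℝ) : ℂ) * deriv σ x - σ x) :=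
    (HasCompactSupport.mul_left hσ.deriv.2).sub hσ.2
  have hi : Integrable (fun x : ℝ => ((x - a : ℝ) : ℂ) * deriv (deriv σ) x) :=
    hσ.deriv.deriv.integrable_mul
      (by fun_prop : Continuous fun x : ℝ => ((x - a : ℝ) : ℂ)).locallyIntegrable
  have h1 := integral_Ioi_of_hasDerivAt_of_tendsto' (a := a) (fun x _ => h0 x) hi.integrableOn
    (m := 0) (hc.is_zero_at_infty.mono_left atTop_le_cocompact)
  have h2 : ∫ x, ((max (x - a) 0 : ℝ) : ℂ) * deriv (deriv σ) x =
      ∫ x in Ioi a, ((x - a : ℝ) : ℂ) * deriv (deriv σ) x := by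
    rw [← integral_indicator measurableSet_Ioi]
    congr 1; ext x
    by_cases hx : x ∈ Ioi a
    · rw [indicator_of_mem hx, max_eq_left (by linarith [mem_Ioi.1 hx])]
    · rw [indicator_of_notMem hx, max_eq_right (by simp at hx; linarith)]; simp
  rw [h2, h1]; simp

/-- A primitive of a continuous function. -/
def prim (q : ℝ → ℂ) (x : ℝ) : ℂ := ∫ y in (0)..x, q y

theorem hasDerivAt_prim {q : ℝ → ℂ} (hq : Continuous q) (x : ℝ) : HasDerivAt (prim q) (q x) x :=
  intervalIntegral.integral_hasDerivAt_right (hq.intervalIntegrable _ _)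
    (hq.stronglyMeasurableAtFilter _ _) hq.continuousAt

theorem continuous_prim {q : ℝ → ℂ} (hq : Continuous q) : Continuous (prim q) :=
  continuous_iff_continuousAt.2 fun x => (hasDerivAt_prim hq x).continuousAt

theorem prim_sub_prim {q : ℝ → ℂ} (hq : Continuous q) (a b : ℝ) :
    prim q b - prim q a = ∫ y in a..b, q y :=
  intervalIntegral.integral_interval_sub_left (hq.intervalIntegrable _ _)
    (hq.intervalIntegrable _ _)

/-- `s'' = q - ∑ c_J δ(x - X_J)` in the weak sense. -/
def WeakEq {N : ℕ} (X : Fin N → ℝ) (c : Fin N → ℂ) (s q : ℝ → ℂ) : Prop :=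
  ∀ ρ, IsTestFunction ρ → ∫ x, s x * deriv (deriv ρ) x = (∫ x, q x * ρ x) - ∑ J, c J * ρ (X J)

variable {N : ℕ} {X : Fin N → ℝ} {c : Fin N → ℂ} {s q : ℝ → ℂ}

/-- The double primitive of `q` minus the hinges is a particular solution; what remains has
vanishing second distributional derivative and is affine. -/
theorem WeakEq.exists_repr (h : WeakEq X c s q) (hs : Continuous s) (hq : Continuous q) :
    ∃ α β : ℂ, ∀ x : ℝ, s x = β + x * α + prim (prim q) x -
      ∑ J, c J * ((max (x - X J) 0 : ℝ) : ℂ) := by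
  have hQ := continuous_prim (continuous_prim hq)
  have hw : Continuous (fun x => s x - prim (prim q) x + ∑ J, c J * ((max (x - X J) 0 : ℝ) : ℂ)) := by
    fun_prop
  have h1 := affine_of_weak_deriv2_eq_zero hw (fun ρ hρ => by
    have e1 : ∫ x, prim (prim q) x * deriv (deriv ρ) x = ∫ x, q x * ρ x := by
      rw [integral_primitive_mul_deriv (hasDerivAt_prim (continuous_prim hq)) (continuous_prim hq)
        hρ.deriv, integral_primitive_mul_deriv (hasDerivAt_prim hq) hq hρ, neg_neg]
    have hh : ∀ J, Integrable (fun x => c J * (((max (x - X J) 0 : ℝ) : ℂ) * deriv (deriv ρ) x)) :=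
      fun J => (hρ.deriv.deriv.integrable_mul
        (by fun_prop : Continuous fun x : ℝ => ((max (x - X J) 0 : ℝ) : ℂ)).locallyIntegrable).const_mul _
    have e2 : ∫ x, ∑ J, c J * (((max (x - X J) 0 : ℝ) : ℂ) * deriv (deriv ρ) x) =
        ∑ J, c J * ρ (X J) := by
      rw [integral_finsetSum _ fun J _ => hh J]
      refine Finset.sum_congr rfl fun J _ => ?_
      rw [integral_const_mul, integral_hinge_mul hρ]
    have i1 := hρ.deriv.deriv.integrable_mul hs.locallyIntegrable
    have i2 := hρ.deriv.deriv.integrable_mul hQ.locallyIntegrable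
    have i3 : Integrable (fun x => ∑ J, c J * (((max (x - X J) 0 : ℝ) : ℂ) * deriv (deriv ρ) x)) :=
      integrable_finsetSum _ fun J _ => hh J
    calc _ = ∫ x, ((s x * deriv (deriv ρ) x - prim (prim q) x * deriv (deriv ρ) x) +
          ∑ J, c J * (((max (x - X J) 0 : ℝ) : ℂ) * deriv (deriv ρ) x)) := by
          congr 1; ext x
          rw [add_mul, sub_mul, Finset.sum_mul]
          congr 1
          exact Finset.sum_congr rfl fun J _ => by ring
      _ = 0 := by
          have i12 : Integrable (fun x => s x * deriv (deriv ρ) x -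
            prim (prim q) x * deriv (deriv ρ) x) := i1.sub i2
          rw [integral_add i12 i3, integral_sub i1 i2, e1, e2, h ρ hρ]; ring)
  set w := fun x => s x - prim (prim q) x + ∑ J, c J * ((max (x - X J) 0 : ℝ) : ℂ) with hwdef
  refine ⟨w 1 - w 0, w 0, fun x => ?_⟩
  rw [← h1 x]
  ring

/-- No source lies in the open interval `(a, b)`. -/
def FreeOn (X : Fin N → ℝ) (a b : ℝ) : Prop := ∀ J, X J ∉ Ioo a b

theorem exists_free_radius (X : Fin N → ℝ) (x : ℝ) :
    ∃ ε > 0, FreeOn X x (x + ε) ∧ FreeOn X (x - ε) x := by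
  have h1 : (range X \ {x})ᶜ ∈ 𝓝 x :=
    ((finite_range X).subset sdiff_subset).isClosed.isOpen_compl.mem_nhds (by simp)
  obtain ⟨ε, hε, hb⟩ := Metric.mem_nhds_iff.1 h1
  have h2 : ∀ J, X J ∈ Metric.ball x ε → X J = x := by
    intro J hJ
    by_contra hne
    exact hb hJ ⟨mem_range_self J, hne⟩
  refine ⟨ε, hε, fun J hJ => ?_, fun J hJ => ?_⟩
  · have := h2 J (by rw [Metric.mem_ball, Real.dist_eq, abs_lt]; constructor <;> linarith [hJ.1, hJ.2])
    linarith [hJ.1]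
  · have := h2 J (by rw [Metric.mem_ball, Real.dist_eq, abs_lt]; constructor <;> linarith [hJ.1, hJ.2])
    linarith [hJ.2]

/-- One-sided slopes of the solution of a second order equation with sources. -/
structure Slopes (X : Fin N → ℝ) (c : Fin N → ℂ) (s q sR sL : ℝ → ℂ) : Prop where
  free : ∀ a b, a < b → FreeOn X a b → ∃ D : ℝ → ℂ, (∀ x, HasDerivAt D (q x) x) ∧
    (∀ x ∈ Icc a b, s x = s a + ∫ y in a..x, D y) ∧ (∀ x ∈ Ico a b, sR x = D x) ∧
    ∀ x ∈ Ioc a b, sL x = D x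
  jump : ∀ J, sR (X J) - sL (X J) = -c J

/-- A hinge is affine on an interval that does not contain its corner: of slope 1 if the corner lies
to the left, and zero otherwise. -/
theorem sum_hinge_of_free {a b : ℝ} (h : FreeOn X a b) {x : ℝ} (hx : x ∈ Icc a b) :
    ∑ J, c J * ((max (x - X J) 0 : ℝ) : ℂ) - ∑ J, c J * ((max (a - X J) 0 : ℝ) : ℂ) =
      (x - a : ℝ) * ∑ J, if X J ≤ a then c J else 0 := by
  rw [← Finset.sum_sub_distrib, Finset.mul_sum]
  refine Finset.sum_congr rfl fun J _ => ?_
  have hJ := h J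
  split_ifs with h1
  · rw [max_eq_left (by linarith [hx.1]), max_eq_left (by linarith)]
    push_cast; ring
  · have h2 : b ≤ X J := by
      by_contra h3; exact hJ ⟨not_le.1 h1, not_le.1 h3⟩
    rw [max_eq_right (by linarith [hx.2]), max_eq_right (by linarith [not_le.1 h1])]
    simp

theorem WeakEq.exists_slopes (h : WeakEq X c s q) (hX : Function.Injective X) (hs : Continuous s)
    (hq : Continuous q) : ∃ sR sL, Slopes X c s q sR sL := by
  obtain ⟨α, β, hr⟩ := h.exists_repr hs hq
  -- The right slope counts the sources at or before `x`, the left slope those strictly before `x`.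
  -- They differ at `X J` by the single source located there, since the points are distinct.
  refine ⟨fun x => α + prim q x - ∑ J, if X J ≤ x then c J else 0,
    fun x => α + prim q x - ∑ J, if X J < x then c J else 0, ?_, ?_⟩
  · intro a b hab hfree
    set C := ∑ J, if X J ≤ a then c J else 0 with hC
    refine ⟨fun x => α + prim q x - C, fun x => ((hasDerivAt_prim hq x).const_add α).sub_const C,
      fun x hx => ?_, fun x hx => ?_, fun x hx => ?_⟩
    · have h1 := sum_hinge_of_free (c := c) hfree hx
      have e : ∫ y in a..x, (α + prim q y - C) =
          (prim (prim q) x - prim (prim q) a) + (x - a : ℝ) * (α - C) := by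
        rw [prim_sub_prim (continuous_prim hq)]
        have : (fun y => α + prim q y - C) = fun y => prim q y + (α - C) := by ext y; ring
        rw [this, intervalIntegral.integral_add ((continuous_prim hq).intervalIntegrable _ _)
          (intervalIntegrable_const), intervalIntegral.integral_const, Complex.real_smul]
      rw [e, hr x, hr a]
      push_cast at h1 ⊢
      linear_combination -h1
    · simp only
      congr 1
      refine Finset.sum_congr rfl fun J _ => ?_
      have hJ := hfree J
      congr 1
      simp only [eq_iff_iff]
      refine ⟨fun h1 => ?_, fun h1 => h1.trans hx.1⟩
      by_contra h2
      exact hJ ⟨not_le.1 h2, h1.trans_lt hx.2⟩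
    · simp only
      congr 1
      refine Finset.sum_congr rfl fun J _ => ?_
      have hJ := hfree J
      congr 1
      simp only [eq_iff_iff]
      refine ⟨fun h1 => ?_, fun h1 => h1.trans_lt hx.1⟩
      by_contra h2
      exact hJ ⟨not_le.1 h2, h1.trans_le hx.2⟩
  · intro J
    have : ∀ K, (if X K ≤ X J then c K else 0) = (if X K < X J then c K else 0) +
        if K = J then c K else 0 := by
      intro K
      by_cases hK : K = J
      · subst hK; simp
      · have : X K ≠ X J := fun h => hK (hX h)
        simp only [hK, if_false, add_zero, le_iff_lt_or_eq, this, or_false]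
    simp only [this, Finset.sum_add_distrib, Finset.sum_ite_eq', Finset.mem_univ, if_true]
    ring

theorem tendsto_one_div_nhdsGT : Tendsto (fun n : ℕ => (1 / ((n : ℝ) + 1))) atTop (𝓝[>] 0) :=
  tendsto_nhdsWithin_iff.2 ⟨tendsto_one_div_add_atTop_nhds_zero_nat,
    Eventually.of_forall fun n => by simp only [mem_Ioi]; positivity⟩

namespace Slopes

variable {sR sL : ℝ → ℂ}

theorem hasDerivAt_integral {a : ℝ} {D : ℝ → ℂ} (hD : ∀ x, HasDerivAt D (q x) x) (x : ℝ) :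
    HasDerivAt (fun x => s a + ∫ y in a..x, D y) (D x) x := by
  have hc : Continuous D := continuous_iff_continuousAt.2 fun x => (hD x).continuousAt
  exact (intervalIntegral.integral_hasDerivAt_right (hc.intervalIntegrable _ _)
    (hc.stronglyMeasurableAtFilter _ _) hc.continuousAt).const_add _

/-- The slopes are limits of difference quotients along a fixed sequence of steps. This makes them
jointly measurable in `x` and `ξ` and accessible to Fatou's lemma. -/
theorem tendsto_right (h : Slopes X c s q sR sL) (x : ℝ) :
    Tendsto (fun n : ℕ => ((n : ℂ) + 1) * (s (x + 1 / ((n : ℝ) + 1)) - s x)) atTop (𝓝 (sR x)) := by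
  obtain ⟨ε, hε, hf, -⟩ := exists_free_radius X x
  obtain ⟨D, hD, hs, hR, -⟩ := h.free x (x + ε) (by linarith) hf
  have h1 := (hasDerivAt_integral (s := s) (a := x) hD x).tendsto_slope_zero_right
  rw [hR x ⟨le_rfl, by linarith⟩]
  refine (h1.comp tendsto_one_div_nhdsGT).congr' ?_
  have h2 : ∀ᶠ n : ℕ in atTop, 1 / ((n : ℝ) + 1) < ε :=
    tendsto_one_div_add_atTop_nhds_zero_nat.eventually_lt_const hε
  filter_upwards [h2] with n hn
  have hn0 : 0 < 1 / ((n : ℝ) + 1) := by positivity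
  simp only [Function.comp]
  rw [← hs _ ⟨by linarith, by linarith⟩, ← hs x ⟨le_rfl, by linarith⟩, Complex.real_smul]
  push_cast
  rw [one_div, inv_inv]

theorem tendsto_left (h : Slopes X c s q sR sL) (x : ℝ) :
    Tendsto (fun n : ℕ => ((n : ℂ) + 1) * (s x - s (x - 1 / ((n : ℝ) + 1)))) atTop (𝓝 (sL x)) := by
  obtain ⟨ε, hε, -, hf⟩ := exists_free_radius X x
  obtain ⟨D, hD, hs, -, hL⟩ := h.free (x - ε) x (by linarith) hf
  have h1 := (hasDerivAt_integral (s := s) (a := x - ε) hD x).tendsto_slope_zero_left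
  rw [hL x ⟨by linarith, le_rfl⟩]
  have h0 : Tendsto (fun n : ℕ => -(1 / ((n : ℝ) + 1))) atTop (𝓝[<] 0) := by
    refine tendsto_nhdsWithin_iff.2 ⟨?_, Eventually.of_forall fun n => ?_⟩
    · simpa using (tendsto_one_div_add_atTop_nhds_zero_nat (𝕜 := ℝ)).neg
    · simp only [mem_Iio, Left.neg_neg_iff]; positivity
  refine (h1.comp h0).congr' ?_
  have h2 : ∀ᶠ n : ℕ in atTop, 1 / ((n : ℝ) + 1) < ε :=
    tendsto_one_div_add_atTop_nhds_zero_nat.eventually_lt_const hε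
  filter_upwards [h2] with n hn
  have hn0 : 0 < 1 / ((n : ℝ) + 1) := by positivity
  simp only [Function.comp]
  rw [← hs _ ⟨by linarith, by linarith⟩, ← hs x ⟨by linarith, le_rfl⟩, Complex.real_smul,
    ← sub_eq_add_neg]
  push_cast
  rw [inv_neg, one_div, inv_inv]
  ring

/-- The energy density in the space direction. -/
def sideEnergy (k2 : ℝ) (D s : ℂ) : ℝ≥0∞ := ‖D‖ₑ ^ 2 + ENNReal.ofReal k2 * ‖s‖ₑ ^ 2

theorem ofReal_sideEnergy {k2 : ℝ} (hk : 0 ≤ k2) (D s : ℂ) :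
    sideEnergy k2 D s = ENNReal.ofReal (‖D‖ ^ 2 + k2 * ‖s‖ ^ 2) := by
  rw [sideEnergy, ENNReal.ofReal_add (by positivity) (by positivity), ENNReal.ofReal_mul hk,
    ENNReal.ofReal_pow (norm_nonneg _), ENNReal.ofReal_pow (norm_nonneg _), ofReal_norm,
    ofReal_norm]

/-- Variation of the energy density along a free interval. -/
theorem sideEnergy_le {a b : ℝ} {D r : ℝ → ℂ} {k2 : ℝ} (hk : 0 ≤ k2)
    (hr : Continuous r) (hD : ∀ x, HasDerivAt D (q x) x)
    (hsD : ∀ x ∈ Icc a b, s x = s a + ∫ y in a..x, D y)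
    (hq : ∀ x ∈ Icc a b, q x = -((k2 : ℂ) * s x) + r x) (hqc : Continuous q)
    {L : ℝ} (hL : 0 < L) {x y : ℝ} (hx : x ∈ Icc a b) (hy : y ∈ Icc a b) :
    sideEnergy k2 (D x) (s x) ≤ sideEnergy k2 (D y) (s y) +
      ∫⁻ z in Icc a b, (ENNReal.ofReal L⁻¹ * ‖D z‖ₑ ^ 2 + ENNReal.ofReal L * ‖r z‖ₑ ^ 2) := by
  have hDc : Continuous D := continuous_iff_continuousAt.2 fun x => (hD x).continuousAt
  set S : ℝ → ℂ := fun x => s a + ∫ y in a..x, D y with hS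
  have hSd : ∀ x, HasDerivAt S (D x) x := fun x => hasDerivAt_integral hD x
  have hSc : Continuous S := continuous_iff_continuousAt.2 fun x => (hSd x).continuousAt
  set g : ℝ → ℝ := fun x => 2 * inner ℝ (D x) (q x) + k2 * (2 * inner ℝ (S x) (D x)) with hg
  have hgc : Continuous g := by fun_prop
  have hG : ∀ x, HasDerivAt (fun x => ‖D x‖ ^ 2 + k2 * ‖S x‖ ^ 2) (g x) x := fun x =>
    ((hD x).norm_sq).add (((hSd x).norm_sq).const_mul k2)
  -- In the derivative of the density the terms with `k2` cancel by the equation and only `2⟨D, r⟩`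
  -- is left. The weight `L` in the splitting of this product will be the length of the averaging
  -- interval.
  have hgb : ∀ z ∈ Icc a b, |g z| ≤ L⁻¹ * ‖D z‖ ^ 2 + L * ‖r z‖ ^ 2 := by
    intro z hz
    have e : g z = 2 * inner ℝ (D z) (r z) := by
      have h1 : ((k2 : ℂ) * s z) = k2 • s z := (Complex.real_smul).symm
      have h2 : S z = s z := (hsD z hz).symm
      simp only [hg]
      rw [hq z hz, h1, h2, inner_add_right, inner_neg_right, real_inner_smul_right,
        real_inner_comm (D z) (s z)]
      ring
    rw [e, abs_mul, abs_two]
    have h3 := abs_real_inner_le_norm (D z) (r z)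
    have h4 : 0 ≤ L⁻¹ * (‖D z‖ - L * ‖r z‖) ^ 2 := by positivity
    have h5 : L⁻¹ * (‖D z‖ - L * ‖r z‖) ^ 2 =
        L⁻¹ * ‖D z‖ ^ 2 + L * ‖r z‖ ^ 2 - 2 * (‖D z‖ * ‖r z‖) := by
      field_simp; ring
    linarith
  have hbc : Continuous fun z => L⁻¹ * ‖D z‖ ^ 2 + L * ‖r z‖ ^ 2 := by fun_prop
  have hsub : uIoc y x ⊆ Icc a b := by
    refine (uIoc_subset_uIcc).trans ?_
    exact uIcc_subset_Icc hy hx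
  have hI : ∫ z in uIoc y x, (L⁻¹ * ‖D z‖ ^ 2 + L * ‖r z‖ ^ 2) ≤
      ∫ z in Icc a b, (L⁻¹ * ‖D z‖ ^ 2 + L * ‖r z‖ ^ 2) := by
    refine setIntegral_mono_set (hbc.integrableOn_Icc) (ae_of_all _ fun z => ?_)
      (Eventually.of_forall hsub)
    simp only [Pi.zero_apply]; positivity
  have hdiff : (‖D x‖ ^ 2 + k2 * ‖S x‖ ^ 2) - (‖D y‖ ^ 2 + k2 * ‖S y‖ ^ 2) ≤
      ∫ z in Icc a b, (L⁻¹ * ‖D z‖ ^ 2 + L * ‖r z‖ ^ 2) := by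
    have h1 := intervalIntegral.integral_eq_sub_of_hasDerivAt (a := y) (b := x)
      (fun z _ => hG z) (hgc.intervalIntegrable _ _)
    rw [← h1]
    refine (le_abs_self _).trans ?_
    rw [← Real.norm_eq_abs]
    refine (intervalIntegral.norm_integral_le_integral_norm_uIoc).trans ?_
    refine le_trans ?_ hI
    refine setIntegral_mono_on (hgc.norm.integrableOn_uIcc.mono_set uIoc_subset_uIcc)
      (hbc.integrableOn_uIcc.mono_set uIoc_subset_uIcc) measurableSet_uIoc ?_
    exact fun z hz => hgb z (hsub hz)
  rw [ofReal_sideEnergy hk, ofReal_sideEnergy hk, hsD x hx, hsD y hy]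
  have e1 : ∀ z, ENNReal.ofReal L⁻¹ * ‖D z‖ₑ ^ 2 + ENNReal.ofReal L * ‖r z‖ₑ ^ 2 =
      ENNReal.ofReal (L⁻¹ * ‖D z‖ ^ 2 + L * ‖r z‖ ^ 2) := by
    intro z
    rw [ENNReal.ofReal_add (by positivity) (by positivity), ENNReal.ofReal_mul (by positivity),
      ENNReal.ofReal_mul hL.le, ENNReal.ofReal_pow (norm_nonneg _),
      ENNReal.ofReal_pow (norm_nonneg _), ofReal_norm, ofReal_norm]
  simp_rw [e1]
  rw [← ofReal_integral_eq_lintegral_ofReal (hbc.integrableOn_Icc)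
    (ae_of_all _ fun z => by simp only [Pi.zero_apply]; positivity), ← ENNReal.ofReal_add
    (by positivity) (integral_nonneg fun z => by simp only [Pi.zero_apply]; positivity)]
  refine ENNReal.ofReal_le_ofReal ?_
  simp only [hS] at hdiff
  linarith

end Slopes

/-! ### The energy estimate in the space direction -/

section Sideways

open Slopes

variable {m : ℝ} {Ψ : ℝ → EnergyState} {κ : 𝓢(ℝ, ℂ)} {B : ℝ≥0}
variable {N : ℕ} {X : Fin N → ℝ} {f : Fin N → ℝ → ℂ}

/-- One-sided derivatives in `x` of the cut-off Fourier transform of the field. -/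
def FieldSlopes (m : ℝ) (X : Fin N → ℝ) (f : Fin N → ℝ → ℂ) (Ψ : ℝ → EnergyState) (κ : 𝓢(ℝ, ℂ))
    (sR sL : ℝ → ℝ → ℂ) : Prop :=
  ∀ ξ, Slopes X (fun J => ft (fun t => κ t * f J t) ξ) (fun x => cutFt Ψ κ x ξ)
    (fun x => curvFt m Ψ κ x ξ) (fun x => sR x ξ) (fun x => sL x ξ)

theorem exists_fieldSlopes (hm : 0 < m) (hX : Function.Injective X) (hΨ : SolvesForcedKG m X f Ψ)
    (hB : EnergyBoundNear m Ψ κ B) (hfc : ∀ J, Continuous (f J)) {M : ℝ}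
    (hf : ∀ J, ∀ t ∈ tsupport κ, ‖f J t‖ ≤ M) : ∃ sR sL, FieldSlopes m X f Ψ κ sR sL := by
  have h : ∀ ξ, ∃ sR sL, Slopes X (fun J => ft (fun t => κ t * f J t) ξ)
      (fun x => cutFt Ψ κ x ξ) (fun x => curvFt m Ψ κ x ξ) sR sL := fun ξ =>
    WeakEq.exists_slopes (fun ρ hρ => integral_cutFt_deriv2 hm hΨ hB hfc hf hρ ξ) hX
      (continuous_section (continuous_cutFt hm hΨ.continuousInEnergy hB) ξ)
      (continuous_section (continuous_curvFt hm hΨ.continuousInEnergy hB) ξ)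
  choose sR sL h using h
  exact ⟨fun x ξ => sR ξ x, fun x ξ => sL ξ x, h⟩

/-- The quantity controlling the variation of the energy density in `x`. -/
def sideRem (Ψ : ℝ → EnergyState) (κ : 𝓢(ℝ, ℂ)) (sR : ℝ → ℝ → ℂ) (L ξ : ℝ) : ℝ≥0∞ :=
  ∫⁻ x, (ENNReal.ofReal L⁻¹ * (2 * ‖sR x ξ‖ₑ ^ 2 + ‖(ξ : ℂ) * cutFt Ψ κ x ξ‖ₑ ^ 2) +
    ENNReal.ofReal L * ‖remFt Ψ κ x ξ‖ₑ ^ 2)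

variable {sR sL : ℝ → ℝ → ℂ}

theorem sq_sub_sq_nonneg {ξ : ℝ} (hm : 0 < m) (hξ : m < |ξ|) : 0 ≤ ξ ^ 2 - m ^ 2 := by
  rw [← sq_abs ξ]; nlinarith

theorem setLIntegral_congr_slope {a b : ℝ} {D : ℝ → ℂ} {ξ : ℝ}
    (hR : ∀ x ∈ Ico a b, sR x ξ = D x) (G : ℝ → ℂ → ℝ≥0∞) :
    ∫⁻ z in Icc a b, G z (D z) = ∫⁻ z in Icc a b, G z (sR z ξ) := by
  rw [setLIntegral_congr (Ico_ae_eq_Icc (μ := volume) (a := a) (b := b)).symm,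
    setLIntegral_congr (Ico_ae_eq_Icc (μ := volume) (a := a) (b := b)).symm]
  exact setLIntegral_congr_fun measurableSet_Ico fun x hx => by simp only [hR x hx]

/-- The density is compared at two points in either order, through the smooth interior derivative
`D`, which is the right slope at `a` and the left slope at `b`. Both directions of propagation and
the averaging argument follow from it. -/
theorem sideEnergy_free (hm : 0 < m) (hΨ : SolvesForcedKG m X f Ψ)
    (hB : EnergyBoundNear m Ψ κ B) (hS : FieldSlopes m X f Ψ κ sR sL) {L : ℝ} (hL : 0 < L)
    {ξ : ℝ} (hξ : m < |ξ|) {a b : ℝ} (hab : a < b) (hfree : FreeOn X a b) :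
    ∃ D : ℝ → ℂ, D a = sR a ξ ∧ D b = sL b ξ ∧ (∀ x ∈ Ico a b, sR x ξ = D x) ∧
      ∀ x ∈ Icc a b, ∀ y ∈ Icc a b, sideEnergy (ξ ^ 2 - m ^ 2) (D x) (cutFt Ψ κ x ξ) ≤
        sideEnergy (ξ ^ 2 - m ^ 2) (D y) (cutFt Ψ κ y ξ) +
        ∫⁻ z in Icc a b, (ENNReal.ofReal L⁻¹ * ‖sR z ξ‖ₑ ^ 2 +
          ENNReal.ofReal L * ‖remFt Ψ κ z ξ‖ₑ ^ 2) := by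
  have hE := hΨ.continuousInEnergy
  obtain ⟨D, hD, hs, hR, hLe⟩ := (hS ξ).free a b hab hfree
  refine ⟨D, (hR a ⟨le_rfl, hab⟩).symm, (hLe b ⟨hab, le_rfl⟩).symm, hR, fun x hx y hy => ?_⟩
  have h := sideEnergy_le (q := fun x => curvFt m Ψ κ x ξ) (s := fun x => cutFt Ψ κ x ξ)
    (r := fun x => remFt Ψ κ x ξ) (sq_sub_sq_nonneg hm hξ)
    (continuous_section (continuous_remFt hm hE hB) ξ) hD hs (fun x _ => rfl)
    (continuous_section (continuous_curvFt hm hE hB) ξ) hL hx hy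
  rwa [setLIntegral_congr_slope hR (fun z d => ENNReal.ofReal L⁻¹ * ‖d‖ₑ ^ 2 +
    ENNReal.ofReal L * ‖remFt Ψ κ z ξ‖ₑ ^ 2)] at h

theorem setLIntegral_le_sideRem {L ξ : ℝ} (s : Set ℝ) :
    ∫⁻ z in s, (ENNReal.ofReal L⁻¹ * ‖sR z ξ‖ₑ ^ 2 + ENNReal.ofReal L * ‖remFt Ψ κ z ξ‖ₑ ^ 2) ≤
      sideRem Ψ κ sR L ξ := by
  refine (setLIntegral_le_lintegral _ _).trans (lintegral_mono fun x => ?_)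
  gcongr
  rw [two_mul, add_assoc]
  exact le_self_add

theorem sideEnergy_left_le (hm : 0 < m) (hΨ : SolvesForcedKG m X f Ψ)
    (hB : EnergyBoundNear m Ψ κ B) (hS : FieldSlopes m X f Ψ κ sR sL) {L : ℝ} (hL : 0 < L)
    {ξ : ℝ} (hξ : m < |ξ|) {a b : ℝ} (hab : a < b) (hfree : FreeOn X a b) :
    sideEnergy (ξ ^ 2 - m ^ 2) (sL b ξ) (cutFt Ψ κ b ξ) ≤
      sideEnergy (ξ ^ 2 - m ^ 2) (sR a ξ) (cutFt Ψ κ a ξ) + sideRem Ψ κ sR L ξ := by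
  obtain ⟨D, ha, hb, -, h⟩ := sideEnergy_free hm hΨ hB hS hL hξ hab hfree
  rw [← ha, ← hb]
  exact (h b ⟨hab.le, le_rfl⟩ a ⟨le_rfl, hab.le⟩).trans
    (add_le_add_right (setLIntegral_le_sideRem _) _)

theorem sideEnergy_right_le (hm : 0 < m) (hΨ : SolvesForcedKG m X f Ψ)
    (hB : EnergyBoundNear m Ψ κ B) (hS : FieldSlopes m X f Ψ κ sR sL) {L : ℝ} (hL : 0 < L)
    {ξ : ℝ} (hξ : m < |ξ|) {a b : ℝ} (hab : a < b) (hfree : FreeOn X a b) :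
    sideEnergy (ξ ^ 2 - m ^ 2) (sR a ξ) (cutFt Ψ κ a ξ) ≤
      sideEnergy (ξ ^ 2 - m ^ 2) (sL b ξ) (cutFt Ψ κ b ξ) + sideRem Ψ κ sR L ξ := by
  obtain ⟨D, ha, hb, -, h⟩ := sideEnergy_free hm hΨ hB hS hL hξ hab hfree
  rw [← ha, ← hb]
  exact (h a ⟨le_rfl, hab.le⟩ b ⟨hab.le, le_rfl⟩).trans
    (add_le_add_right (setLIntegral_le_sideRem _) _)

theorem measurable_slopeR (hm : 0 < m) (hΨ : SolvesForcedKG m X f Ψ)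
    (hB : EnergyBoundNear m Ψ κ B) (hS : FieldSlopes m X f Ψ κ sR sL) :
    Measurable (Function.uncurry sR) := by
  have hc := continuous_cutFt hm hΨ.continuousInEnergy hB
  refine measurable_of_tendsto_metrizable (f := fun (n : ℕ) (p : ℝ × ℝ) => ((n : ℂ) + 1) *
    (cutFt Ψ κ (p.1 + 1 / ((n : ℝ) + 1)) p.2 - cutFt Ψ κ p.1 p.2)) (fun n => ?_)
    (tendsto_pi_nhds.2 fun p => (hS p.2).tendsto_right p.1)
  refine (continuous_const.mul (Continuous.sub ?_ hc)).measurable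
  exact hc.comp (by fun_prop : Continuous fun p : ℝ × ℝ => (p.1 + 1 / ((n : ℝ) + 1), p.2))

theorem measurable_slopeL (hm : 0 < m) (hΨ : SolvesForcedKG m X f Ψ)
    (hB : EnergyBoundNear m Ψ κ B) (hS : FieldSlopes m X f Ψ κ sR sL) :
    Measurable (Function.uncurry sL) := by
  have hc := continuous_cutFt hm hΨ.continuousInEnergy hB
  refine measurable_of_tendsto_metrizable (f := fun (n : ℕ) (p : ℝ × ℝ) => ((n : ℂ) + 1) *
    (cutFt Ψ κ p.1 p.2 - cutFt Ψ κ (p.1 - 1 / ((n : ℝ) + 1)) p.2)) (fun n => ?_)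
    (tendsto_pi_nhds.2 fun p => (hS p.2).tendsto_left p.1)
  refine (continuous_const.mul (Continuous.sub hc ?_)).measurable
  exact hc.comp (by fun_prop : Continuous fun p : ℝ × ℝ => (p.1 - 1 / ((n : ℝ) + 1), p.2))

/-- The energy density at a point is bounded by its average over an adjacent free interval. -/
theorem sideEnergy_average (hm : 0 < m) (hΨ : SolvesForcedKG m X f Ψ)
    (hB : EnergyBoundNear m Ψ κ B) (hS : FieldSlopes m X f Ψ κ sR sL) {L : ℝ} (hL : 0 < L)
    {ξ : ℝ} (hξ : m < |ξ|) {a : ℝ} (hfree : FreeOn X a (a + L)) :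
    sideEnergy (ξ ^ 2 - m ^ 2) (sR a ξ) (cutFt Ψ κ a ξ) ≤ sideRem Ψ κ sR L ξ ∧
    sideEnergy (ξ ^ 2 - m ^ 2) (sL (a + L) ξ) (cutFt Ψ κ (a + L) ξ) ≤ sideRem Ψ κ sR L ξ := by
  have hab : a < a + L := by linarith
  obtain ⟨D, ha, hb, hR, h⟩ := sideEnergy_free hm hΨ hB hS hL hξ hab hfree
  have key : ∀ x ∈ Icc a (a + L), sideEnergy (ξ ^ 2 - m ^ 2) (D x) (cutFt Ψ κ x ξ) ≤
      sideRem Ψ κ sR L ξ := by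
    intro x hx
    set V := ∫⁻ z in Icc a (a + L), (ENNReal.ofReal L⁻¹ * ‖sR z ξ‖ₑ ^ 2 +
          ENNReal.ofReal L * ‖remFt Ψ κ z ξ‖ₑ ^ 2) with hV
    -- The comparison is integrated over the reference point and divided by `L`. The average of the
    -- density contributes `L⁻¹ |sR|²` and the variation along the interval contributes it once
    -- more, hence the factor 2 in `sideRem`.
    have h1 := setLIntegral_mono' (μ := volume) measurableSet_Icc (h x hx)
    rw [setLIntegral_const, Real.volume_Icc, add_sub_cancel_left,
      lintegral_add_right _ measurable_const, setLIntegral_const, Real.volume_Icc,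
      add_sub_cancel_left, setLIntegral_congr_slope hR
        (fun z d => sideEnergy (ξ ^ 2 - m ^ 2) d (cutFt Ψ κ z ξ))] at h1
    have h2 := mul_le_mul_right h1 (ENNReal.ofReal L⁻¹)
    have hLL : ENNReal.ofReal L⁻¹ * ENNReal.ofReal L = 1 := by
      rw [← ENNReal.ofReal_mul (by positivity), inv_mul_cancel₀ hL.ne', ENNReal.ofReal_one]
    rw [mul_comm _ (ENNReal.ofReal L), ← mul_assoc, hLL, one_mul, mul_add,
      mul_comm V, ← mul_assoc, hLL, one_mul] at h2
    refine h2.trans ?_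
    rw [hV, ← lintegral_const_mul' _ _ ENNReal.ofReal_ne_top, ← lintegral_add_left]
    · refine (setLIntegral_le_lintegral _ _).trans (lintegral_mono fun z => ?_)
      have hk : ENNReal.ofReal (ξ ^ 2 - m ^ 2) * ‖cutFt Ψ κ z ξ‖ₑ ^ 2 ≤
          ‖(ξ : ℂ) * cutFt Ψ κ z ξ‖ₑ ^ 2 := by
        rw [enorm_mul, mul_pow]
        gcongr
        rw [← ofReal_norm, ← ENNReal.ofReal_pow (norm_nonneg _), Complex.norm_real,
          Real.norm_eq_abs, sq_abs]
        exact ENNReal.ofReal_le_ofReal (by linarith [sq_nonneg m])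
      calc _ ≤ ENNReal.ofReal L⁻¹ * (‖sR z ξ‖ₑ ^ 2 + ‖(ξ : ℂ) * cutFt Ψ κ z ξ‖ₑ ^ 2) +
            (ENNReal.ofReal L⁻¹ * ‖sR z ξ‖ₑ ^ 2 + ENNReal.ofReal L * ‖remFt Ψ κ z ξ‖ₑ ^ 2) := by
            simp only [sideEnergy]; gcongr
        _ = _ := by ring
    · have h3 := (measurable_slopeR hm hΨ hB hS).comp (measurable_prodMk_right (y := ξ))
      have h4 := (continuous_section (continuous_cutFt hm hΨ.continuousInEnergy hB) ξ).measurable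
      exact ((h3.enorm.pow_const 2).add ((h4.enorm.pow_const 2).const_mul _)).const_mul _
  constructor
  · rw [← ha]; exact key a ⟨le_rfl, hab.le⟩
  · rw [← hb]; exact key (a + L) ⟨hab.le, le_rfl⟩

/-- The bound for the integral of `sideRem`. -/
def sideConst (m : ℝ) (κ : 𝓢(ℝ, ℂ)) (B : ℝ≥0) (L : ℝ) : ℝ≥0∞ :=
  ENNReal.ofReal L⁻¹ * (2 * (ENNReal.ofReal (2 * Real.pi) * (cutNorm κ * B)) +
    (ENNReal.ofReal (2 * Real.pi) * (2 * (cutNorm κ * B) +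
        2 * (cutNorm (dS κ) * (ENNReal.ofReal (1 / m ^ 2) * B))))) +
  ENNReal.ofReal L * (8 * (ENNReal.ofReal (2 * Real.pi) * (2 * (cutNorm (dS κ) * B) +
        2 * (cutNorm (dS (dS κ)) * (ENNReal.ofReal (1 / m ^ 2) * B)))) +
    2 * (ENNReal.ofReal (2 * Real.pi) * (cutNorm (dS (dS κ)) * (ENNReal.ofReal (1 / m ^ 2) * B))))

/-- Fatou's lemma for the space difference quotients bounded by `lintegral_cutFt_translate_le`. -/
theorem lintegral_slopeR_le (hm : 0 < m) (hΨ : SolvesForcedKG m X f Ψ)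
    (hB : EnergyBoundNear m Ψ κ B) (hS : FieldSlopes m X f Ψ κ sR sL) :
    ∫⁻ x, ∫⁻ ξ, ‖sR x ξ‖ₑ ^ 2 ≤ ENNReal.ofReal (2 * Real.pi) * (cutNorm κ * B) := by
  have hE := hΨ.continuousInEnergy
  have hc := continuous_cutFt hm hE hB
  refine lintegral_lintegral_le_of_tendsto (F := fun n x ξ => ‖((n : ℂ) + 1) *
    (cutFt Ψ κ (x + 1 / ((n : ℝ) + 1)) ξ - cutFt Ψ κ x ξ)‖ₑ ^ 2)
    (fun n => ?_) (fun x ξ => ?_) (fun n => ?_)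
  · refine ((continuous_const.mul (Continuous.sub ?_ hc)).enorm.measurable).pow_const 2
    exact hc.comp (by fun_prop : Continuous fun p : ℝ × ℝ => (p.1 + 1 / ((n : ℝ) + 1), p.2))
  · exact (ENNReal.continuous_pow 2).tendsto _ |>.comp ((hS ξ).tendsto_right x).enorm
  · have hn : (0:ℝ) < (n:ℝ) + 1 := by positivity
    have h1 := lintegral_cutFt_translate_le hm hE hB (h := 1 / ((n : ℝ) + 1)) (by positivity)
    have hnn : ‖((n : ℂ) + 1)‖ₑ ^ 2 = ENNReal.ofReal (((n : ℝ) + 1) ^ 2) := by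
      rw [← ofReal_norm, ← ENNReal.ofReal_pow (norm_nonneg _)]
      congr 2
      rw [show ((n : ℂ) + 1) = (((n : ℝ) + 1 : ℝ) : ℂ) by push_cast; rfl, Complex.norm_real,
        Real.norm_of_nonneg hn.le]
    simp_rw [enorm_mul ((n : ℂ) + 1), mul_pow, hnn, lintegral_const_mul' _ _ ENNReal.ofReal_ne_top]
    refine (mul_le_mul_right h1 _).trans (le_of_eq ?_)
    have h2 : ENNReal.ofReal (((n : ℝ) + 1) ^ 2) * ENNReal.ofReal ((1 / ((n : ℝ) + 1)) ^ 2) = 1 := by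
      rw [← ENNReal.ofReal_mul (by positivity), ← mul_pow, mul_one_div_cancel hn.ne',
        one_pow, ENNReal.ofReal_one]
    calc _ = (ENNReal.ofReal (((n : ℝ) + 1) ^ 2) * ENNReal.ofReal ((1 / ((n : ℝ) + 1)) ^ 2)) *
          (ENNReal.ofReal (2 * Real.pi) * (cutNorm κ * B)) := by ring
      _ = _ := by rw [h2, one_mul]

theorem lintegral_remFt_le (hm : 0 < m) (hΨ : SolvesForcedKG m X f Ψ)
    (hB : EnergyBoundNear m Ψ κ B) :
    ∫⁻ x, ∫⁻ ξ, ‖remFt Ψ κ x ξ‖ₑ ^ 2 ≤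
      8 * (ENNReal.ofReal (2 * Real.pi) * (2 * (cutNorm (dS κ) * B) +
        2 * (cutNorm (dS (dS κ)) * (ENNReal.ofReal (1 / m ^ 2) * B)))) +
      2 * (ENNReal.ofReal (2 * Real.pi) * (cutNorm (dS (dS κ)) *
        (ENNReal.ofReal (1 / m ^ 2) * B))) := by
  have hE := hΨ.continuousInEnergy
  have h1 := lintegral_sq_mul_cutFt_le hm hΨ hB.deriv
  have h2 := lintegral_cutFt_le hm hE hB.deriv.deriv
  have c1 := continuous_cutFt hm hE hB.deriv
  have c1' : Continuous (Function.uncurry fun (x ξ : ℝ) => (ξ : ℂ) * cutFt Ψ (dS κ) x ξ) :=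
    (by fun_prop : Continuous fun p : ℝ × ℝ => (p.2 : ℂ)).mul c1
  calc _ ≤ ∫⁻ x, ∫⁻ ξ : ℝ, (8 * ‖(ξ : ℂ) * cutFt Ψ (dS κ) x ξ‖ₑ ^ 2 +
        2 * ‖cutFt Ψ (dS (dS κ)) x ξ‖ₑ ^ 2) := by
        refine lintegral_mono fun x => lintegral_mono fun ξ => ?_
        refine (enorm_add_sq_le _ _).trans (le_of_eq ?_)
        have h2I : ‖2 * Complex.I‖ₑ = 2 := by
          rw [← ofReal_norm]; simp
        have h8 : (2 : ℝ≥0∞) * 2 ^ 2 = 8 := by norm_num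
        rw [enorm_mul, mul_pow, ← mul_assoc, h2I, h8]
    _ = 8 * (∫⁻ x, ∫⁻ ξ : ℝ, ‖(ξ : ℂ) * cutFt Ψ (dS κ) x ξ‖ₑ ^ 2) +
        2 * ∫⁻ x, ∫⁻ ξ, ‖cutFt Ψ (dS (dS κ)) x ξ‖ₑ ^ 2 := by
        rw [← lintegral_const_mul' _ _ (by simp), ← lintegral_const_mul' _ _ (by simp),
          ← lintegral_add_left]
        · refine lintegral_congr fun x => ?_
          rw [lintegral_add_left, lintegral_const_mul' _ _ (by simp),
            lintegral_const_mul' _ _ (by simp)]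
          exact ((c1'.comp (Continuous.prodMk_right x)).enorm.measurable.pow_const 2).const_mul 8
        · exact ((c1'.enorm.measurable.pow_const 2).lintegral_prod_right').const_mul 8
    _ ≤ _ := by gcongr

theorem lintegral_comb {a b : ℝ≥0∞} (ha : a ≠ ⊤) (hb : b ≠ ⊤) {g₁ g₂ g₃ : ℝ → ℝ≥0∞}
    (h1 : Measurable g₁) (h2 : Measurable g₂) :
    ∫⁻ x, (a * (2 * g₁ x + g₂ x) + b * g₃ x) =
      a * (2 * (∫⁻ x, g₁ x) + ∫⁻ x, g₂ x) + b * ∫⁻ x, g₃ x := by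
  have e1 : Measurable fun x => 2 * g₁ x := h1.const_mul 2
  have e2 : Measurable fun x => a * (2 * g₁ x + g₂ x) := (e1.add h2).const_mul a
  rw [lintegral_add_left e2, lintegral_const_mul' _ _ ha, lintegral_const_mul' _ _ hb,
    lintegral_add_left e1, lintegral_const_mul' _ _ (by simp)]

theorem lintegral_sideRem_le (hm : 0 < m) (hΨ : SolvesForcedKG m X f Ψ)
    (hB : EnergyBoundNear m Ψ κ B) (hS : FieldSlopes m X f Ψ κ sR sL) (L : ℝ) :
    ∫⁻ ξ, sideRem Ψ κ sR L ξ ≤ sideConst m κ B L := by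
  have hE := hΨ.continuousInEnergy
  have h1 := lintegral_slopeR_le hm hΨ hB hS
  have h2 := lintegral_sq_mul_cutFt_le hm hΨ hB
  have h3 := lintegral_remFt_le hm hΨ hB
  have m1 : Measurable (Function.uncurry fun x ξ => ‖sR x ξ‖ₑ ^ 2) :=
    (measurable_slopeR hm hΨ hB hS).enorm.pow_const 2
  have m2 : Measurable (Function.uncurry fun (x ξ : ℝ) => ‖(ξ : ℂ) * cutFt Ψ κ x ξ‖ₑ ^ 2) :=
    ((by fun_prop : Continuous fun p : ℝ × ℝ => (p.2 : ℂ)).mul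
      (continuous_cutFt hm hE hB)).enorm.measurable.pow_const 2
  have m3 : Measurable (Function.uncurry fun x ξ => ‖remFt Ψ κ x ξ‖ₑ ^ 2) :=
    (continuous_remFt hm hE hB).enorm.measurable.pow_const 2
  have m12 : Measurable (Function.uncurry fun (x ξ : ℝ) => ENNReal.ofReal L⁻¹ *
      (2 * ‖sR x ξ‖ₑ ^ 2 + ‖(ξ : ℂ) * cutFt Ψ κ x ξ‖ₑ ^ 2)) :=
    ((m1.const_mul 2).add m2).const_mul _
  simp only [sideRem]
  rw [lintegral_lintegral_swap]
  swap
  · have := (m12.add (m3.const_mul (ENNReal.ofReal L)))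
    exact (this.comp measurable_swap).aemeasurable
  have e := fun x => lintegral_comb (a := ENNReal.ofReal L⁻¹) (b := ENNReal.ofReal L)
    ENNReal.ofReal_ne_top ENNReal.ofReal_ne_top (g₁ := fun ξ => ‖sR x ξ‖ₑ ^ 2)
    (g₂ := fun ξ : ℝ => ‖(ξ : ℂ) * cutFt Ψ κ x ξ‖ₑ ^ 2) (g₃ := fun ξ => ‖remFt Ψ κ x ξ‖ₑ ^ 2)
    (m1.comp measurable_prodMk_left) (m2.comp measurable_prodMk_left)
  calc _ = _ := lintegral_congr e
    _ = _ := lintegral_comb ENNReal.ofReal_ne_top ENNReal.ofReal_ne_top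
        m1.lintegral_prod_right' m2.lintegral_prod_right'
    _ ≤ _ := by
        rw [sideConst]
        gcongr

end Sideways

/-! ### The polynomial potential and its force -/

section Potential

variable (p : ℕ) (u : ℕ → ℝ)

/-- The coefficients of the polynomial `c(z)` in `F(z) = c(z) z`. -/
def forceCoeff (n : ℕ) : ℂ := -((2 * n * u n : ℝ) : ℂ)

/-- The gradient of `|z|^{2n}` is `2n |z|^{2n-2} z`. It is written as a polynomial in `z` and its
conjugate, because the degree `2n - 1` in these variables governs the spectrum of the force. For `n
= 0` the truncated exponent is harmless, the coefficient being zero. -/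
theorem hasGradientAt_potential (z : ℂ) :
    HasGradientAt (potential p u)
      (-∑ n ∈ Finset.range (p + 1), forceCoeff u n * ((starRingEnd ℂ z * z) ^ (n - 1) * z)) z := by
  have h1 : ∀ n : ℕ, HasFDerivAt (fun z : ℂ => u n * ‖z‖ ^ (2 * n))
      (u n • ((n * (‖z‖ ^ 2) ^ (n - 1)) • (2 • innerSL ℝ z))) z := by
    intro n
    have := ((hasStrictFDerivAt_norm_sq z).hasFDerivAt.pow n).const_mul (u n)
    have e : (fun z : ℂ => u n * ‖z‖ ^ (2 * n)) = fun z => u n * (‖z‖ ^ 2) ^ n := by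
      ext z; rw [pow_mul]
    rw [e]
    refine this.congr_fderiv ?_
    ext w
    simp
  have h2 := HasFDerivAt.fun_sum (fun n (_ : n ∈ Finset.range (p + 1)) => h1 n)
  rw [hasGradientAt_iff_hasFDerivAt]
  refine h2.congr_fderiv ?_
  ext w
  rw [InnerProductSpace.toDual_apply_apply, ← Finset.sum_neg_distrib, sum_inner,
    sum_apply]
  refine Finset.sum_congr rfl fun n _ => ?_
  have e : -(forceCoeff u n * ((starRingEnd ℂ z * z) ^ (n - 1) * z)) =
      ((u n * (n * (‖z‖ ^ 2) ^ (n - 1)) * 2 : ℝ) : ℂ) * z := by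
    rw [forceCoeff, mul_comm (starRingEnd ℂ z) z, Complex.mul_conj, Complex.normSq_eq_norm_sq]
    push_cast; ring
  rw [e, ← Complex.real_smul, real_inner_smul_left]
  simp
  ring

theorem force_eq (z : ℂ) : force p u z =
    ∑ n ∈ Finset.range (p + 1), forceCoeff u n * ((starRingEnd ℂ z * z) ^ (n - 1) * z) := by
  rw [force, (hasGradientAt_potential p u z).gradient, neg_neg]

theorem continuous_force : Continuous (force p u) := by
  have : force p u = fun z => ∑ n ∈ Finset.range (p + 1),
      forceCoeff u n * ((starRingEnd ℂ z * z) ^ (n - 1) * z) := funext (force_eq p u)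
  rw [this]
  have := Complex.continuous_conj
  fun_prop

theorem continuous_potential : Continuous (potential p u) := by
  unfold potential; fun_prop

theorem hasDerivAt_potential {Y : ℝ → ℂ} {Y' : ℂ} {t : ℝ} (h : HasDerivAt Y Y' t) :
    HasDerivAt (fun s => potential p u (Y s)) (-(force p u (Y t) * starRingEnd ℂ Y').re) t := by
  have h1 := (hasGradientAt_potential p u (Y t)).hasFDerivAt.comp_hasDerivAt t h
  rw [← force_eq] at h1
  refine h1.congr_deriv ?_
  rw [InnerProductSpace.toDual_apply_apply, inner_neg_left, Complex.inner]
  congr 1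
  simp
  ring

variable {p u}

/-- The leading coefficient is positive, so the potential is coercive and attains its minimum. -/
theorem exists_potential_ge (hp : 1 ≤ p) (hu : 0 < u p) : ∃ K : ℝ, ∀ z, K ≤ potential p u z := by
  set P : Polynomial ℝ := ∑ n ∈ Finset.range (p + 1), Polynomial.C (u n) * Polynomial.X ^ n
  have hc : P.coeff p = u p := by
    simp [P, Polynomial.coeff_C_mul, Polynomial.coeff_X_pow]
  have hle : P.natDegree ≤ p := by
    refine Polynomial.natDegree_sum_le_of_forall_le _ _ fun n hn => ?_
    refine (Polynomial.natDegree_C_mul_X_pow_le _ _).trans ?_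
    have := Finset.mem_range.1 hn
    omega
  have hd : P.natDegree = p := le_antisymm hle
    (Polynomial.le_natDegree_of_ne_zero (by rw [hc]; exact hu.ne'))
  have hP : ∀ z : ℂ, potential p u z = P.eval (‖z‖ ^ 2) := by
    intro z
    simp [potential, P, Polynomial.eval_finsetSum, pow_mul]
  have ht : Tendsto (fun x => P.eval x) atTop atTop := by
    refine Polynomial.tendsto_atTop_of_leadingCoeff_nonneg P ?_ ?_
    · rw [Polynomial.degree_eq_natDegree (fun h => by rw [h] at hc; simp at hc; exact hu.ne hc), hd]
      exact_mod_cast hp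
    · rw [Polynomial.leadingCoeff, hd, hc]; exact hu.le
  have ht2 : Tendsto (potential p u) (cocompact ℂ) atTop := by
    have e : potential p u = fun z => P.eval (‖z‖ ^ 2) := funext hP
    rw [e]
    exact ht.comp ((tendsto_pow_atTop two_ne_zero).comp (tendsto_norm_cocompact_atTop))
  obtain ⟨z0, hz0⟩ := (continuous_potential p u).exists_forall_le ht2
  exact ⟨_, hz0⟩

end Potential

/-! ### Local `H¹` regularity in time of the field at a point -/

section LocalRegularity

variable {m : ℝ} {Ψ : ℝ → EnergyState} {N : ℕ} {X : Fin N → ℝ} {f : Fin N → ℝ → ℂ}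

theorem exists_cutoff (hE : ContinuousInEnergy m Ψ) (R : ℝ) :
    ∃ κ : 𝓢(ℝ, ℂ), (∀ t, |t| ≤ R → κ t = 1) ∧ HasCompactSupport κ ∧
      ∃ B, EnergyBoundNear m Ψ κ B := by
  set b : ContDiffBump (0 : ℝ) := ⟨|R| + 1, |R| + 2, by positivity, by linarith⟩
  have hs : HasCompactSupport (fun t => (b t : ℂ)) := hasCompactSupport_ofReal_comp b.hasCompactSupport
  obtain ⟨κ, hκ⟩ := exists_schwartz (contDiff_ofReal_comp b.contDiff) hs
  have hκ' : ⇑κ = fun t => (b t : ℂ) := funext hκ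
  -- The cutoff is supported in `|t| ≤ |R| + 2`; one more unit covers the neighbourhood demanded by
  -- `EnergyBoundNear`.
  obtain ⟨B, hB⟩ := hE.exists_bound (-(|R| + 3)) (|R| + 3)
  refine ⟨κ, fun t ht => ?_, hκ' ▸ hs, B, ?_⟩
  · rw [hκ, b.one_of_mem_closedBall, Complex.ofReal_one]
    rw [mem_closedBall_zero_iff, Real.norm_eq_abs]
    exact (ht.trans (le_abs_self R)).trans (by simp [b])
  · rintro t ⟨s, hs, hts⟩
    have h1 : |s| ≤ |R| + 2 := by
      have h2 : s ∈ tsupport b := by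
        refine closure_mono (fun x hx => ?_) hs
        rw [Function.mem_support, hκ] at hx
        simpa using hx
      rw [b.tsupport_eq, mem_closedBall_zero_iff, Real.norm_eq_abs] at h2
      exact h2
    have h3 : |t| ≤ |R| + 3 := by
      have := abs_add_le (t - s) s
      rw [sub_add_cancel] at this
      linarith
    exact hB t (abs_le.1 h3)

/-- For `|ξ| > m` the density at `x` is bounded by its average over an adjacent free interval; for
`|ξ| ≤ m` the term `m² |s|²` suffices. -/
theorem sq_mul_cutFt_le {κ : 𝓢(ℝ, ℂ)} {B : ℝ≥0} {sR sL : ℝ → ℝ → ℂ}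
    (hm : 0 < m) (hΨ : SolvesForcedKG m X f Ψ)
    (hB : EnergyBoundNear m Ψ κ B) (hS : FieldSlopes m X f Ψ κ sR sL) {L : ℝ} (hL : 0 < L)
    {x : ℝ} (hx : FreeOn X x (x + L) ∨ FreeOn X (x - L) x) (ξ : ℝ) :
    ‖(ξ : ℂ) * cutFt Ψ κ x ξ‖ₑ ^ 2 ≤ sideRem Ψ κ sR L ξ +
      ENNReal.ofReal (m ^ 2) * ‖cutFt Ψ κ x ξ‖ₑ ^ 2 := by
  have e : ‖(ξ : ℂ) * cutFt Ψ κ x ξ‖ₑ ^ 2 = ENNReal.ofReal (ξ ^ 2) * ‖cutFt Ψ κ x ξ‖ₑ ^ 2 := by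
    rw [enorm_mul, mul_pow, ← ofReal_norm, ← ENNReal.ofReal_pow (norm_nonneg _)]
    simp
  have h1 : ENNReal.ofReal (ξ ^ 2) ≤ ENNReal.ofReal (ξ ^ 2 - m ^ 2) + ENNReal.ofReal (m ^ 2) := by
    refine le_trans (ENNReal.ofReal_le_ofReal (by linarith)) ENNReal.ofReal_add_le
  have h2 : ENNReal.ofReal (ξ ^ 2 - m ^ 2) * ‖cutFt Ψ κ x ξ‖ₑ ^ 2 ≤ sideRem Ψ κ sR L ξ := by
    by_cases hξ : m < |ξ|
    · rcases hx with hx | hx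
      · exact le_add_self.trans (sideEnergy_average hm hΨ hB hS hL hξ hx).1
      · have := (sideEnergy_average hm hΨ hB hS hL hξ (a := x - L) (by simpa using hx)).2
        rw [sub_add_cancel] at this
        exact le_add_self.trans this
    · have : ξ ^ 2 - m ^ 2 ≤ 0 := by
        rw [← sq_abs ξ]
        have := not_lt.1 hξ
        nlinarith [abs_nonneg ξ]
      rw [ENNReal.ofReal_of_nonpos this]
      simp
  rw [e]
  calc _ ≤ (ENNReal.ofReal (ξ ^ 2 - m ^ 2) + ENNReal.ofReal (m ^ 2)) * ‖cutFt Ψ κ x ξ‖ₑ ^ 2 := by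
        gcongr
    _ ≤ _ := by rw [add_mul]; gcongr

theorem FreeOn.mono {a b a' b' : ℝ} (h : FreeOn X a b) (ha : a ≤ a') (hb : b' ≤ b) :
    FreeOn X a' b' := fun J hJ => h J ⟨ha.trans_lt hJ.1, hJ.2.trans_le hb⟩

/-- Near a point the field is `H¹` in time, locally uniformly in space. -/
theorem exists_lintegral_time_difference_le (hm : 0 < m) (hX : Function.Injective X)
    (hΨ : SolvesForcedKG m X f Ψ) (hfc : ∀ J, Continuous (f J)) (x₀ R : ℝ) :
    ∃ δ > 0, ∃ C : ℝ≥0, ∀ x, |x - x₀| < δ → ∀ h : ℝ, 0 ≤ h → h ≤ 1 →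
      ∫⁻ t in Icc (-R) R, ‖(Ψ (t + h)).fld x - (Ψ t).fld x‖ₑ ^ 2 ≤ ENNReal.ofReal (h ^ 2) * C := by
  have hE := hΨ.continuousInEnergy
  -- The cutoff equals 1 up to `R + 1`, so that it is 1 at both `t` and `t + h` for `|t| ≤ R` and `h
  -- ≤ 1`.
  obtain ⟨κ, hκ1, hκs, B, hB⟩ := exists_cutoff hE (R + 1)
  obtain ⟨M, hM⟩ : ∃ M : ℝ, ∀ J, ∀ t ∈ tsupport κ, ‖f J t‖ ≤ M := by
    have : ∀ J, ∃ M : ℝ, ∀ t ∈ tsupport κ, ‖f J t‖ ≤ M := fun J =>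
      hκs.isCompact.exists_bound_of_continuousOn (hfc J).continuousOn
    choose M hM using this
    exact ⟨∑ J, |M J|, fun J t ht => (hM J t ht).trans ((le_abs_self _).trans
      (Finset.single_le_sum (f := fun J => |M J|) (fun _ _ => abs_nonneg _) (Finset.mem_univ J)))⟩
  obtain ⟨sR, sL, hS⟩ := exists_fieldSlopes hm hX hΨ hB hfc hM
  obtain ⟨ε, hε, hr, hl⟩ := exists_free_radius X x₀
  set D := sideConst m κ B (ε / 2) + ENNReal.ofReal (m ^ 2) *
    (ENNReal.ofReal (2 * Real.pi) * (cutNorm κ * ENNReal.ofReal (fldBound m B ^ 2))) with hD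
  have cn : ∀ κ : 𝓢(ℝ, ℂ), cutNorm κ ≠ ⊤ := fun κ =>
    (KGOscillators.MemLp.lintegral_sq_lt_top (κ.memLp 2 volume)).ne
  have hDtop : D ≠ ⊤ := by
    have := cn κ
    have := cn (dS κ)
    have := cn (dS (dS κ))
    rw [hD, sideConst]
    finiteness
  refine ⟨ε / 2, by positivity, D.toNNReal, fun x hx h hh hh1 => ?_⟩
  rw [ENNReal.coe_toNNReal hDtop]
  -- Half of the free radius at `x₀` is used: every nearby `x` has a free interval of length `ε / 2`
  -- on the side pointing away from `x₀`, so the constant does not depend on `x`.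
  have hfree : FreeOn X x (x + ε / 2) ∨ FreeOn X (x - ε / 2) x := by
    rw [abs_lt] at hx
    rcases le_or_gt x₀ x with h0 | h0
    · exact Or.inl (hr.mono h0 (by linarith))
    · exact Or.inr (hl.mono (by linarith) h0.le)
  have i1 := integrable_cut hm hE hB x
  have i2 := memLp_cut hm hE hB x
  have hint : ∫⁻ ξ : ℝ, ‖(ξ : ℂ) * cutFt Ψ κ x ξ‖ₑ ^ 2 ≤ D := by
    calc _ ≤ ∫⁻ ξ : ℝ, (sideRem Ψ κ sR (ε / 2) ξ +
          ENNReal.ofReal (m ^ 2) * ‖cutFt Ψ κ x ξ‖ₑ ^ 2) :=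
          lintegral_mono fun ξ => sq_mul_cutFt_le hm hΨ hB hS (by positivity) hfree ξ
      _ = (∫⁻ ξ, sideRem Ψ κ sR (ε / 2) ξ) +
          ENNReal.ofReal (m ^ 2) * ∫⁻ ξ, ‖cutFt Ψ κ x ξ‖ₑ ^ 2 := by
          rw [lintegral_add_right, lintegral_const_mul' _ _ ENNReal.ofReal_ne_top]
          exact ((continuous_ft i1).enorm.measurable.pow_const 2).const_mul _
      _ ≤ _ := by
          rw [hD]
          gcongr
          · exact lintegral_sideRem_le hm hΨ hB hS _
          · simp only [cutFt]
            rw [lintegral_ft_sq i1 i2]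
            gcongr
            rw [cutNorm, ← lintegral_mul_const' _ _ ENNReal.ofReal_ne_top]
            refine lintegral_mono fun t => ?_
            by_cases ht : κ t = 0
            · simp [ht]
            · rw [enorm_mul, mul_pow]
              gcongr
              have := hB.norm_fld_le hm x t (mem_tsupport_of_ne ht)
              rw [← ofReal_norm, ← ENNReal.ofReal_pow (norm_nonneg _)]
              exact ENNReal.ofReal_le_ofReal (by gcongr)
  have i1' : Integrable (fun t => κ (t + h) * (Ψ (t + h)).fld x) := i1.comp_add_right h
  have i2' : MemLp (fun t => κ (t + h) * (Ψ (t + h)).fld x) 2 :=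
    i2.comp_measurePreserving (measurePreserving_add_right volume h)
  have hpl := lintegral_ft_sq (i1'.sub i1) (i2'.sub i2)
  have h2pi : ENNReal.ofReal (2 * Real.pi) ≥ 1 := by
    rw [ge_iff_le, ENNReal.one_le_ofReal]; nlinarith [Real.pi_gt_three]
  calc ∫⁻ t in Icc (-R) R, ‖(Ψ (t + h)).fld x - (Ψ t).fld x‖ₑ ^ 2
      = ∫⁻ t in Icc (-R) R, ‖κ (t + h) * (Ψ (t + h)).fld x - κ t * (Ψ t).fld x‖ₑ ^ 2 := by
        refine setLIntegral_congr_fun measurableSet_Icc fun t ht => ?_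
        rw [hκ1 t (abs_le.2 ⟨by linarith [ht.1], by linarith [ht.2]⟩),
          hκ1 (t + h) (abs_le.2 ⟨by linarith [ht.1], by linarith [ht.2]⟩), one_mul, one_mul]
    _ ≤ ∫⁻ t, ‖κ (t + h) * (Ψ (t + h)).fld x - κ t * (Ψ t).fld x‖ₑ ^ 2 := setLIntegral_le_lintegral _ _
    _ ≤ ENNReal.ofReal (2 * Real.pi) * ∫⁻ t, ‖κ (t + h) * (Ψ (t + h)).fld x - κ t * (Ψ t).fld x‖ₑ ^ 2 :=
        le_mul_of_one_le_left zero_le h2pi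
    _ = ∫⁻ ξ : ℝ, ‖ft (fun t => κ (t + h) * (Ψ (t + h)).fld x - κ t * (Ψ t).fld x) ξ‖ₑ ^ 2 := hpl.symm
    -- The time difference has the symbol `e^{-iξh} - 1`, whose modulus is at most `|ξ h|`.
    _ ≤ ∫⁻ ξ : ℝ, ENNReal.ofReal (h ^ 2) * ‖(ξ : ℂ) * cutFt Ψ κ x ξ‖ₑ ^ 2 := by
        refine lintegral_mono fun ξ => ?_
        rw [ft_sub i1' i1, ft_comp_add (fun t => κ t * (Ψ t).fld x)]
        have e : Complex.exp (-(Complex.I * ξ * h)) * ft (fun t => κ t * (Ψ t).fld x) ξ -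
            ft (fun t => κ t * (Ψ t).fld x) ξ =
            (Complex.exp (Complex.I * ((-(ξ * h) : ℝ) : ℂ)) - 1) * cutFt Ψ κ x ξ := by
          rw [cutFt, sub_mul, one_mul]; push_cast; ring_nf
        rw [e, enorm_mul, enorm_mul, mul_pow, mul_pow, ← mul_assoc]
        gcongr
        rw [← ofReal_norm, ← ofReal_norm, ← ENNReal.ofReal_pow (norm_nonneg _),
          ← ENNReal.ofReal_pow (norm_nonneg _), ← ENNReal.ofReal_mul (by positivity)]
        refine ENNReal.ofReal_le_ofReal ?_
        have := Real.norm_exp_I_mul_ofReal_sub_one_le (x := -(ξ * h))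
        rw [Real.norm_eq_abs, abs_neg] at this
        calc _ ≤ |ξ * h| ^ 2 := by gcongr
          _ = _ := by rw [sq_abs, Complex.norm_real, Real.norm_eq_abs, sq_abs]; ring
    _ = ENNReal.ofReal (h ^ 2) * ∫⁻ ξ : ℝ, ‖(ξ : ℂ) * cutFt Ψ κ x ξ‖ₑ ^ 2 :=
        lintegral_const_mul' _ _ ENNReal.ofReal_ne_top
    _ ≤ _ := by gcongr

end LocalRegularity

/-! ### Mollification in space -/

section Mollification

variable {g ρ σ : ℝ → ℂ}

/-- Cauchy–Schwarz after splitting `|ρ|` into two square roots, one of which stays with `g`. -/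
theorem enorm_conv_sq_le_lintegral (hg : AEStronglyMeasurable g volume) (hρ : IsTestFunction ρ)
    (x : ℝ) : ‖conv g ρ x‖ₑ ^ 2 ≤
      (∫⁻ x, ‖ρ x‖ₑ) * ∫⁻ y, ‖ρ (x - y)‖ₑ * ‖g y‖ₑ ^ 2 := by
  have mρ : Measurable fun x => ‖ρ x‖ₑ := hρ.continuous.enorm.measurable
  have h0 : ‖conv g ρ x‖ₑ ≤ ∫⁻ y, ‖ρ (x - y)‖ₑ ^ (1 / 2 : ℝ) *
      (‖ρ (x - y)‖ₑ ^ (1 / 2 : ℝ) * ‖g y‖ₑ) := by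
    refine (enorm_integral_le_lintegral_enorm _).trans (lintegral_mono fun y => le_of_eq ?_)
    rw [enorm_mul, ← mul_assoc, ← ENNReal.rpow_add_of_nonneg _ _ (by norm_num) (by norm_num)]
    norm_num [mul_comm]
  have mx : Measurable fun y => ‖ρ (x - y)‖ₑ ^ (1 / 2 : ℝ) :=
    (mρ.comp (measurable_const.sub measurable_id)).pow_const _
  have h1 := lintegral_mul_sq_le (μ := volume) mx.aemeasurable
    (mx.aemeasurable.mul hg.enorm)
  have e1 : ∀ a : ℝ≥0∞, (a ^ (1 / 2 : ℝ)) ^ 2 = a := fun a => by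
    rw [← ENNReal.rpow_natCast, ← ENNReal.rpow_mul]; norm_num
  calc _ ≤ _ := pow_le_pow_left' h0 2
    _ ≤ _ := h1
    _ = _ := by
      simp only [Pi.mul_apply, mul_pow, e1]
      rw [lintegral_sub_left_eq_self (fun y => ‖ρ y‖ₑ) x]

/-- Young's inequality. -/
theorem lintegral_conv_sq_le (hg : AEStronglyMeasurable g volume) (hρ : IsTestFunction ρ) :
    ∫⁻ x, ‖conv g ρ x‖ₑ ^ 2 ≤ (∫⁻ x, ‖ρ x‖ₑ) ^ 2 * ∫⁻ x, ‖g x‖ₑ ^ 2 := by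
  have mρ : Measurable fun x => ‖ρ x‖ₑ := hρ.continuous.enorm.measurable
  calc _ ≤ ∫⁻ x, (∫⁻ x, ‖ρ x‖ₑ) * ∫⁻ y, ‖ρ (x - y)‖ₑ * ‖g y‖ₑ ^ 2 := 
        lintegral_mono fun x => enorm_conv_sq_le_lintegral hg hρ x
    _ = (∫⁻ x, ‖ρ x‖ₑ) * ∫⁻ x, ∫⁻ y, ‖ρ (x - y)‖ₑ * ‖g y‖ₑ ^ 2 :=
        lintegral_const_mul' _ _ (hρ.integrable.2).ne
    _ = (∫⁻ x, ‖ρ x‖ₑ) * ∫⁻ y, ∫⁻ x, ‖ρ (x - y)‖ₑ * ‖g y‖ₑ ^ 2 := by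
        rw [lintegral_lintegral_swap]
        have a1 : AEMeasurable (fun p : ℝ × ℝ => ‖ρ (p.1 - p.2)‖ₑ) (volume.prod volume) :=
          (mρ.comp (measurable_fst.sub measurable_snd)).aemeasurable
        have a2 : AEMeasurable (fun p : ℝ × ℝ => ‖g p.2‖ₑ ^ 2) (volume.prod volume) :=
          (hg.enorm.pow_const 2).comp_snd
        exact a1.mul a2
    _ = (∫⁻ x, ‖ρ x‖ₑ) * ∫⁻ y, (∫⁻ x, ‖ρ x‖ₑ) * ‖g y‖ₑ ^ 2 := by
        congr 1
        refine lintegral_congr fun y => ?_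
        have my : Measurable fun x => ‖ρ (x - y)‖ₑ := mρ.comp (measurable_id.sub measurable_const)
        rw [lintegral_mul_const _ my,
          lintegral_sub_right_eq_self (fun x => ‖ρ x‖ₑ) y]
    _ = _ := by
        rw [lintegral_const_mul' _ _ (hρ.integrable.2).ne, ← mul_assoc, sq]

theorem memLp_conv (hg : MemLp g 2 volume) (hρ : IsTestFunction ρ) : MemLp (conv g ρ) 2 volume := by
  refine ⟨(continuous_conv (memLp_two_locallyIntegrable hg) hρ).aestronglyMeasurable, ?_⟩
  rw [eLpNorm_lt_top_iff_lintegral_rpow_enorm_lt_top (by simp) (by simp)]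
  have h := lintegral_conv_sq_le hg.1 hρ
  refine lt_of_le_of_lt ?_ (h.trans_lt (ENNReal.mul_lt_top
    (ENNReal.pow_lt_top hρ.integrable.2) (MemLp.lintegral_sq_lt_top hg)))
  simp

theorem isTestFunction_conv (hρ : IsTestFunction ρ) (hσ : IsTestFunction σ) :
    IsTestFunction (conv ρ σ) := by
  rw [conv_eq_convolution]
  exact ⟨hσ.2.contDiff_convolution_left _ hσ.1 hρ.continuous.locallyIntegrable,
    hσ.2.convolution _ hρ.2⟩

theorem conv_conv (hg : LocallyIntegrable g) (hρ : IsTestFunction ρ) (hσ : IsTestFunction σ)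
    (x : ℝ) : conv (conv g ρ) σ x = conv g (conv ρ σ) x := by
  rw [conv_eq_convolution, conv_eq_convolution, conv_eq_convolution, conv_eq_convolution]
  have hg' : LocallyIntegrable (fun x => ‖g x‖) := fun x =>
    (hg x).norm
  symm
  refine convolution_assoc _ _ _ _ (fun a b c => by simp [mul_assoc])
    hσ.continuous.aestronglyMeasurable hρ.continuous.aestronglyMeasurable hg.aestronglyMeasurable
    (ae_of_all _ (hσ.2.convolutionExists_left _ hσ.continuous hρ.continuous.locallyIntegrable))
    (ae_of_all _ (hρ.2.norm.convolutionExists_left _ hρ.continuous.norm hg'))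
    (hσ.2.norm.convolutionExists_left _ hσ.continuous.norm ?_ x)
  exact (hρ.2.norm.continuous_convolution_left _ hρ.continuous.norm hg').locallyIntegrable

theorem integral_conv (hρ : IsTestFunction ρ) (hσ : IsTestFunction σ) :
    ∫ x, conv ρ σ x = (∫ x, ρ x) * ∫ x, σ x := by
  rw [conv_eq_convolution, integral_convolution _ hσ.integrable hρ.integrable]
  simp [mul_comm]

theorem lintegral_conv_le (hρ : IsTestFunction ρ) (hσ : IsTestFunction σ) :
    ∫⁻ x, ‖conv ρ σ x‖ₑ ≤ (∫⁻ x, ‖ρ x‖ₑ) * ∫⁻ x, ‖σ x‖ₑ := by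
  have mρ : Measurable fun x => ‖ρ x‖ₑ := hρ.continuous.enorm.measurable
  have mσ : Measurable fun x => ‖σ x‖ₑ := hσ.continuous.enorm.measurable
  calc _ ≤ ∫⁻ x, ∫⁻ y, ‖ρ y‖ₑ * ‖σ (x - y)‖ₑ := lintegral_mono fun x =>
        (enorm_integral_le_lintegral_enorm _).trans (lintegral_mono fun y => by rw [enorm_mul])
    _ = ∫⁻ y, ∫⁻ x, ‖ρ y‖ₑ * ‖σ (x - y)‖ₑ := by
        rw [lintegral_lintegral_swap]
        exact ((mρ.comp measurable_snd).mul
          (mσ.comp (measurable_fst.sub measurable_snd))).aemeasurable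
    _ = ∫⁻ y, ‖ρ y‖ₑ * ∫⁻ x, ‖σ x‖ₑ := by
        refine lintegral_congr fun y => ?_
        have my : Measurable fun x => ‖σ (x - y)‖ₑ := mσ.comp (measurable_id.sub measurable_const)
        rw [lintegral_const_mul _ my,
          lintegral_sub_right_eq_self (fun x => ‖σ x‖ₑ) y]
    _ = _ := lintegral_mul_const _ mρ

theorem enorm_conv_sq_le (hg : MemLp g 2 volume) (hρ : IsTestFunction ρ) (x : ℝ) :
    ‖conv g ρ x‖ₑ ^ 2 ≤ (∫⁻ y, ‖g y‖ₑ ^ 2) * ∫⁻ y, ‖ρ y‖ₑ ^ 2 := by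
  refine (enorm_integral_mul_sq_le hg ((hρ.comp_sub x).memLp 2)).trans_eq ?_
  rw [lintegral_sub_left_eq_self (fun y => ‖ρ y‖ₑ ^ 2) x]

theorem conv_sub {g₁ g₂ : ℝ → ℂ} (h₁ : LocallyIntegrable g₁) (h₂ : LocallyIntegrable g₂)
    (hρ : IsTestFunction ρ) (x : ℝ) : conv (g₁ - g₂) ρ x = conv g₁ ρ x - conv g₂ ρ x := by
  simp only [conv, Pi.sub_apply, sub_mul]
  exact integral_sub ((hρ.comp_sub x).integrable_mul h₁) ((hρ.comp_sub x).integrable_mul h₂)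

/-- Cauchy–Schwarz bounds the change of the convolution under `s` uniformly in `x` by an `L²`
distance; for fixed time the convolution is continuous in `x`. -/
theorem continuous_conv_family {v : ℝ → ℝ → ℂ} (hv : ∀ s, MemLp (v s) 2 volume)
    (hc : ∀ t, Tendsto (fun s => ∫⁻ x, ‖v s x - v t x‖ₑ ^ 2) (𝓝 t) (𝓝 0))
    (hρ : IsTestFunction ρ) : Continuous (Function.uncurry fun x s => conv (v s) ρ x) := by
  refine continuous_iff_continuousAt.2 fun ⟨x₀, t⟩ => ?_
  have hl := fun s => memLp_two_locallyIntegrable (hv s)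
  have hR : ∫⁻ x, ‖ρ x‖ₑ ^ 2 < ⊤ := MemLp.lintegral_sq_lt_top (hρ.memLp 2)
  have h1 : Tendsto (fun p : ℝ × ℝ => conv (v p.2) ρ p.1 - conv (v t) ρ p.1) (𝓝 (x₀, t)) (𝓝 0) := by
    have h2 : Tendsto (fun s => (∫⁻ x, ‖v s x - v t x‖ₑ ^ 2) * ∫⁻ x, ‖ρ x‖ₑ ^ 2) (𝓝 t) (𝓝 0) := by
      simpa using ENNReal.Tendsto.mul_const (hc t) (Or.inr hR.ne)
    have h3 : Tendsto (fun p : ℝ × ℝ => ‖conv (v p.2) ρ p.1 - conv (v t) ρ p.1‖ₑ ^ 2)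
        (𝓝 (x₀, t)) (𝓝 0) := by
      refine tendsto_of_tendsto_of_tendsto_of_le_of_le tendsto_const_nhds
        (h2.comp (continuous_snd.tendsto (x₀, t))) (fun _ => zero_le) fun p => ?_
      rw [← conv_sub (hl _) (hl _) hρ]
      exact enorm_conv_sq_le ((hv _).sub (hv _)) hρ _
    have h4 := (ENNReal.tendsto_toReal ENNReal.zero_ne_top).comp h3
    rw [tendsto_zero_iff_norm_tendsto_zero]
    have h5 := (Real.continuous_sqrt.tendsto 0).comp h4
    simpa [Function.comp_def, Real.sqrt_sq] using h5
  have h2 : Tendsto (fun p : ℝ × ℝ => conv (v t) ρ p.1) (𝓝 (x₀, t)) (𝓝 (conv (v t) ρ x₀)) :=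
    ((continuous_conv (hl t) hρ).tendsto x₀).comp (continuous_fst.tendsto (x₀, t))
  have h3 := h1.add h2
  simp only [sub_add_cancel, zero_add] at h3
  exact h3

variable {m : ℝ} {Ψ : ℝ → EnergyState}

theorem continuous_conv_fld (hm : 0 < m) (hE : ContinuousInEnergy m Ψ) (hρ : IsTestFunction ρ) :
    Continuous (Function.uncurry fun x s => conv (Ψ s).fld ρ x) := by
  refine continuous_conv_family (fun s => (Ψ s).memLp_fld) (fun t => ?_) hρ
  have h1 : Tendsto (fun s => ENNReal.ofReal (1 / m ^ 2) * ((Ψ s).sub (Ψ t)).energy m)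
      (𝓝 t) (𝓝 0) := by
    simpa using ENNReal.Tendsto.const_mul (hE.tendsto t) (Or.inr ENNReal.ofReal_ne_top)
  exact tendsto_of_tendsto_of_tendsto_of_le_of_le tendsto_const_nhds h1 (fun _ => zero_le)
    fun s => ((Ψ s).sub (Ψ t)).lintegral_fld_le hm

theorem continuous_conv_mom (hE : ContinuousInEnergy m Ψ) (hρ : IsTestFunction ρ) :
    Continuous (Function.uncurry fun x s => conv (Ψ s).mom ρ x) :=
  continuous_conv_family (fun s => (Ψ s).memLp_mom) (fun t =>
    tendsto_of_tendsto_of_tendsto_of_le_of_le tendsto_const_nhds (hE.tendsto t)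
      (fun _ => zero_le) fun s => ((Ψ s).sub (Ψ t)).lintegral_mom_le m) hρ

theorem conv_fld_deriv (S : EnergyState) (hρ : IsTestFunction ρ) (x : ℝ) :
    conv S.fld (deriv ρ) x = conv S.dfld ρ x := by
  have h := S.isWeakDeriv _ (hρ.comp_sub x)
  rw [deriv_comp_sub'] at h
  simp only [mul_neg, integral_neg] at h
  exact neg_injective h

variable {N : ℕ} {X : Fin N → ℝ} {f : Fin N → ℝ → ℂ}

theorem hasDerivAt_conv_fld_time (hΨ : SolvesForcedKG m X f Ψ) (hρ : IsTestFunction ρ) (x t : ℝ) :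
    HasDerivAt (fun s => conv (Ψ s).fld ρ x) (conv (Ψ t).mom ρ x) t :=
  hΨ.hasDerivAt_fld _ (hρ.comp_sub x) t

theorem hasDerivAt_conv_mom_time (hΨ : SolvesForcedKG m X f Ψ) (hρ : IsTestFunction ρ) (x t : ℝ) :
    HasDerivAt (fun s => conv (Ψ s).mom ρ x)
      (conv (Ψ t).fld (deriv (deriv ρ)) x - (m : ℂ) ^ 2 * conv (Ψ t).fld ρ x +
        ∑ J, f J t * ρ (x - X J)) t := by
  have h := hΨ.hasDerivAt_mom _ (hρ.comp_sub x) t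
  have h3 : deriv (deriv fun y => ρ (x - y)) = fun y => deriv (deriv ρ) (x - y) := by
    rw [deriv_comp_sub']
    ext y
    rw [deriv.fun_neg, deriv_comp_const_sub, neg_neg]
  rw [h3] at h
  exact h

/-- The integrand is dominated by `‖A‖² + ‖C‖²`. It justifies interchanging the space and time
integrals in the energy balance. -/
theorem integrable_inner_of_bound {A C : ℝ → ℝ → ℂ} (hA : Continuous (Function.uncurry A))
    (hC : Continuous (Function.uncurry C)) {a b : ℝ}
    {K K' : ℝ≥0∞} (hK : K ≠ ⊤) (hK' : K' ≠ ⊤)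
    (h1 : ∀ s ∈ Icc a b, ∫⁻ x, ‖A x s‖ₑ ^ 2 ≤ K) (h2 : ∀ s ∈ Icc a b, ∫⁻ x, ‖C x s‖ₑ ^ 2 ≤ K') :
    Integrable (Function.uncurry fun x s => inner ℝ (A x s) (C x s))
      (volume.prod (volume.restrict (Icc a b))) := by
  have hc : Continuous (Function.uncurry fun x s => inner ℝ (A x s) (C x s)) := hA.inner hC
  have mA : Measurable (Function.uncurry fun x s => ‖A x s‖ₑ ^ 2) := hA.enorm.measurable.pow_const 2
  have mC : Measurable (Function.uncurry fun x s => ‖C x s‖ₑ ^ 2) := hC.enorm.measurable.pow_const 2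
  refine ⟨hc.aestronglyMeasurable, ?_⟩
  have hle : ∀ z w : ℂ, ‖(inner ℝ z w : ℝ)‖ₑ ≤ ‖z‖ₑ ^ 2 + ‖w‖ₑ ^ 2 := by
    intro z w
    rw [← ofReal_norm, ← ofReal_norm, ← ofReal_norm, ← ENNReal.ofReal_pow (norm_nonneg _),
      ← ENNReal.ofReal_pow (norm_nonneg _), ← ENNReal.ofReal_add (by positivity) (by positivity)]
    refine ENNReal.ofReal_le_ofReal ((norm_inner_le_norm z w).trans ?_)
    nlinarith [sq_nonneg (‖z‖ - ‖w‖), norm_nonneg z, norm_nonneg w]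
  rw [HasFiniteIntegral, lintegral_prod_symm _ hc.enorm.measurable.aemeasurable]
  calc _ ≤ ∫⁻ s in Icc a b, ((∫⁻ x, ‖A x s‖ₑ ^ 2) + ∫⁻ x, ‖C x s‖ₑ ^ 2) := by
        refine lintegral_mono fun s => ?_
        have mx : Measurable fun x => ‖A x s‖ₑ ^ 2 := mA.comp (measurable_id.prodMk measurable_const)
        rw [← lintegral_add_left mx]
        exact lintegral_mono fun x => hle _ _
    _ ≤ ∫⁻ s in Icc a b, (K + K') := setLIntegral_mono measurable_const
        fun s hs => add_le_add (h1 s hs) (h2 s hs)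
    _ < ⊤ := by
        rw [setLIntegral_const]
        exact ENNReal.mul_lt_top (by finiteness) (by simp)

end Mollification

/-! ### The energy balance of the mollified solution -/

section EnergyIdentity

theorem integrable_norm_sq {a : ℝ → ℂ} (ha : MemLp a 2 volume) :
    Integrable (fun x => ‖a x‖ ^ 2) := by
  simpa using ha.integrable_norm_pow (by simp)

theorem integrable_inner {a b : ℝ → ℂ} (ha : MemLp a 2 volume) (hb : MemLp b 2 volume) :
    Integrable (fun x => inner ℝ (a x) (b x)) := by
  refine Integrable.mono' ((integrable_norm_sq ha).add (integrable_norm_sq hb))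
    (ha.1.inner hb.1) (ae_of_all _ fun x => (norm_inner_le_norm _ _).trans ?_)
  simp only [Pi.add_apply]
  nlinarith [sq_nonneg (‖a x‖ - ‖b x‖), norm_nonneg (a x), norm_nonneg (b x)]

variable {m : ℝ} {Ψ : ℝ → EnergyState} {N : ℕ} {X : Fin N → ℝ} {f : Fin N → ℝ → ℂ} {ρ : ℝ → ℂ}

/-- The energy density of the state `S` mollified in space by `ρ`. -/
def mollDensity (m : ℝ) (ρ : ℝ → ℂ) (S : EnergyState) (x : ℝ) : ℝ :=
  ‖conv S.mom ρ x‖ ^ 2 + ‖conv S.fld (deriv ρ) x‖ ^ 2 + m ^ 2 * ‖conv S.fld ρ x‖ ^ 2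

theorem integrable_mollDensity (S : EnergyState) (hρ : IsTestFunction ρ) :
    Integrable (mollDensity m ρ S) :=
  ((integrable_norm_sq (memLp_conv S.memLp_mom hρ)).add
    (integrable_norm_sq (memLp_conv S.memLp_fld hρ.deriv))).add
    ((integrable_norm_sq (memLp_conv S.memLp_fld hρ)).const_mul _)

/-- The divergence term of the energy balance. -/
def mollFlux (ρ : ℝ → ℂ) (S : EnergyState) (x : ℝ) : ℝ :=
  inner ℝ (conv S.mom ρ x) (conv S.fld (deriv (deriv ρ)) x) +
    inner ℝ (conv S.mom (deriv ρ) x) (conv S.fld (deriv ρ) x)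

/-- The work of the forces in the energy balance. -/
def mollWork (X : Fin N → ℝ) (f : Fin N → ℝ → ℂ) (Ψ : ℝ → EnergyState) (ρ : ℝ → ℂ) (x s : ℝ) : ℝ :=
  ∑ J, inner ℝ (conv (Ψ s).mom ρ x) (f J s * ρ (x - X J))

/-- The mass terms coming from the momentum and from the field cancel; there remain a divergence and
the work of the forces. -/
theorem hasDerivAt_mollDensity (hΨ : SolvesForcedKG m X f Ψ) (hρ : IsTestFunction ρ) (x t : ℝ) :
    HasDerivAt (fun s => mollDensity m ρ (Ψ s) x)
      (2 * (mollFlux ρ (Ψ t) x + mollWork X f Ψ ρ x t)) t := by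
  have h1 := (hasDerivAt_conv_mom_time hΨ hρ x t).norm_sq
  have h2 := (hasDerivAt_conv_fld_time hΨ hρ.deriv x t).norm_sq
  have h3 := ((hasDerivAt_conv_fld_time hΨ hρ x t).norm_sq).const_mul (m ^ 2)
  refine ((h1.fun_add h2).fun_add h3).congr_deriv ?_
  have e : ((m : ℂ) ^ 2 * conv (Ψ t).fld ρ x) = (m ^ 2) • conv (Ψ t).fld ρ x := by
    rw [Complex.real_smul]; push_cast; rfl
  rw [mollFlux, mollWork, e, inner_add_right, inner_sub_right, inner_sum, real_inner_smul_right,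
    real_inner_comm (conv (Ψ t).fld ρ x), real_inner_comm (conv (Ψ t).fld (deriv ρ) x)]
  ring

/-- The flux is the space derivative of the integrable function `⟨mom * ρ, fld * ρ'⟩`. -/
theorem integral_mollFlux (S : EnergyState) (hρ : IsTestFunction ρ) :
    ∫ x, mollFlux ρ S x = 0 := by
  have hf := memLp_two_locallyIntegrable S.memLp_fld
  have hp := memLp_two_locallyIntegrable S.memLp_mom
  refine integral_eq_zero_of_hasDerivAt_of_integrable
    (f := fun x => inner ℝ (conv S.mom ρ x) (conv S.fld (deriv ρ) x)) (fun x => ?_) ?_ ?_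
  · exact (hasDerivAt_conv hp hρ x).inner ℝ (hasDerivAt_conv hf hρ.deriv x)
  · exact (integrable_inner (memLp_conv S.memLp_mom hρ) (memLp_conv S.memLp_fld hρ.deriv.deriv)).add
      (integrable_inner (memLp_conv S.memLp_mom hρ.deriv) (memLp_conv S.memLp_fld hρ.deriv))
  · exact integrable_inner (memLp_conv S.memLp_mom hρ) (memLp_conv S.memLp_fld hρ.deriv)

theorem integrable_mollFlux (S : EnergyState) (hρ : IsTestFunction ρ) :
    Integrable (mollFlux ρ S) :=
  (integrable_inner (memLp_conv S.memLp_mom hρ) (memLp_conv S.memLp_fld hρ.deriv.deriv)).add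
      (integrable_inner (memLp_conv S.memLp_mom hρ.deriv) (memLp_conv S.memLp_fld hρ.deriv))

theorem memLp_shift (hρ : IsTestFunction ρ) (z : ℂ) (y : ℝ) :
    MemLp (fun x => z * ρ (x - y)) 2 volume :=
  ((hρ.memLp 2).comp_measurePreserving (measurePreserving_sub_right volume y)).const_mul z

/-- Integration against the force spread by `ρ` applies a second mollification. For real even `ρ`
the result is the momentum mollified by `ρ * ρ` at the point itself, which is why `moll2` appears
below. -/
theorem integral_mollWork (hρ : IsTestFunction ρ) (hreal : ∀ x, starRingEnd ℂ (ρ x) = ρ x)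
    (heven : ∀ x, ρ (-x) = ρ x) (s : ℝ) :
    ∫ x, mollWork X f Ψ ρ x s =
      ∑ J, (f J s * starRingEnd ℂ (conv (Ψ s).mom (conv ρ ρ) (X J))).re := by
  have hp := (Ψ s).memLp_mom
  simp only [mollWork]
  rw [integral_finsetSum _ fun J _ => integrable_inner (memLp_conv hp hρ) (memLp_shift hρ _ _)]
  refine Finset.sum_congr rfl fun J _ => ?_
  rw [← conv_conv (memLp_two_locallyIntegrable hp) hρ hρ]
  have i1 : Integrable fun x => conv (Ψ s).mom ρ x * ρ (X J - x) :=
    (hρ.comp_sub (X J)).integrable_mul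
      (memLp_two_locallyIntegrable (memLp_conv hp hρ))
  have i2 : Integrable fun x => f J s * starRingEnd ℂ (conv (Ψ s).mom ρ x * ρ (X J - x)) := by
    refine Integrable.const_mul ?_ _
    exact (Complex.conjCLE.toContinuousLinearMap.integrable_comp i1 : _)
  rw [conv, ← integral_conj, ← integral_const_mul]
  calc _ = ∫ x, Complex.reCLM (f J s * starRingEnd ℂ (conv (Ψ s).mom ρ x * ρ (X J - x))) := by
        congr 1; ext x
        rw [Complex.inner, Complex.reCLM_apply, map_mul, hreal, ← heven (X J - x), neg_sub]
        congr 1; ring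
    _ = _ := Complex.reCLM.integral_comp_comm i2

theorem continuous_mollFlux (hm : 0 < m) (hE : ContinuousInEnergy m Ψ) (hρ : IsTestFunction ρ) :
    Continuous (Function.uncurry fun x s => mollFlux ρ (Ψ s) x) :=
  ((continuous_conv_mom hE hρ).inner (continuous_conv_fld hm hE hρ.deriv.deriv)).add
    ((continuous_conv_mom hE hρ.deriv).inner (continuous_conv_fld hm hE hρ.deriv))

theorem continuous_forceTerm (hfc : ∀ J, Continuous (f J)) (hρ : IsTestFunction ρ) (J : Fin N) :
    Continuous (Function.uncurry fun x s => f J s * ρ (x - X J)) :=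
  ((hfc J).comp continuous_snd).mul (hρ.continuous.comp (continuous_fst.sub continuous_const))

theorem continuous_mollWork (hE : ContinuousInEnergy m Ψ) (hfc : ∀ J, Continuous (f J))
    (hρ : IsTestFunction ρ) : Continuous (Function.uncurry (mollWork X f Ψ ρ)) := by
  have h : Continuous fun p : ℝ × ℝ =>
      ∑ J, inner ℝ (conv (Ψ p.2).mom ρ p.1) (f J p.2 * ρ (p.1 - X J)) :=
    continuous_finsetSum _ fun J _ =>
      (continuous_conv_mom hE hρ).inner (continuous_forceTerm hfc hρ J)
  exact h

theorem integrable_balance (hm : 0 < m) (hE : ContinuousInEnergy m Ψ)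
    (hfc : ∀ J, Continuous (f J)) (hρ : IsTestFunction ρ) (a b : ℝ) :
    Integrable (Function.uncurry fun x s => 2 * (mollFlux ρ (Ψ s) x + mollWork X f Ψ ρ x s))
      (volume.prod (volume.restrict (Icc a b))) := by
  obtain ⟨B, hB⟩ := hE.exists_bound a b
  have bm : ∀ {σ}, IsTestFunction σ → ∀ s ∈ Icc a b, ∫⁻ x, ‖conv (Ψ s).mom σ x‖ₑ ^ 2 ≤
      (∫⁻ x, ‖σ x‖ₑ) ^ 2 * B := fun hσ s hs =>
    (lintegral_conv_sq_le (Ψ s).memLp_mom.1 hσ).trans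
      (by gcongr; exact ((Ψ s).lintegral_mom_le m).trans (hB s hs))
  have bf : ∀ {σ}, IsTestFunction σ → ∀ s ∈ Icc a b, ∫⁻ x, ‖conv (Ψ s).fld σ x‖ₑ ^ 2 ≤
      (∫⁻ x, ‖σ x‖ₑ) ^ 2 * (ENNReal.ofReal (1 / m ^ 2) * B) := fun hσ s hs =>
    (lintegral_conv_sq_le (Ψ s).memLp_fld.1 hσ).trans
      (by gcongr; exact ((Ψ s).lintegral_fld_le hm).trans (by gcongr; exact hB s hs))
  have tm : ∀ {σ : ℝ → ℂ}, IsTestFunction σ → (∫⁻ x, ‖σ x‖ₑ) ^ 2 * B ≠ ⊤ := fun hσ =>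
    ENNReal.mul_ne_top (ENNReal.pow_ne_top hσ.integrable.2.ne) ENNReal.coe_ne_top
  have tf : ∀ {σ : ℝ → ℂ}, IsTestFunction σ →
      (∫⁻ x, ‖σ x‖ₑ) ^ 2 * (ENNReal.ofReal (1 / m ^ 2) * B) ≠ ⊤ := fun hσ =>
    ENNReal.mul_ne_top (ENNReal.pow_ne_top hσ.integrable.2.ne)
      (ENNReal.mul_ne_top ENNReal.ofReal_ne_top ENNReal.coe_ne_top)
  have i1 := integrable_inner_of_bound (continuous_conv_mom hE hρ)
    (continuous_conv_fld hm hE hρ.deriv.deriv) (tm hρ) (tf hρ.deriv.deriv) (bm hρ) (bf hρ.deriv.deriv)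
  have i2 := integrable_inner_of_bound (continuous_conv_mom hE hρ.deriv)
    (continuous_conv_fld hm hE hρ.deriv) (tm hρ.deriv) (tf hρ.deriv) (bm hρ.deriv) (bf hρ.deriv)
  have i3 : ∀ J, Integrable (Function.uncurry fun x s =>
      inner ℝ (conv (Ψ s).mom ρ x) (f J s * ρ (x - X J)))
      (volume.prod (volume.restrict (Icc a b))) := by
    intro J
    obtain ⟨M, hM⟩ := isCompact_Icc.exists_bound_of_continuousOn (s := Icc a b) (hfc J).continuousOn
    refine integrable_inner_of_bound (K' := ENNReal.ofReal M ^ 2 * ∫⁻ x, ‖ρ x‖ₑ ^ 2)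
      (continuous_conv_mom hE hρ) (continuous_forceTerm hfc hρ J) (tm hρ)
      (ENNReal.mul_ne_top (by simp) (MemLp.lintegral_sq_lt_top (hρ.memLp 2)).ne) (bm hρ)
      fun s hs => ?_
    have e : ∀ x, ‖f J s * ρ (x - X J)‖ₑ ^ 2 = ‖f J s‖ₑ ^ 2 * ‖ρ (x - X J)‖ₑ ^ 2 := fun x => by
      rw [enorm_mul, mul_pow]
    simp_rw [e]
    rw [lintegral_const_mul' _ _ (by simp), lintegral_sub_right_eq_self (fun x => ‖ρ x‖ₑ ^ 2)]
    gcongr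
    rw [← ofReal_norm]
    exact ENNReal.ofReal_le_ofReal (hM s hs)
  exact ((i1.add i2).add (integrable_finsetSum Finset.univ fun J _ => i3 J)).const_mul 2

/-- The energy balance of the solution mollified in space. -/
theorem integral_mollDensity_sub (hm : 0 < m) (hΨ : SolvesForcedKG m X f Ψ)
    (hfc : ∀ J, Continuous (f J)) (hρ : IsTestFunction ρ)
    (hreal : ∀ x, starRingEnd ℂ (ρ x) = ρ x) (heven : ∀ x, ρ (-x) = ρ x) {a b : ℝ} (hab : a ≤ b) :
    (∫ x, mollDensity m ρ (Ψ b) x) - ∫ x, mollDensity m ρ (Ψ a) x =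
      ∫ s in a..b, 2 * ∑ J, (f J s * starRingEnd ℂ (conv (Ψ s).mom (conv ρ ρ) (X J))).re := by
  have hE := hΨ.continuousInEnergy
  have hc : Continuous (Function.uncurry fun x s =>
      2 * (mollFlux ρ (Ψ s) x + mollWork X f Ψ ρ x s)) :=
    ((continuous_mollFlux hm hE hρ).add (continuous_mollWork hE hfc hρ)).const_mul 2
  have h1 : ∀ x, mollDensity m ρ (Ψ b) x - mollDensity m ρ (Ψ a) x =
      ∫ s in Icc a b, 2 * (mollFlux ρ (Ψ s) x + mollWork X f Ψ ρ x s) := by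
    intro x
    rw [integral_Icc_eq_integral_Ioc, ← intervalIntegral.integral_of_le hab]
    refine (intervalIntegral.integral_eq_sub_of_hasDerivAt
      (fun s _ => hasDerivAt_mollDensity hΨ hρ x s) ?_).symm
    exact (hc.comp (Continuous.prodMk_right x)).intervalIntegrable _ _
  rw [← integral_sub (integrable_mollDensity _ hρ) (integrable_mollDensity _ hρ)]
  simp_rw [h1]
  rw [integral_integral_swap (integrable_balance hm hE hfc hρ a b),
    intervalIntegral.integral_of_le hab, integral_Icc_eq_integral_Ioc]
  refine integral_congr_ae (ae_of_all _ fun s => ?_)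
  have i1 := integrable_mollFlux (Ψ s) hρ
  have i2 : Integrable fun x => mollWork X f Ψ ρ x s :=
    integrable_finsetSum _ fun J _ => integrable_inner (memLp_conv (Ψ s).memLp_mom hρ)
      (memLp_shift hρ _ _)
  simp only
  rw [integral_const_mul, integral_add i1 i2, integral_mollFlux _ hρ,
    integral_mollWork hρ hreal heven, zero_add]

end EnergyIdentity

/-! ### Limits of the mollified energy and velocity -/

section EnergyBound

theorem tendsto_zero_of_enorm_sq {α E : Type*} [NormedAddCommGroup E] {l : Filter α} {f : α → E}
    (h : Tendsto (fun a => ‖f a‖ₑ ^ 2) l (𝓝 0)) : Tendsto f l (𝓝 0) := by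
  have h4 := (ENNReal.tendsto_toReal ENNReal.zero_ne_top).comp h
  rw [tendsto_zero_iff_norm_tendsto_zero]
  have h5 := (Real.continuous_sqrt.tendsto 0).comp h4
  simpa [Function.comp_def, Real.sqrt_sq] using h5

theorem tendsto_enorm_sq {α E : Type*} [NormedAddCommGroup E] {l : Filter α} {f : α → E} {a : E}
    (h : Tendsto f l (𝓝 a)) : Tendsto (fun x => ‖f x‖ₑ ^ 2) l (𝓝 (‖a‖ₑ ^ 2)) :=
  ((ENNReal.continuous_pow 2).tendsto _).comp h.enorm

/-- The self-convolution of the mollifier. -/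
def moll2 (n : ℕ) : ℝ → ℂ := conv (moll n) (moll n)

theorem isTestFunction_moll2 (n : ℕ) : IsTestFunction (moll2 n) :=
  isTestFunction_conv (isTestFunction_moll n) (isTestFunction_moll n)

theorem integral_moll2 (n : ℕ) : ∫ x, moll2 n x = 1 := by
  rw [moll2, integral_conv (isTestFunction_moll n) (isTestFunction_moll n), integral_moll, one_mul]

theorem lintegral_moll2_le (n : ℕ) : ∫⁻ x, ‖moll2 n x‖ₑ ≤ 1 := by
  refine (lintegral_conv_le (isTestFunction_moll n) (isTestFunction_moll n)).trans ?_
  rw [lintegral_moll, one_mul]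

theorem moll2_eq_zero {n : ℕ} {x : ℝ} (h : (2 / (n + 1) : ℝ) ≤ |x|) : moll2 n x = 0 := by
  rw [moll2, conv]
  refine integral_eq_zero_of_ae (ae_of_all _ fun y => ?_)
  by_cases hy : (1 / (n + 1) : ℝ) ≤ |y|
  · simp [moll_eq_zero hy]
  · have h1 : (1 / (n + 1) : ℝ) ≤ |x - y| := by
      have h2 := abs_sub_abs_le_abs_sub x y
      have h3 : (2 / (n + 1) : ℝ) = 1 / (n + 1) + 1 / (n + 1) := by ring
      linarith
    simp [moll_eq_zero h1]

theorem norm_conv_moll2_le {g : ℝ → ℂ} {M : ℝ} (n : ℕ) (x : ℝ) (hM : 0 ≤ M)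
    (h : ∀ y, |x - y| < 2 / (n + 1) → ‖g y‖ ≤ M) : ‖conv g (moll2 n) x‖ ≤ M := by
  have hI := ((isTestFunction_moll2 n).comp_sub x).integrable
  calc _ ≤ ∫ y, M * ‖moll2 n (x - y)‖ := by
        refine norm_integral_le_of_norm_le (hI.norm.const_mul _) (ae_of_all _ fun y => ?_)
        rw [norm_mul]
        by_cases hy : (2 / (n + 1) : ℝ) ≤ |x - y|
        · simp [moll2_eq_zero hy]
        · gcongr
          exact h y (not_le.1 hy)
    _ = M * ∫ y, ‖moll2 n y‖ := by
        rw [integral_const_mul, integral_sub_left_eq_self (fun y => ‖moll2 n y‖)]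
    _ ≤ M * 1 := by
        gcongr
        rw [integral_norm_eq_lintegral_enorm
          (isTestFunction_moll2 n).continuous.aestronglyMeasurable]
        exact ENNReal.toReal_le_of_le_ofReal zero_le_one (by simpa using lintegral_moll2_le n)
    _ = M := mul_one M

theorem eventually_radius_lt {δ : ℝ} (hδ : 0 < δ) : ∀ᶠ n : ℕ in atTop, (2 / (n + 1) : ℝ) < δ := by
  have h : Tendsto (fun n : ℕ => (2 : ℝ) * (1 / (n + 1))) atTop (𝓝 0) := by
    simpa using tendsto_one_div_add_atTop_nhds_zero_nat.const_mul (2 : ℝ)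
  filter_upwards [h.eventually (gt_mem_nhds hδ)] with n hn
  rwa [mul_one_div] at hn

theorem tendsto_conv_moll2 {g : ℝ → ℂ} (hg : Continuous g) (x : ℝ) :
    Tendsto (fun n => conv g (moll2 n) x) atTop (𝓝 (g x)) := by
  rw [Metric.tendsto_atTop']
  intro ε hε
  obtain ⟨δ, hδ, h⟩ := Metric.continuousAt_iff.1 hg.continuousAt (ε / 2) (by positivity : 0 < ε / 2)
  obtain ⟨k, hk⟩ := eventually_atTop.1 (eventually_radius_lt hδ)
  refine ⟨k, fun n hn => ?_⟩
  -- The kernel has integral 1, so subtracting the constant `g x` commutes with the mollification.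
  have e : conv (g - fun _ => g x) (moll2 n) x = conv g (moll2 n) x - g x := by
    rw [conv_sub hg.locallyIntegrable continuous_const.locallyIntegrable (isTestFunction_moll2 n)]
    congr 1
    rw [conv, integral_const_mul, integral_sub_left_eq_self (fun y => moll2 n y), integral_moll2,
      mul_one]
  rw [dist_eq_norm, ← e]
  refine (norm_conv_moll2_le n x (by positivity : 0 ≤ ε / 2) fun y hy => ?_).trans_lt (by linarith)
  have := h (x := y) (by rw [Real.dist_eq, abs_sub_comm]; exact hy.trans (hk n hn.le))
  rw [dist_eq_norm] at this
  exact this.le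

/-- The state `S` mollified in space. -/
def EnergyState.moll (S : EnergyState) (n : ℕ) : EnergyState where
  fld := conv S.fld (KGOscillators.moll n)
  dfld := conv S.fld (deriv (KGOscillators.moll n))
  mom := conv S.mom (KGOscillators.moll n)
  continuous_fld := continuous_conv S.continuous_fld.locallyIntegrable (isTestFunction_moll n)
  memLp_fld := memLp_conv S.memLp_fld (isTestFunction_moll n)
  memLp_dfld := memLp_conv S.memLp_fld (isTestFunction_moll n).deriv
  isWeakDeriv := fun _ hσ => integral_primitive_mul_deriv
    (fun x => hasDerivAt_conv S.continuous_fld.locallyIntegrable (isTestFunction_moll n) x)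
    (continuous_conv S.continuous_fld.locallyIntegrable (isTestFunction_moll n).deriv) hσ
  memLp_mom := memLp_conv S.memLp_mom (isTestFunction_moll n)

variable {m : ℝ} {Ψ : ℝ → EnergyState} {N : ℕ} {X : Fin N → ℝ}

/-- Young's inequality with a kernel of `L¹` norm 1, applied to the momentum, the derivative and the
field. -/
theorem energy_moll_le (S : EnergyState) (n : ℕ) : (S.moll n).energy m ≤ S.energy m := by
  have hT := isTestFunction_moll n
  have key : ∀ {g : ℝ → ℂ}, MemLp g 2 volume →
      ∫⁻ x, ‖conv g (moll n) x‖ₑ ^ 2 ≤ ∫⁻ x, ‖g x‖ₑ ^ 2 := fun hg => by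
    simpa [lintegral_moll] using lintegral_conv_sq_le hg.1 hT
  rw [EnergyState.energy_eq, EnergyState.energy_eq]
  simp only [EnergyState.moll, conv_fld_deriv S hT]
  have h1 := key S.memLp_mom
  have h2 := key S.memLp_dfld
  have h3 := key S.memLp_fld
  gcongr

theorem energy_moll_eq (S : EnergyState) (n : ℕ) :
    (S.moll n).energy m = ENNReal.ofReal (∫ x, mollDensity m (moll n) S x) := by
  rw [ofReal_integral_eq_lintegral_ofReal (integrable_mollDensity S (isTestFunction_moll n))
    (ae_of_all _ fun x => by simp only [mollDensity, Pi.zero_apply]; positivity)]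
  refine lintegral_congr fun x => ?_
  simp only [EnergyState.moll, mollDensity]
  rw [ENNReal.ofReal_add (by positivity) (by positivity),
    ENNReal.ofReal_add (by positivity) (by positivity), ENNReal.ofReal_mul (by positivity),
    ENNReal.ofReal_pow (norm_nonneg _), ENNReal.ofReal_pow (norm_nonneg _),
    ENNReal.ofReal_pow (norm_nonneg (conv S.fld (moll n) x))]
  simp only [ofReal_norm]

/-- Mollifications converge almost everywhere, so Fatou's lemma gives lower semicontinuity. With
`energy_moll_le`, an inequality for mollified energies passes to the limit without any strong
convergence. -/
theorem energy_le_liminf (S : EnergyState) :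
    S.energy m ≤ liminf (fun n => (S.moll n).energy m) atTop := by
  have hT := isTestFunction_moll
  have c1 := fun n => continuous_conv (memLp_two_locallyIntegrable S.memLp_mom) (hT n)
  have c2 := fun n => continuous_conv (memLp_two_locallyIntegrable S.memLp_dfld) (hT n)
  have c3 := fun n => continuous_conv (memLp_two_locallyIntegrable S.memLp_fld) (hT n)
  have e : ∀ n, (S.moll n).energy m = ∫⁻ x, (‖conv S.mom (moll n) x‖ₑ ^ 2 +
      ‖conv S.dfld (moll n) x‖ₑ ^ 2 + ENNReal.ofReal (m ^ 2) * ‖conv S.fld (moll n) x‖ₑ ^ 2) := by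
    intro n
    simp only [EnergyState.energy, energyNormSq, EnergyState.moll, conv_fld_deriv S (hT n)]
  simp_rw [e]
  refine le_trans (le_of_eq ?_) (lintegral_liminf_le fun n => ?_)
  · refine lintegral_congr_ae ?_
    filter_upwards [ae_tendsto_conv_moll (memLp_two_locallyIntegrable S.memLp_mom),
      ae_tendsto_conv_moll (memLp_two_locallyIntegrable S.memLp_dfld),
      ae_tendsto_conv_moll (memLp_two_locallyIntegrable S.memLp_fld)] with x h1 h2 h3
    exact ((((tendsto_enorm_sq h1).add (tendsto_enorm_sq h2)).add
      (ENNReal.Tendsto.const_mul (tendsto_enorm_sq h3) (Or.inr ENNReal.ofReal_ne_top))).liminf_eq).symm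
  · exact (((c1 n).enorm.measurable.pow_const 2).add ((c2 n).enorm.measurable.pow_const 2)).add
      (((c3 n).enorm.measurable.pow_const 2).const_mul _)

variable {f : Fin N → ℝ → ℂ}

/-- The mollified field at a point has a time derivative bounded in `L²`. -/
theorem exists_lintegral_conv_mom_le (hm : 0 < m) (hX : Function.Injective X)
    (hΨ : SolvesForcedKG m X f Ψ) (hfc : ∀ J, Continuous (f J)) (x₀ R : ℝ) :
    ∃ C : ℝ≥0, ∀ᶠ n in atTop,
      ∫⁻ t in Icc (-R) R, ‖conv (Ψ t).mom (moll2 n) x₀‖ₑ ^ 2 ≤ C := by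
  obtain ⟨δ, hδ, C, hC⟩ := exists_lintegral_time_difference_le hm hX hΨ hfc x₀ R
  have hE := hΨ.continuousInEnergy
  refine ⟨C, ?_⟩
  filter_upwards [eventually_radius_lt hδ] with n hn
  have hT := isTestFunction_moll2 n
  have hcY : Continuous fun t => conv (Ψ t).fld (moll2 n) x₀ :=
    (continuous_conv_fld hm hE hT).comp (Continuous.prodMk_right x₀)
  have hcF := hE.continuous_fld hm
  -- For large `n` the kernel only sees points within `δ` of `x₀`, where the `H¹` estimate in time
  -- holds with one constant; averaging against a kernel of `L¹` norm at most 1 preserves it.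
  have key : ∀ h : ℝ, 0 ≤ h → h ≤ 1 → ∫⁻ t in Icc (-R) R,
      ‖conv (Ψ (t + h)).fld (moll2 n) x₀ - conv (Ψ t).fld (moll2 n) x₀‖ₑ ^ 2 ≤
        ENNReal.ofReal (h ^ 2) * C := by
    intro h hh hh1
    have hcont : Continuous fun q : ℝ × ℝ => (Ψ (q.1 + h)).fld q.2 - (Ψ q.1).fld q.2 :=
      (hcF.comp (continuous_snd.prodMk (continuous_fst.add continuous_const))).sub
        (hcF.comp (continuous_snd.prodMk continuous_fst))
    have hσ : Continuous fun q : ℝ × ℝ => moll2 n (x₀ - q.2) :=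
      hT.continuous.comp (continuous_const.sub continuous_snd)
    calc _ ≤ ∫⁻ t in Icc (-R) R, ∫⁻ y, ‖moll2 n (x₀ - y)‖ₑ *
          ‖(Ψ (t + h)).fld y - (Ψ t).fld y‖ₑ ^ 2 := by
          refine lintegral_mono fun t => ?_
          rw [← conv_sub (Ψ (t + h)).continuous_fld.locallyIntegrable
            (Ψ t).continuous_fld.locallyIntegrable hT]
          refine (enorm_conv_sq_le_lintegral ((Ψ (t + h)).continuous_fld.sub
            (Ψ t).continuous_fld).aestronglyMeasurable hT x₀).trans ?_
          exact mul_le_of_le_one_left zero_le (lintegral_moll2_le n)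
      _ = ∫⁻ y, ∫⁻ t in Icc (-R) R, ‖moll2 n (x₀ - y)‖ₑ *
          ‖(Ψ (t + h)).fld y - (Ψ t).fld y‖ₑ ^ 2 := by
          rw [lintegral_lintegral_swap]
          exact (hσ.enorm.measurable.mul (hcont.enorm.measurable.pow_const 2)).aemeasurable
      _ ≤ ∫⁻ y, ‖moll2 n (x₀ - y)‖ₑ * (ENNReal.ofReal (h ^ 2) * C) := by
          refine lintegral_mono fun y => ?_
          by_cases hy : (2 / (n + 1) : ℝ) ≤ |x₀ - y|
          · simp [moll2_eq_zero hy]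
          · rw [lintegral_const_mul' _ _ enorm_ne_top]
            gcongr
            refine hC y ?_ h hh hh1
            rw [abs_sub_comm]
            exact (not_le.1 hy).trans hn
      _ ≤ _ := by
          rw [lintegral_mul_const' _ _ (by finiteness),
            lintegral_sub_left_eq_self (fun y => ‖moll2 n y‖ₑ)]
          exact mul_le_of_le_one_left zero_le (lintegral_moll2_le n)
  have hlim : ∀ t, Tendsto (fun k : ℕ => ‖((k : ℂ) + 1) *
      (conv (Ψ (t + 1 / ((k : ℝ) + 1))).fld (moll2 n) x₀ - conv (Ψ t).fld (moll2 n) x₀)‖ₑ ^ 2)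
      atTop (𝓝 (‖conv (Ψ t).mom (moll2 n) x₀‖ₑ ^ 2)) := by
    intro t
    have h1 := (hasDerivAt_conv_fld_time hΨ hT x₀ t).tendsto_slope_zero_right.comp
      tendsto_one_div_nhdsGT
    refine tendsto_enorm_sq (h1.congr fun k => ?_)
    simp only [Function.comp_apply]
    rw [Complex.real_smul]
    push_cast
    rw [one_div, inv_inv]
  -- The momentum at `x₀` makes sense only after mollification. It is the limit of the difference
  -- quotients with step `1/(k+1)`, to which Fatou's lemma applies.
  calc _ = ∫⁻ t in Icc (-R) R, liminf (fun k : ℕ => ‖((k : ℂ) + 1) *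
      (conv (Ψ (t + 1 / ((k : ℝ) + 1))).fld (moll2 n) x₀ - conv (Ψ t).fld (moll2 n) x₀)‖ₑ ^ 2)
        atTop := lintegral_congr fun t => (hlim t).liminf_eq.symm
    _ ≤ liminf (fun k : ℕ => ∫⁻ t in Icc (-R) R, ‖((k : ℂ) + 1) *
      (conv (Ψ (t + 1 / ((k : ℝ) + 1))).fld (moll2 n) x₀ - conv (Ψ t).fld (moll2 n) x₀)‖ₑ ^ 2)
        atTop := by
        refine lintegral_liminf_le fun k => ?_
        have : Continuous fun t => conv (Ψ (t + 1 / ((k : ℝ) + 1))).fld (moll2 n) x₀ :=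
          hcY.comp (continuous_id.add continuous_const)
        exact ((continuous_const.mul (this.sub hcY)).enorm.measurable.pow_const 2)
    _ ≤ C := by
        refine (liminf_le_of_le (by isBoundedDefault) fun b hb => ?_)
        obtain ⟨k, hk⟩ := hb.exists
        refine hk.trans ?_
        have hk1 : (0 : ℝ) < (k : ℝ) + 1 := by positivity
        have h2 := key (1 / ((k : ℝ) + 1)) (by positivity)
          ((div_le_one hk1).2 (by linarith [(k.cast_nonneg : (0 : ℝ) ≤ k)]))
        have e1 : ‖(k : ℂ) + 1‖ₑ ^ 2 = ENNReal.ofReal (((k : ℝ) + 1) ^ 2) := by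
          rw [← ofReal_norm, ← ENNReal.ofReal_pow (norm_nonneg _)]
          congr 2
          rw [show (k : ℂ) + 1 = (((k : ℝ) + 1 : ℝ) : ℂ) by push_cast; rfl, Complex.norm_real,
            Real.norm_of_nonneg hk1.le]
        simp_rw [enorm_mul, mul_pow, e1]
        rw [lintegral_const_mul' _ _ ENNReal.ofReal_ne_top]
        calc _ ≤ ENNReal.ofReal (((k : ℝ) + 1) ^ 2) *
              (ENNReal.ofReal ((1 / ((k : ℝ) + 1)) ^ 2) * C) := by gcongr
          _ = C := by
            rw [← mul_assoc, ← ENNReal.ofReal_mul (by positivity), ← mul_pow, mul_one_div_cancel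
              hk1.ne', one_pow, ENNReal.ofReal_one, one_mul]

end EnergyBound

/-! ### Uniform energy bounds for coupled and free solutions -/

section Coupled

variable {m : ℝ} {Ψ : ℝ → EnergyState} {N : ℕ} {X : Fin N → ℝ} {p : Fin N → ℕ}
  {u : Fin N → ℕ → ℝ} {f : Fin N → ℝ → ℂ}

theorem continuous_force_fld (hm : 0 < m) (hE : ContinuousInEnergy m Ψ) (J : Fin N) :
    Continuous (fun t => force (p J) (u J) ((Ψ t).fld (X J))) :=
  (continuous_force _ _).comp (hE.continuous_fld_right hm _)

theorem moll2_eq (n : ℕ) : moll2 n = conv (moll n) (moll n) := rfl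

theorem conj_moll (n : ℕ) (x : ℝ) : starRingEnd ℂ (moll n x) = moll n x := Complex.conj_ofReal _

/-- Dominated convergence: on a bounded time interval the field and its mollifications stay in one
ball, on which the force is bounded. -/
theorem tendsto_lintegral_force_sub (hm : 0 < m) (hE : ContinuousInEnergy m Ψ) {q : ℕ} {v : ℕ → ℝ}
    (x₀ a b : ℝ) : Tendsto (fun n => ∫⁻ s in Icc a b, ‖force q v ((Ψ s).fld x₀) -
      force q v (conv (Ψ s).fld (moll2 n) x₀)‖ₑ ^ 2) atTop (𝓝 0) := by
  obtain ⟨B, hB⟩ := hE.exists_bound a b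
  have hF := continuous_force q v
  obtain ⟨M, hM⟩ := (isCompact_closedBall (0 : ℂ) (fldBound m B)).exists_bound_of_continuousOn
    hF.continuousOn
  have hc : ∀ n, Continuous fun s => force q v ((Ψ s).fld x₀) -
      force q v (conv (Ψ s).fld (moll2 n) x₀) := fun n =>
    (hF.comp (hE.continuous_fld_right hm x₀)).sub (hF.comp
      ((continuous_conv_fld hm hE (isTestFunction_moll2 n)).comp (Continuous.prodMk_right x₀)))
  have h0 : ∫⁻ s in Icc a b, (0 : ℝ≥0∞) = 0 := lintegral_zero
  rw [← h0]
  refine tendsto_lintegral_of_dominated_convergence' (fun _ => ENNReal.ofReal (2 * M) ^ 2)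
    (fun n => ((hc n).enorm.measurable.pow_const 2).aemeasurable) (fun n => ?_) ?_
    (ae_of_all _ fun s => ?_)
  · rw [EventuallyLE, ae_restrict_iff' measurableSet_Icc]
    refine ae_of_all _ fun s hs => ?_
    gcongr
    rw [← ofReal_norm]
    refine ENNReal.ofReal_le_ofReal ((norm_sub_le _ _).trans ?_)
    have hb := fun y => norm_fld_le_fldBound hm (hB s hs) y
    have h1 := hM _ (mem_closedBall_zero_iff.2 (hb x₀))
    have h2 := hM _ (mem_closedBall_zero_iff.2 (norm_conv_moll2_le (g := (Ψ s).fld) n x₀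
      (Real.sqrt_nonneg _) fun y _ => hb y))
    linarith
  · rw [setLIntegral_const]
    exact ENNReal.mul_ne_top (by finiteness) (by simp)
  · have h1 := (hF.tendsto _).comp (tendsto_conv_moll2 (Ψ s).continuous_fld x₀)
    have h2 := tendsto_enorm_sq (h1.const_sub (force q v ((Ψ s).fld x₀)))
    simpa using h2

/-- By Cauchy–Schwarz in time: the difference of forces tends to 0 in `L²`, while the mollified
velocity is bounded in `L²` by local regularity. -/
theorem tendsto_work_error (hm : 0 < m) (hX : Function.Injective X)
    (hΨ : SolvesForcedKG m X f Ψ) (hfc : ∀ J, Continuous (f J)) {q : ℕ} {v : ℕ → ℝ}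
    (x₀ : ℝ) {a b : ℝ} (hab : a ≤ b) :
    Tendsto (fun n => ∫ s in a..b, ((force q v ((Ψ s).fld x₀) -
      force q v (conv (Ψ s).fld (moll2 n) x₀)) *
        starRingEnd ℂ (conv (Ψ s).mom (moll2 n) x₀)).re) atTop (𝓝 0) := by
  have hE := hΨ.continuousInEnergy
  obtain ⟨C, hC⟩ := exists_lintegral_conv_mom_le hm hX hΨ hfc x₀ (|a| + |b|)
  have hF := continuous_force q v
  have hc : ∀ n, Continuous fun s => force q v ((Ψ s).fld x₀) -
      force q v (conv (Ψ s).fld (moll2 n) x₀) := fun n =>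
    (hF.comp (hE.continuous_fld_right hm x₀)).sub (hF.comp
      ((continuous_conv_fld hm hE (isTestFunction_moll2 n)).comp (Continuous.prodMk_right x₀)))
  have hc' : ∀ n, Continuous fun s => conv (Ψ s).mom (moll2 n) x₀ := fun n =>
    (continuous_conv_mom hE (isTestFunction_moll2 n)).comp (Continuous.prodMk_right x₀)
  have hlim : Tendsto (fun n => (∫⁻ s in Icc a b, ‖force q v ((Ψ s).fld x₀) -
      force q v (conv (Ψ s).fld (moll2 n) x₀)‖ₑ ^ 2) * C) atTop (𝓝 0) := by
    simpa using ENNReal.Tendsto.mul_const (tendsto_lintegral_force_sub hm hE (q := q) (v := v) x₀ a b)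
      (Or.inr ENNReal.coe_ne_top)
  refine tendsto_zero_of_enorm_sq
    (tendsto_of_tendsto_of_tendsto_of_le_of_le' tendsto_const_nhds hlim
      (Eventually.of_forall fun _ => zero_le) ?_)
  filter_upwards [hC] with n hn
  rw [intervalIntegral.integral_of_le hab, ← integral_Icc_eq_integral_Ioc]
  have hsub : Icc a b ⊆ Icc (-(|a| + |b|)) (|a| + |b|) :=
    Icc_subset_Icc (by linarith [neg_abs_le a, abs_nonneg b]) (by linarith [le_abs_self b, abs_nonneg a])
  calc _ ≤ (∫⁻ s in Icc a b, ‖force q v ((Ψ s).fld x₀) -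
        force q v (conv (Ψ s).fld (moll2 n) x₀)‖ₑ * ‖conv (Ψ s).mom (moll2 n) x₀‖ₑ) ^ 2 := by
        refine pow_le_pow_left' ((enorm_integral_le_lintegral_enorm _).trans
          (lintegral_mono fun s => ?_)) 2
        rw [← ofReal_norm, ← ofReal_norm, ← ofReal_norm, ← ENNReal.ofReal_mul (norm_nonneg _)]
        refine ENNReal.ofReal_le_ofReal ((Complex.abs_re_le_norm _).trans ?_)
        rw [norm_mul, RCLike.norm_conj]
    _ ≤ _ := lintegral_mul_sq_le (hc n).enorm.measurable.aemeasurable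
        (hc' n).enorm.measurable.aemeasurable
    _ ≤ _ := by
        gcongr
        exact (lintegral_mono_set hsub).trans hn

/-- The true force is replaced by the force at the mollified field, at the cost of
`tendsto_work_error`. The work of the latter is an exact derivative in time and equals a difference
of potentials, which converges. -/
theorem tendsto_energy_balance (hm : 0 < m) (hX : Function.Injective X)
    (hΨ : SolvesCoupledKG m X p u Ψ) {a b : ℝ} (hab : a ≤ b) :
    Tendsto (fun n => (∫ x, mollDensity m (moll n) (Ψ b) x) - ∫ x, mollDensity m (moll n) (Ψ a) x)
      atTop (𝓝 (2 * ∑ J, (potential (p J) (u J) ((Ψ a).fld (X J)) -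
        potential (p J) (u J) ((Ψ b).fld (X J))))) := by
  have hE := hΨ.continuousInEnergy
  have hfc := fun J => continuous_force_fld (p := p) (u := u) (X := X) hm hE J
  have hcm : ∀ n J, Continuous fun s => starRingEnd ℂ (conv (Ψ s).mom (moll2 n) (X J)) := fun n J =>
    Complex.continuous_conj.comp
      ((continuous_conv_mom hE (isTestFunction_moll2 n)).comp (Continuous.prodMk_right (X J)))
  have hcF : ∀ n J, Continuous fun s => force (p J) (u J) (conv (Ψ s).fld (moll2 n) (X J)) :=
    fun n J => (continuous_force _ _).comp
      ((continuous_conv_fld hm hE (isTestFunction_moll2 n)).comp (Continuous.prodMk_right (X J)))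
  have hpot : ∀ n J, ∫ s in a..b, (force (p J) (u J) (conv (Ψ s).fld (moll2 n) (X J)) *
      starRingEnd ℂ (conv (Ψ s).mom (moll2 n) (X J))).re =
      potential (p J) (u J) (conv (Ψ a).fld (moll2 n) (X J)) -
        potential (p J) (u J) (conv (Ψ b).fld (moll2 n) (X J)) := by
    intro n J
    have h := intervalIntegral.integral_eq_sub_of_hasDerivAt (a := a) (b := b)
      (fun s _ => hasDerivAt_potential (p J) (u J)
        (hasDerivAt_conv_fld_time hΨ (isTestFunction_moll2 n) (X J) s))
      (((Complex.continuous_re.comp ((hcF n J).mul (hcm n J))).neg).intervalIntegrable a b)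
    rw [intervalIntegral.integral_neg] at h
    linarith
  have hbal : ∀ n, (∫ x, mollDensity m (moll n) (Ψ b) x) - ∫ x, mollDensity m (moll n) (Ψ a) x =
      2 * ∑ J, ((∫ s in a..b, ((force (p J) (u J) ((Ψ s).fld (X J)) -
        force (p J) (u J) (conv (Ψ s).fld (moll2 n) (X J))) *
          starRingEnd ℂ (conv (Ψ s).mom (moll2 n) (X J))).re) +
        (potential (p J) (u J) (conv (Ψ a).fld (moll2 n) (X J)) -
          potential (p J) (u J) (conv (Ψ b).fld (moll2 n) (X J)))) := by
    intro n
    rw [integral_mollDensity_sub hm hΨ hfc (isTestFunction_moll n) (conj_moll n) (moll_neg n) hab,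
      intervalIntegral.integral_const_mul, intervalIntegral.integral_finsetSum]
    · congr 1
      refine Finset.sum_congr rfl fun J _ => ?_
      rw [← hpot, ← intervalIntegral.integral_add]
      · refine intervalIntegral.integral_congr fun s _ => ?_
        simp only [← Complex.add_re, ← moll2_eq]
        congr 1; ring
      · exact (Complex.continuous_re.comp (((hfc J).sub (hcF n J)).mul
          (hcm n J))).intervalIntegrable a b
      · exact (Complex.continuous_re.comp ((hcF n J).mul (hcm n J))).intervalIntegrable a b
    · intro J _
      exact (Complex.continuous_re.comp ((hfc J).mul (hcm n J))).intervalIntegrable a b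
  simp_rw [hbal]
  refine Tendsto.const_mul 2 (tendsto_finsetSum _ fun J _ => ?_)
  have h1 := tendsto_work_error hm hX hΨ hfc (q := p J) (v := u J) (X J) hab
  have h2 := fun t => ((continuous_potential (p J) (u J)).tendsto _).comp
    (tendsto_conv_moll2 (Ψ t).continuous_fld (X J))
  simpa using h1.add ((h2 a).sub (h2 b))

/-- The energy inequality. -/
theorem energy_le_of_solvesCoupledKG (hm : 0 < m) (hX : Function.Injective X)
    (hΨ : SolvesCoupledKG m X p u Ψ) (a b : ℝ) :
    (Ψ b).energy m ≤ ENNReal.ofReal (((Ψ a).energy m).toReal +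
      2 * ∑ J, (potential (p J) (u J) ((Ψ a).fld (X J)) -
        potential (p J) (u J) ((Ψ b).fld (X J)))) := by
  have hlim : Tendsto (fun n => (∫ x, mollDensity m (moll n) (Ψ b) x) -
      ∫ x, mollDensity m (moll n) (Ψ a) x) atTop (𝓝 (2 * ∑ J,
        (potential (p J) (u J) ((Ψ a).fld (X J)) - potential (p J) (u J) ((Ψ b).fld (X J))))) := by
    -- The balance is an identity in the limit, so it may be read backwards in time; this is what
    -- gives a bound for negative times.
    rcases le_total a b with hab | hab
    · exact tendsto_energy_balance hm hX hΨ hab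
    · have h := (tendsto_energy_balance hm hX hΨ hab).neg
      simp only [neg_sub, ← mul_neg, ← Finset.sum_neg_distrib] at h
      exact h
  refine (energy_le_liminf (Ψ b)).trans ?_
  have h2 := (ENNReal.continuous_ofReal.tendsto _).comp (hlim.const_add ((Ψ a).energy m).toReal)
  rw [← h2.liminf_eq]
  refine liminf_le_liminf (Eventually.of_forall fun n => ?_)
  rw [energy_moll_eq]
  refine ENNReal.ofReal_le_ofReal ?_
  have h3 := ENNReal.toReal_mono ((Ψ a).energy_lt_top m).ne (energy_moll_le (m := m) (Ψ a) n)
  rw [energy_moll_eq, ENNReal.toReal_ofReal (integral_nonneg fun x => by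
    simp only [mollDensity, Pi.zero_apply]; positivity)] at h3
  linarith

/-- The energy of a solution is bounded uniformly in time. -/
theorem SolvesCoupledKG.exists_energy_bound (hm : 0 < m) (hX : Function.Injective X)
    (hp : ∀ J, 1 ≤ p J) (hu : ∀ J, 0 < u J (p J)) (hΨ : SolvesCoupledKG m X p u Ψ) :
    ∃ B : ℝ≥0, ∀ t, (Ψ t).energy m ≤ B := by
  have h : ∀ J, ∃ K : ℝ, ∀ z, K ≤ potential (p J) (u J) z := fun J =>
    exists_potential_ge (hp J) (hu J)
  choose K hK using h
  refine ⟨(((Ψ 0).energy m).toReal + 2 * ∑ J, (potential (p J) (u J) ((Ψ 0).fld (X J)) -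
    K J)).toNNReal, fun t => (energy_le_of_solvesCoupledKG hm hX hΨ 0 t).trans ?_⟩
  refine ENNReal.ofReal_le_ofReal ?_
  gcongr with J
  exact hK J _

/-- The free equation is the coupled one with an empty set of oscillators. -/
theorem SolvesFreeKG.exists_energy_bound (hm : 0 < m) (hΨ : SolvesFreeKG m Ψ) :
    ∃ B : ℝ≥0, ∀ t, (Ψ t).energy m ≤ B := by
  have h : SolvesCoupledKG (N := 0) m Fin.elim0 Fin.elim0 Fin.elim0 Ψ := by
    have e : (fun (J : Fin 0) t => force ((Fin.elim0 : Fin 0 → ℕ) J) ((Fin.elim0 : Fin 0 → ℕ → ℝ) J)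
        ((Ψ t).fld ((Fin.elim0 : Fin 0 → ℝ) J))) = Fin.elim0 := funext fun J => J.elim0
    rw [SolvesCoupledKG, e]
    exact hΨ
  exact h.exists_energy_bound hm (fun J => J.elim0) (fun J => J.elim0) (fun J => J.elim0)

/-- A free solution solves the equation with vanishing forces at any points. -/
theorem SolvesFreeKG.solvesForcedKG (hΨ : SolvesFreeKG m Ψ) (X : Fin N → ℝ) :
    SolvesForcedKG m X (fun _ _ => 0) Ψ where
  continuousInEnergy := hΨ.continuousInEnergy
  hasDerivAt_fld := hΨ.hasDerivAt_fld
  hasDerivAt_mom ρ hρ t := by simpa using hΨ.hasDerivAt_mom ρ hρ t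

end Coupled

/-! ### Cutoffs in time with compact spectrum -/

section Cutoff

/-- A test function as a Schwartz function. -/
def IsTestFunction.toSchwartz {ρ : ℝ → ℂ} (h : IsTestFunction ρ) : 𝓢(ℝ, ℂ) :=
  Classical.choose (exists_schwartz h.1 h.2)

theorem IsTestFunction.coe_toSchwartz {ρ : ℝ → ℂ} (h : IsTestFunction ρ) : ⇑h.toSchwartz = ρ :=
  funext (Classical.choose_spec (exists_schwartz h.1 h.2))

/-- The spectrum of the cutoff in time of length `n + 1`. -/
def cutoffSpec (n : ℕ) (ν : ℝ) : ℂ := ((n + 1 : ℝ) : ℂ) * moll 0 ((n + 1 : ℝ) * ν)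

theorem isTestFunction_cutoffSpec (n : ℕ) : IsTestFunction (cutoffSpec n) := by
  have h := isTestFunction_moll 0
  have hn : (n + 1 : ℝ) ≠ 0 := by positivity
  refine ⟨contDiff_const.mul (h.1.comp (contDiff_const.mul contDiff_id)), ?_⟩
  exact (h.2.comp_smul hn).mul_left

theorem cutoffSpec_eq_zero {n : ℕ} {ν : ℝ} (h : (1 / (n + 1) : ℝ) ≤ |ν|) : cutoffSpec n ν = 0 := by
  rw [cutoffSpec, moll_eq_zero, mul_zero]
  have hn : (0 : ℝ) < n + 1 := by positivity
  rw [abs_mul, abs_of_pos hn]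
  rw [div_le_iff₀ hn] at h
  simpa [mul_comm] using h

/-- A cutoff in time of length `n + 1` whose spectrum is compactly supported. -/
def cutoff (n : ℕ) : 𝓢(ℝ, ℂ) := ftS (isTestFunction_cutoffSpec n).toSchwartz

theorem cutoff_eq_ft (n : ℕ) (t : ℝ) : cutoff n t = ft (cutoffSpec n) t := by
  rw [cutoff, ftS_apply, IsTestFunction.coe_toSchwartz]

theorem cutoff_apply (n : ℕ) (t : ℝ) : cutoff n t = ft (moll 0) ((n + 1 : ℝ)⁻¹ * t) := by
  have hn : (0 : ℝ) < n + 1 := by positivity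
  rw [cutoff_eq_ft, ft, ft]
  have h := Measure.integral_comp_mul_left
    (fun ν : ℝ => Complex.exp (Complex.I * (((n + 1 : ℝ)⁻¹ * t : ℝ) : ℂ) * ν) * moll 0 ν) (n + 1 : ℝ)
  rw [abs_of_pos (inv_pos.2 hn)] at h
  have h2 : ∫ ν : ℝ, Complex.exp (Complex.I * (((n + 1 : ℝ)⁻¹ * t : ℝ) : ℂ) * ν) * moll 0 ν =
      (n + 1 : ℝ) • ∫ x : ℝ, Complex.exp (Complex.I * (((n + 1 : ℝ)⁻¹ * t : ℝ) : ℂ) *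
        (((n + 1 : ℝ) * x : ℝ) : ℂ)) * moll 0 ((n + 1 : ℝ) * x) := by
    rw [h, smul_smul, mul_inv_cancel₀ hn.ne', one_smul]
  rw [h2, ← integral_smul]
  refine integral_congr_ae (ae_of_all _ fun ν => ?_)
  simp only [cutoffSpec, Complex.real_smul]
  have e : Complex.I * (((n + 1 : ℝ)⁻¹ * t : ℝ) : ℂ) * (((n + 1 : ℝ) * ν : ℝ) : ℂ) =
      Complex.I * t * ν := by
    have : (((n : ℝ) + 1 : ℝ) : ℂ) ≠ 0 := by exact_mod_cast hn.ne'
    rw [Complex.ofReal_mul, Complex.ofReal_mul, Complex.ofReal_inv]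
    field_simp
  rw [e]
  ring

theorem cutoff_zero_apply (t : ℝ) : cutoff 0 t = ft (moll 0) t := by
  rw [cutoff_apply]; simp

theorem cutoff_eq_dilation (n : ℕ) (t : ℝ) : cutoff n t = cutoff 0 ((n + 1 : ℝ)⁻¹ * t) := by
  rw [cutoff_apply, cutoff_zero_apply]

theorem norm_cutoff_le (n : ℕ) (t : ℝ) : ‖cutoff n t‖ ≤ 1 := by
  rw [cutoff_apply]
  refine (norm_ft_le _ _).trans ?_
  rw [integral_norm_eq_lintegral_enorm (isTestFunction_moll 0).continuous.aestronglyMeasurable,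
    lintegral_moll, ENNReal.toReal_one]

theorem tendsto_cutoff (t : ℝ) : Tendsto (fun n => cutoff n t) atTop (𝓝 1) := by
  have h1 := (continuous_ft (isTestFunction_moll 0).integrable).tendsto 0
  have h2 : ft (moll 0) 0 = 1 := by simp [ft, integral_moll]
  rw [h2] at h1
  have h3 : Tendsto (fun n : ℕ => ((n : ℝ) + 1)⁻¹ * t) atTop (𝓝 0) := by
    simpa using (tendsto_one_div_add_atTop_nhds_zero_nat (𝕜 := ℝ)).mul_const t
  exact (h1.comp h3).congr fun n => (cutoff_apply n t).symm

theorem dS_dilation {κ κ' : 𝓢(ℝ, ℂ)} {a : ℝ} {c : ℂ} (h : ∀ t, κ' t = c * κ (a * t)) (t : ℝ) :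
    dS κ' t = c * a * dS κ (a * t) := by
  have h1 : HasDerivAt (fun t => a * t) a t := by simpa using (hasDerivAt_id t).const_mul a
  have h2 := ((hasDerivAt_schwartz κ (a * t)).scomp t h1).const_mul c
  have h3 := hasDerivAt_schwartz κ' t
  rw [show ⇑κ' = fun t => c * κ (a * t) from funext h] at h3
  rw [h3.unique h2, Complex.real_smul, mul_assoc]

theorem cutNorm_dilation {κ κ' : 𝓢(ℝ, ℂ)} {a : ℝ} (ha : 0 < a) {c : ℂ}
    (h : ∀ t, κ' t = c * κ (a * t)) :
    cutNorm κ' = ‖c‖ₑ ^ 2 * (ENNReal.ofReal a⁻¹ * cutNorm κ) := by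
  rw [cutNorm, cutNorm]
  simp_rw [h, enorm_mul, mul_pow]
  rw [lintegral_const_mul' _ _ (by simp), lintegral_comp_mul_left (fun t => ‖κ t‖ₑ ^ 2) ha.ne',
    abs_of_pos (inv_pos.2 ha)]

theorem enorm_real_sq (a : ℝ) : ‖(a : ℂ)‖ₑ ^ 2 = ENNReal.ofReal (a ^ 2) := by
  rw [← ofReal_norm, ← ENNReal.ofReal_pow (norm_nonneg _), Complex.norm_real, Real.norm_eq_abs,
    sq_abs]

theorem sideConst_eq (m : ℝ) (κ : 𝓢(ℝ, ℂ)) (B : ℝ≥0) (L : ℝ) : sideConst m κ B L =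
    ENNReal.ofReal (2 * Real.pi) * (4 * B * (ENNReal.ofReal L⁻¹ * cutNorm κ) +
      2 * (ENNReal.ofReal (1 / m ^ 2) * B) * (ENNReal.ofReal L⁻¹ * cutNorm (dS κ)) +
      16 * B * (ENNReal.ofReal L * cutNorm (dS κ)) +
      18 * (ENNReal.ofReal (1 / m ^ 2) * B) * (ENNReal.ofReal L * cutNorm (dS (dS κ)))) := by
  rw [sideConst]; ring

/-- With `L = n + 1`, the squared norms of the cutoff and of its first two derivatives scale like
`L`, `L⁻¹` and `L⁻³`. The four terms then scale like `L⁻¹L`, `L⁻¹L⁻¹`, `L L⁻¹` and `L L⁻³`, none of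
which grows. The choice of averaging length equal to the duration of the cutoff is dictated by this
balance. -/
theorem sideConst_cutoff_le (m : ℝ) (B : ℝ≥0) (n : ℕ) :
    sideConst m (cutoff n) B (n + 1) ≤ sideConst m (cutoff 0) B 1 := by
  have hn : (0 : ℝ) < n + 1 := by positivity
  have hn1 : (1 : ℝ) ≤ n + 1 := by linarith [(n.cast_nonneg : (0 : ℝ) ≤ n)]
  have hi1 : ((n : ℝ) + 1)⁻¹ ≤ 1 := inv_le_one_of_one_le₀ hn1
  have hi0 : 0 < ((n : ℝ) + 1)⁻¹ := inv_pos.2 hn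
  have e0 : ∀ t, cutoff n t = ((1 : ℝ) : ℂ) * cutoff 0 ((n + 1 : ℝ)⁻¹ * t) := fun t => by
    rw [Complex.ofReal_one, one_mul, cutoff_eq_dilation]
  have e1 := fun t => (dS_dilation e0 t).trans (by rw [← Complex.ofReal_mul])
  have e2 := fun t => (dS_dilation e1 t).trans (by rw [← Complex.ofReal_mul])
  have n0 := cutNorm_dilation hi0 e0
  have n1 := cutNorm_dilation hi0 e1
  have n2 := cutNorm_dilation hi0 e2
  rw [enorm_real_sq, ← mul_assoc, ← ENNReal.ofReal_mul (by positivity), inv_inv] at n0 n1 n2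
  have key : ∀ {a b : ℝ} {c : ℝ≥0∞}, 0 ≤ a → a * b ≤ 1 →
      ENNReal.ofReal a * (ENNReal.ofReal b * c) ≤ ENNReal.ofReal 1 * c := by
    intro a b c ha hb
    rw [← mul_assoc, ← ENNReal.ofReal_mul ha]
    gcongr
  have h0 : ((n : ℝ) + 1)⁻¹ * (n + 1) = 1 := inv_mul_cancel₀ hn.ne'
  rw [sideConst_eq, sideConst_eq, n0, n1, n2, inv_one]
  set L : ℝ := (n : ℝ) + 1
  have mono : ∀ {P b₁ b₂ b₃ b₄ x₁ x₂ x₃ x₄ y₁ y₂ y₃ y₄ : ℝ≥0∞}, x₁ ≤ y₁ → x₂ ≤ y₂ → x₃ ≤ y₃ →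
      x₄ ≤ y₄ → P * (b₁ * x₁ + b₂ * x₂ + b₃ * x₃ + b₄ * x₄) ≤
        P * (b₁ * y₁ + b₂ * y₂ + b₃ * y₃ + b₄ * y₄) := by
    intros
    gcongr
  refine mono ?_ ?_ ?_ ?_
  · refine key hi0.le ?_
    calc L⁻¹ * (1 ^ 2 * L) = L⁻¹ * L := by ring
      _ ≤ 1 := h0.le
  · refine key hi0.le ?_
    calc L⁻¹ * ((1 * L⁻¹) ^ 2 * L) = L⁻¹ ^ 2 * (L⁻¹ * L) := by ring
      _ ≤ 1 := by rw [h0, mul_one]; exact pow_le_one₀ hi0.le hi1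
  · refine key hn.le ?_
    calc L * ((1 * L⁻¹) ^ 2 * L) = (L⁻¹ * L) ^ 2 := by ring
      _ ≤ 1 := by rw [h0]; norm_num
  · refine key hn.le ?_
    calc L * ((1 * L⁻¹ * L⁻¹) ^ 2 * L) = L⁻¹ ^ 2 * (L⁻¹ * L) ^ 2 := by ring
      _ ≤ 1 := by rw [h0, one_pow, mul_one]; exact pow_le_one₀ hi0.le hi1

theorem cutNorm_lt_top (κ : 𝓢(ℝ, ℂ)) : cutNorm κ < ⊤ :=
  KGOscillators.MemLp.lintegral_sq_lt_top (κ.memLp 2 volume)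

theorem sideConst_lt_top (m : ℝ) (κ : 𝓢(ℝ, ℂ)) (B : ℝ≥0) (L : ℝ) : sideConst m κ B L < ⊤ := by
  have := (cutNorm_lt_top κ).ne
  have := (cutNorm_lt_top (dS κ)).ne
  have := (cutNorm_lt_top (dS (dS κ))).ne
  rw [sideConst]
  finiteness

end Cutoff

/-! ### Low-pass filters and band-limited functions -/

section LowPass

open scoped Pointwise

/-- The functions `g n` are eventually uniformly integrable over the frequencies `|ξ| > a + δ`, for
every `δ > 0`. -/
def EvBdd (g : ℕ → ℝ → ℝ≥0∞) (a : ℝ) : Prop :=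
  ∀ δ : ℝ, 0 < δ → ∃ C : ℝ≥0, ∀ᶠ n in atTop, ∫⁻ ξ in highFreq (a + δ), g n ξ ≤ C

theorem measurableSet_highFreq (a : ℝ) : MeasurableSet (highFreq a) :=
  measurableSet_lt measurable_const measurable_id.abs

theorem highFreq_anti {a b : ℝ} (h : a ≤ b) : highFreq b ⊆ highFreq a := fun _ hx => h.trans_lt hx

theorem integrable_conv {g ρ : ℝ → ℂ} (hg : Integrable g) (hρ : Integrable ρ) :
    Integrable (conv g ρ) := by
  rw [conv_eq_convolution]
  exact hρ.integrable_convolution _ hg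

theorem ft_conv {g ρ : ℝ → ℂ} (hg : Integrable g) (hρ : Integrable ρ) (ξ : ℝ) :
    ft (conv g ρ) ξ = ft g ξ * ft ρ ξ := by
  have h := integral_convolution (μ := volume) (ν := volume)
    (ContinuousLinearMap.lsmul ℝ ℂ : ℂ →L[ℝ] ℂ →L[ℝ] ℂ)
    (integrable_exp_mul hρ ξ) (integrable_exp_mul hg ξ)
  rw [← conv_eq_convolution] at h
  have h2 : conv (fun t : ℝ => Complex.exp (Complex.I * ξ * t) * g t)
      (fun t : ℝ => Complex.exp (Complex.I * ξ * t) * ρ t) =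
      fun t : ℝ => Complex.exp (Complex.I * ξ * t) * conv g ρ t := by
    ext x
    rw [conv, conv, ← integral_const_mul]
    refine integral_congr_ae (ae_of_all _ fun y => ?_)
    simp only
    rw [show Complex.I * ξ * x = Complex.I * ξ * y + Complex.I * ξ * ((x - y : ℝ) : ℂ) by
      push_cast; ring, Complex.exp_add]
    ring
  rw [h2] at h
  rw [ft, h, mul_comm (ft g ξ)]
  rfl

/-- Continuous and bounded. -/
def BddCont (c : ℝ → ℂ) : Prop := Continuous c ∧ ∃ K : ℝ, ∀ t, ‖c t‖ ≤ K

theorem BddCont.mul {c d : ℝ → ℂ} (hc : BddCont c) (hd : BddCont d) :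
    BddCont (fun t => c t * d t) := by
  obtain ⟨K, hK⟩ := hc.2
  obtain ⟨L, hL⟩ := hd.2
  refine ⟨hc.1.mul hd.1, K * L, fun t => ?_⟩
  rw [norm_mul]
  exact mul_le_mul (hK t) (hL t) (norm_nonneg _) ((norm_nonneg _).trans (hK t))

theorem BddCont.conj {c : ℝ → ℂ} (hc : BddCont c) : BddCont (fun t => starRingEnd ℂ (c t)) := by
  obtain ⟨K, hK⟩ := hc.2
  exact ⟨Complex.continuous_conj.comp hc.1, K, fun t => by simpa using hK t⟩

theorem BddCont.const (z : ℂ) : BddCont (fun _ => z) := ⟨continuous_const, ‖z‖, fun _ => le_rfl⟩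

theorem BddCont.integrable_mul {c g : ℝ → ℂ} (hc : BddCont c) (hg : Integrable g) :
    Integrable (fun t => c t * g t) := by
  obtain ⟨K, hK⟩ := hc.2
  exact hg.bdd_mul hc.1.aestronglyMeasurable (ae_of_all _ hK)

theorem BddCont.memLp_mul {c g : ℝ → ℂ} (hc : BddCont c) (hg : MemLp g 2 volume) :
    MemLp (fun t => c t * g t) 2 volume := by
  obtain ⟨K, hK⟩ := hc.2
  refine (hg.const_mul (K : ℂ)).of_le (hc.1.aestronglyMeasurable.mul hg.1) (ae_of_all _ fun t => ?_)
  rw [norm_mul, norm_mul, Complex.norm_real]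
  gcongr
  exact (hK t).trans (le_abs_self K)

theorem conv_eq_integral_sub (u Z : ℝ → ℂ) (t : ℝ) : conv u Z t = ∫ y, u (t - y) * Z y := by
  rw [conv, ← integral_sub_left_eq_self (fun y => u y * Z (t - y)) volume t]
  simp

theorem BddCont.conv {u : ℝ → ℂ} (hu : BddCont u) {Z : ℝ → ℂ} (hZ : Integrable Z) :
    BddCont (conv u Z) := by
  obtain ⟨K, hK⟩ := hu.2
  have hle : ∀ t y, ‖u (t - y) * Z y‖ ≤ K * ‖Z y‖ := fun t y => by
    rw [norm_mul]; gcongr; exact hK _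
  refine ⟨?_, K * ∫ y, ‖Z y‖, fun t => ?_⟩
  · have : KGOscillators.conv u Z = fun t => ∫ y, u (t - y) * Z y :=
      funext (conv_eq_integral_sub u Z)
    rw [this]
    refine continuous_of_dominated (fun t => ?_) (fun t => ae_of_all _ (hle t)) (hZ.norm.const_mul K)
      (ae_of_all _ fun y => ?_)
    · exact (hu.1.comp (continuous_const.sub continuous_id)).aestronglyMeasurable.mul hZ.1
    · exact (hu.1.comp (continuous_id.sub continuous_const)).mul continuous_const
  · rw [conv_eq_integral_sub, ← integral_const_mul]
    exact norm_integral_le_of_norm_le (hZ.norm.const_mul K) (ae_of_all _ (hle t))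

theorem memLp_two_of_bounded {w : ℝ → ℂ} (hi : Integrable w) {K : ℝ} (hK : ∀ t, ‖w t‖ ≤ K) :
    MemLp w 2 volume := by
  refine ⟨hi.1, ?_⟩
  rw [eLpNorm_lt_top_iff_lintegral_rpow_enorm_lt_top (by simp) (by simp)]
  have h : ∀ t, ‖w t‖ₑ ^ (2 : ℝ) ≤ ENNReal.ofReal K * ‖w t‖ₑ := fun t => by
    rw [ENNReal.rpow_two, sq]
    gcongr
    rw [← ofReal_norm]
    exact ENNReal.ofReal_le_ofReal (hK t)
  refine lt_of_le_of_lt (lintegral_mono (g := fun t => ENNReal.ofReal K * ‖w t‖ₑ) fun t => h t) ?_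
  rw [lintegral_const_mul' _ _ ENNReal.ofReal_ne_top]
  exact ENNReal.mul_lt_top ENNReal.ofReal_lt_top hi.2

variable (b : ContDiffBump (0 : ℝ))

theorem isTestFunction_bump : IsTestFunction (fun ν => (b ν : ℂ)) :=
  isTestFunction_ofReal b.contDiff b.hasCompactSupport

/-- The kernel of the low-pass filter with transfer function `b`. -/
def lowPass : 𝓢(ℝ, ℂ) := ((2 * Real.pi : ℝ) : ℂ)⁻¹ • ftS (isTestFunction_bump b).toSchwartz

theorem lowPass_apply (t : ℝ) : lowPass b t = ((2 * Real.pi : ℝ) : ℂ)⁻¹ * ft (fun ν => (b ν : ℂ)) t := by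
  rw [lowPass, smul_apply, ftS_apply, IsTestFunction.coe_toSchwartz, smul_eq_mul]

theorem ft_lowPass (ν : ℝ) : ft (lowPass b) ν = b ν := by
  have h := integral_ft_eq (isTestFunction_bump b).toSchwartz (-ν)
  rw [IsTestFunction.coe_toSchwartz] at h
  have e : (lowPass b : ℝ → ℂ) = fun t => ((2 * Real.pi : ℝ) : ℂ)⁻¹ * ft (fun ν => (b ν : ℂ)) t :=
    funext (lowPass_apply b)
  rw [e, ft_const_mul, ft]
  simp only [Complex.ofReal_neg, mul_neg, neg_mul, neg_neg, b.neg] at h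
  rw [h]
  push_cast
  have : (Real.pi : ℂ) ≠ 0 := by exact_mod_cast Real.pi_ne_zero
  field_simp

theorem conj_lowPass (t : ℝ) : starRingEnd ℂ (lowPass b t) = lowPass b t := by
  rw [lowPass_apply, map_mul, map_inv₀, Complex.conj_ofReal]
  congr 1
  rw [ft, ← integral_conj, ← integral_neg_eq_self]
  refine integral_congr_ae (ae_of_all _ fun ν => ?_)
  simp only [map_mul, Complex.conj_ofReal, b.neg]
  rw [← Complex.exp_conj]
  simp

theorem conj_conv_lowPass (u : ℝ → ℂ) (t : ℝ) :
    starRingEnd ℂ (conv u (lowPass b) t) =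
      conv (fun s => starRingEnd ℂ (u s)) (lowPass b) t := by
  rw [conv, conv, ← integral_conj]
  simp only [map_mul, conj_lowPass]

theorem integrable_cutoff_mul {u : ℝ → ℂ} (hu : BddCont u) (κ : 𝓢(ℝ, ℂ)) :
    Integrable (fun t => κ t * u t) := by
  simpa [mul_comm] using hu.integrable_mul κ.integrable

theorem memLp_cutoff_mul {u : ℝ → ℂ} (hu : BddCont u) (κ : 𝓢(ℝ, ℂ)) :
    MemLp (fun t => κ t * u t) 2 volume := by
  simpa [mul_comm] using hu.memLp_mul (κ.memLp 2 volume)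

/-- A bounded function whose spectrum is square integrable at high frequencies differs from its
low-frequency part by a square integrable function. -/
theorem lintegral_sub_lowPass_lt_top {u : ℝ → ℂ} (hu : BddCont u) {a : ℝ}
    (h : EvBdd (fun n ξ => ‖ft (fun t => cutoff n t * u t) ξ‖ₑ ^ 2) a) (hb : a < b.rIn) :
    ∫⁻ t, ‖u t - conv u (lowPass b) t‖ₑ ^ 2 < ⊤ := by
  obtain ⟨C, hC⟩ := h (b.rIn - a) (by linarith)
  rw [add_sub_cancel] at hC
  obtain ⟨K, hK⟩ := hu.2
  have hK0 : 0 ≤ K := (norm_nonneg _).trans (hK 0)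
  have hZ : Integrable (lowPass b) := (lowPass b).integrable
  have hv := fun n => integrable_cutoff_mul hu (cutoff n)
  have hvB : ∀ n t, ‖cutoff n t * u t‖ ≤ K := fun n t => by
    rw [norm_mul]
    calc _ ≤ 1 * K := mul_le_mul (norm_cutoff_le n t) (hK t) (norm_nonneg _) zero_le_one
      _ = K := one_mul K
  have hvc : ∀ n, BddCont (fun t => cutoff n t * u t) := fun n =>
    ⟨(cutoff n).continuous.mul hu.1, K, hvB n⟩
  have hci := fun n => integrable_conv (hv n) hZ
  set w : ℕ → ℝ → ℂ := fun n t => cutoff n t * u t - conv (fun t => cutoff n t * u t) (lowPass b) t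
  have hwi : ∀ n, Integrable (w n) := fun n => (hv n).sub (hci n)
  have hwm : ∀ n, MemLp (w n) 2 volume := by
    intro n
    obtain ⟨L, hL⟩ := ((hvc n).conv hZ).2
    exact memLp_two_of_bounded (hwi n) (K := K + L) fun t =>
      (norm_sub_le _ _).trans (add_le_add (hvB n t) (hL t))
  -- Filtering is applied after the cutoff, so that everything is integrable; the high-pass symbol
  -- `1 - b` vanishes for `|ξ| ≤ rIn` and is at most 1 elsewhere.
  have hft : ∀ n ξ, ft (w n) ξ = (1 - b ξ) * ft (fun t => cutoff n t * u t) ξ := by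
    intro n ξ
    rw [ft_sub (hv n) (hci n), ft_conv (hv n) hZ, ft_lowPass]
    ring
  have hle : ∀ n, ∫⁻ t, ‖w n t‖ₑ ^ 2 ≤
      ∫⁻ ξ in highFreq b.rIn, ‖ft (fun t => cutoff n t * u t) ξ‖ₑ ^ 2 := by
    intro n
    have h2pi : ENNReal.ofReal (2 * Real.pi) ≥ 1 := by
      rw [ge_iff_le, ENNReal.one_le_ofReal]; nlinarith [Real.pi_gt_three]
    calc _ ≤ ENNReal.ofReal (2 * Real.pi) * ∫⁻ t, ‖w n t‖ₑ ^ 2 := le_mul_of_one_le_left zero_le h2pi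
      _ = ∫⁻ ξ, ‖ft (w n) ξ‖ₑ ^ 2 := (lintegral_ft_sq (hwi n) (hwm n)).symm
      _ ≤ ∫⁻ ξ, (highFreq b.rIn).indicator
          (fun ξ => ‖ft (fun t => cutoff n t * u t) ξ‖ₑ ^ 2) ξ := by
        refine lintegral_mono fun ξ => ?_
        rw [hft]
        by_cases hξ : ξ ∈ highFreq b.rIn
        · rw [indicator_of_mem hξ, enorm_mul, mul_pow]
          refine mul_le_of_le_one_left zero_le ?_
          rw [← Complex.ofReal_one, ← Complex.ofReal_sub, enorm_real_sq, ENNReal.ofReal_le_one]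
          have h0 := b.nonneg (x := ξ)
          have h1 := b.le_one (x := ξ)
          nlinarith
        · have : b ξ = 1 := b.one_of_mem_closedBall (by
            rw [mem_closedBall_zero_iff, Real.norm_eq_abs]; exact not_lt.1 hξ)
          simp [this]
      _ = _ := lintegral_indicator (measurableSet_highFreq _) _
  -- As `n` tends to infinity the cutoff is removed pointwise, under the filter by dominated
  -- convergence; Fatou's lemma then transfers the uniform bound.
  have hlim : ∀ t, Tendsto (fun n => w n t) atTop (𝓝 (u t - conv u (lowPass b) t)) := by
    intro t
    have h1 : ∀ s, Tendsto (fun n => cutoff n s * u s) atTop (𝓝 (u s)) := fun s => by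
      simpa using (tendsto_cutoff s).mul_const (u s)
    refine (h1 t).sub ?_
    have hZt : Integrable fun y => lowPass b (t - y) := hZ.comp_sub_left t
    refine tendsto_integral_of_dominated_convergence (fun y => K * ‖lowPass b (t - y)‖)
      (fun n => ?_) (hZt.norm.const_mul K) (fun n => ae_of_all _ fun y => ?_)
      (ae_of_all _ fun y => (h1 y).mul_const _)
    · exact (hvc n).1.aestronglyMeasurable.mul hZt.1
    · rw [norm_mul]
      gcongr
      exact hvB n y
  calc _ = ∫⁻ t, liminf (fun n => ‖w n t‖ₑ ^ 2) atTop :=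
        lintegral_congr fun t => (tendsto_enorm_sq (hlim t)).liminf_eq.symm
    _ ≤ liminf (fun n => ∫⁻ t, ‖w n t‖ₑ ^ 2) atTop := lintegral_liminf_le' fun n =>
        (hwi n).1.enorm.pow_const 2
    _ ≤ C := by
        refine (liminf_le_of_le (by isBoundedDefault) fun z hz => ?_)
        obtain ⟨k, hk, hk2⟩ := (hz.and hC).exists
        exact hk.trans ((hle k).trans hk2)
    _ < ⊤ := ENNReal.coe_lt_top

/-- The spectrum of `c` is contained in `[-A, A]`. -/
def BandLimited (c : ℝ → ℂ) (A : ℝ) : Prop :=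
  ∀ η : ℝ → ℂ, IsTestFunction η → tsupport η ⊆ highFreq A → ∫ t, c t * ft η t = 0

theorem integrable_ft_test {η : ℝ → ℂ} (hη : IsTestFunction η) : Integrable (ft η) := by
  have h := (ftS hη.toSchwartz).integrable (μ := volume)
  rwa [coe_ftS, hη.coe_toSchwartz] at h

/-- By Fourier inversion the pairing is `2π η(0)`, and 0 is outside the support. -/
theorem bandLimited_one : BandLimited (fun _ => 1) 0 := by
  intro η hη hs
  have h := integral_ft_eq hη.toSchwartz 0
  rw [hη.coe_toSchwartz] at h
  have h0 : η 0 = 0 := by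
    by_contra h0
    have := hs (subset_closure h0)
    simp [highFreq] at this
  simpa [h0] using h

variable {b}

theorem BandLimited.mono {c : ℝ → ℂ} {A A' : ℝ} (h : BandLimited c A) (hA : A ≤ A') :
    BandLimited c A' := fun η hη hs => h η hη (hs.trans (highFreq_anti hA))

theorem BandLimited.const_mul {c : ℝ → ℂ} {A : ℝ} (h : BandLimited c A) (z : ℂ) :
    BandLimited (fun t => z * c t) A := fun η hη hs => by
  simp only [mul_assoc]
  rw [integral_const_mul, h η hη hs, mul_zero]

theorem BandLimited.sum {ι : Type*} {s : Finset ι} {c : ι → ℝ → ℂ} {A : ℝ}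
    (hc : ∀ i ∈ s, BddCont (c i)) (h : ∀ i ∈ s, BandLimited (c i) A) :
    BandLimited (fun t => ∑ i ∈ s, c i t) A := fun η hη hs => by
  simp only [Finset.sum_mul]
  rw [integral_finsetSum _ fun i hi => (hc i hi).integrable_mul (integrable_ft_test hη)]
  exact Finset.sum_eq_zero fun i hi => h i hi η hη hs

theorem isTestFunction_modulate {ρ : ℝ → ℂ} (hρ : IsTestFunction ρ) (s : ℝ) (z : ℂ) :
    IsTestFunction (fun ν : ℝ => z * (Complex.exp (-(Complex.I * ν * s)) * ρ ν)) := by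
  refine ⟨contDiff_const.mul (ContDiff.mul ?_ hρ.1), (hρ.2.mul_left).mul_left⟩
  exact (((contDiff_const.mul Complex.ofRealCLM.contDiff).mul contDiff_const).neg).cexp

theorem tsupport_conv_subset {f g : ℝ → ℂ} (hf : HasCompactSupport f) (hg : HasCompactSupport g) :
    tsupport (conv f g) ⊆ tsupport f + tsupport g := by
  refine closure_minimal ?_ (hf.isCompact.add hg.isCompact).isClosed
  rw [conv_eq_convolution, add_comm]
  refine (support_convolution_subset _).trans ?_
  exact add_subset_add subset_closure subset_closure

/-- Spectra add under multiplication. The convolution is a superposition of translates of the filter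
kernel; each translate times `ft η` is the transform of a convolution of `η` with a function
supported in the ball of radius `rOut`, so the support of the test function moves by at most `rOut`.
-/
theorem BandLimited.mul_conv {c u : ℝ → ℂ} {A : ℝ} (h : BandLimited c A) (hc : BddCont c)
    (hu : BddCont u) : BandLimited (fun t => c t * conv u (lowPass b) t) (A + b.rOut) := by
  intro η hη hs
  obtain ⟨K, hK⟩ := hc.2
  obtain ⟨L, hL⟩ := hu.2
  have hK0 : 0 ≤ K := (norm_nonneg _).trans (hK 0)
  have hη' := integrable_ft_test hη
  have hZ : Integrable (lowPass b) := (lowPass b).integrable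
  have key : ∀ s, ∫ t, c t * (lowPass b (t - s) * ft η t) = 0 := by
    intro s
    have hm := isTestFunction_modulate (isTestFunction_bump b) s ((2 * Real.pi : ℝ) : ℂ)⁻¹
    set ζ := fun ν : ℝ => ((2 * Real.pi : ℝ) : ℂ)⁻¹ * (Complex.exp (-(Complex.I * ν * s)) * (b ν : ℂ))
    have e : ∀ t, lowPass b (t - s) * ft η t = ft (conv ζ η) t := by
      intro t
      rw [ft_conv hm.integrable hη.integrable, lowPass_apply]
      congr 1
      rw [ft_const_mul, ft, ft]
      congr 1
      refine integral_congr_ae (ae_of_all _ fun ν => ?_)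
      simp only
      rw [← mul_assoc, ← Complex.exp_add]
      congr 2
      push_cast; ring
    simp_rw [e]
    refine h _ (isTestFunction_conv hm hη) ((tsupport_conv_subset hm.2 hη.2).trans ?_)
    rintro _ ⟨y, hy, z, hz, rfl⟩
    have hy' : |y| ≤ b.rOut := by
      have h1 : y ∈ tsupport b := by
        refine closure_mono (fun x hx => ?_) hy
        rw [Function.mem_support] at hx ⊢
        intro h0
        exact hx (by simp [ζ, h0])
      rwa [b.tsupport_eq, mem_closedBall_zero_iff, Real.norm_eq_abs] at h1
    have hz' : A + b.rOut < |z| := hs hz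
    have := abs_sub_abs_le_abs_sub z (-y)
    rw [abs_neg, sub_neg_eq_add, add_comm z] at this
    change A < |y + z|
    linarith
  have hint : Integrable (Function.uncurry fun t s => c t * (u s * lowPass b (t - s)) * ft η t)
      (volume.prod volume) := by
    have h1 := ((hη'.convolution_integrand (ContinuousLinearMap.lsmul ℝ ℂ : ℂ →L[ℝ] ℂ →L[ℝ] ℂ)
      hZ.comp_neg).swap).norm.const_mul (K * L)
    refine h1.mono' (Continuous.aestronglyMeasurable ?_) (ae_of_all _ fun q => ?_)
    · have h2 := hc.1
      have h3 := hu.1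
      have h4 := (lowPass b).continuous
      have h5 := continuous_ft hη.integrable
      simp only [Function.uncurry_def]
      fun_prop
    · simp only [Function.uncurry_def, Function.comp_apply, Prod.fst_swap, Prod.snd_swap,
        ContinuousLinearMap.lsmul_apply, smul_eq_mul, neg_sub, norm_mul]
      calc _ = (‖c q.1‖ * ‖u q.2‖) * (‖ft η q.1‖ * ‖lowPass b (q.1 - q.2)‖) := by ring
        _ ≤ _ := by
          gcongr
          · exact hK _
          · exact hL _
  calc _ = ∫ t, ∫ s, c t * (u s * lowPass b (t - s)) * ft η t := by
        refine integral_congr_ae (ae_of_all _ fun t => ?_)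
        simp only
        rw [integral_mul_const, integral_const_mul]; rfl
    _ = ∫ s, ∫ t, c t * (u s * lowPass b (t - s)) * ft η t := integral_integral_swap hint
    _ = ∫ s, u s * ∫ t, c t * (lowPass b (t - s) * ft η t) := by
        refine integral_congr_ae (ae_of_all _ fun s => ?_)
        simp only
        rw [← integral_const_mul]
        congr 1; ext t; ring
    _ = 0 := by simp [key]

end LowPass

/-! ### The spectrum of a polynomial force -/

section ForceSpectrum

theorem contDiff_force (p : ℕ) (v : ℕ → ℝ) : ContDiff ℝ 1 (force p v) := by
  have h : force p v = fun z => ∑ n ∈ Finset.range (p + 1),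
      forceCoeff v n * ((starRingEnd ℂ z * z) ^ (n - 1) * z) := funext (force_eq p v)
  have hc : ContDiff ℝ 1 (fun z : ℂ => starRingEnd ℂ z) := Complex.conjCLE.contDiff
  rw [h]
  exact ContDiff.sum fun n _ => contDiff_const.mul (((hc.mul contDiff_id).pow _).mul contDiff_id)

theorem exists_lipschitz_force (p : ℕ) (v : ℕ → ℝ) (R : ℝ) : ∃ K : ℝ≥0, ∀ z w : ℂ,
    ‖z‖ ≤ R → ‖w‖ ≤ R → ‖force p v z - force p v w‖ₑ ≤ K * ‖z - w‖ₑ := by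
  have h1 : LocallyLipschitzOn (Metric.closedBall (0 : ℂ) R) (force p v) :=
    (contDiff_force p v).locallyLipschitz.locallyLipschitzOn
  obtain ⟨K, hK⟩ := h1.exists_lipschitzOnWith_of_compact (isCompact_closedBall 0 R)
  refine ⟨K, fun z w hz hw => ?_⟩
  have h2 := hK (mem_closedBall_zero_iff.2 hz) (mem_closedBall_zero_iff.2 hw)
  rwa [edist_eq_enorm_sub, edist_eq_enorm_sub] at h2

theorem BddCont.force {c : ℝ → ℂ} (hc : BddCont c) (p : ℕ) (v : ℕ → ℝ) :
    BddCont (fun t => force p v (c t)) := by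
  obtain ⟨K, hK⟩ := hc.2
  obtain ⟨M, hM⟩ := (isCompact_closedBall (0 : ℂ) K).exists_bound_of_continuousOn
    (continuous_force p v).continuousOn
  exact ⟨(continuous_force p v).comp hc.1, M, fun t => hM _ (mem_closedBall_zero_iff.2 (hK t))⟩

theorem BddCont.pow {c : ℝ → ℂ} (hc : BddCont c) (k : ℕ) : BddCont (fun t => c t ^ k) := by
  induction k with
  | zero => simpa using BddCont.const 1
  | succ k ih => simpa [pow_succ] using ih.mul hc

variable {u : ℝ → ℂ} (b : ContDiffBump (0 : ℝ))

/-- The monomial has `2k + 1` factors, each equal to the filtered field or its conjugate, and each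
adds `rOut` to the band. The conjugate is again a filtered function because the kernel is real. -/
theorem bandLimited_monomial (hu : BddCont u) (k : ℕ) :
    BandLimited (fun t => (starRingEnd ℂ (conv u (lowPass b) t) * conv u (lowPass b) t) ^ k *
      conv u (lowPass b) t) ((2 * k + 1) * b.rOut) := by
  have hB : BddCont (conv u (lowPass b)) := hu.conv (lowPass b).integrable
  induction k with
  | zero =>
    have h := bandLimited_one.mul_conv (b := b) (BddCont.const 1) hu
    simpa using h
  | succ k ih =>
    have h1 := ih.mul_conv (b := b) (((hB.conj.mul hB).pow k).mul hB) hu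
    have h2 := h1.mul_conv (b := b) ((((hB.conj.mul hB).pow k).mul hB).mul hB) hu.conj
    have e : (fun t => (starRingEnd ℂ (conv u (lowPass b) t) * conv u (lowPass b) t) ^ (k + 1) *
        conv u (lowPass b) t) = fun t =>
        (starRingEnd ℂ (conv u (lowPass b) t) * conv u (lowPass b) t) ^ k *
          conv u (lowPass b) t * conv u (lowPass b) t *
            conv (fun t => starRingEnd ℂ (u t)) (lowPass b) t := by
      ext t
      rw [← conj_conv_lowPass]; ring
    rw [e]
    convert h2 using 1
    push_cast; ring

theorem bandLimited_force (hu : BddCont u) {p : ℕ} (hp : 1 ≤ p) (v : ℕ → ℝ) :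
    BandLimited (fun t => force p v (conv u (lowPass b) t)) ((2 * p - 1) * b.rOut) := by
  have hB : BddCont (conv u (lowPass b)) := hu.conv (lowPass b).integrable
  simp only [force_eq]
  refine BandLimited.sum (fun n _ => (BddCont.const _).mul (((hB.conj.mul hB).pow _).mul hB))
    fun n hn => ((bandLimited_monomial b hu (n - 1)).mono ?_).const_mul _
  have h1 : (((n - 1 : ℕ) : ℝ)) ≤ p - 1 := by
    have h2 : n - 1 + 1 ≤ p := by have := Finset.mem_range.1 hn; omega
    have h3 : ((n - 1 : ℕ) : ℝ) + 1 ≤ p := by exact_mod_cast h2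
    linarith
  have := b.rOut_pos
  gcongr
  linarith

/-- The value at `ξ` is the pairing of `c` with the transform of `cutoffSpec n` translated to `ξ`,
supported within `1/(n+1)` of `ξ`. The second `1/(n+1)` keeps the closed support inside the open set
of frequencies above `A`. -/
theorem ft_cutoff_mul_eq_zero {c : ℝ → ℂ} {A : ℝ} (h : BandLimited c A) {n : ℕ} {ξ : ℝ}
    (hξ : A + 2 / (n + 1) < |ξ|) : ft (fun t => cutoff n t * c t) ξ = 0 := by
  have hT : IsTestFunction (fun ν => cutoffSpec n (ν - ξ)) := by
    have h1 := isTestFunction_cutoffSpec n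
    exact ⟨h1.1.comp (contDiff_id.sub contDiff_const),
      h1.2.comp_homeomorph (Homeomorph.subRight ξ)⟩
  have e : ∀ t : ℝ, ft (fun ν => cutoffSpec n (ν - ξ)) t =
      Complex.exp (Complex.I * ξ * t) * cutoff n t := by
    intro t
    have h1 := ft_comp_add (cutoffSpec n) (-ξ) t
    simp only [← sub_eq_add_neg] at h1
    rw [h1, cutoff_eq_ft]
    congr 2
    push_cast; ring
  have h2 := h _ hT ?_
  · rw [ft, ← h2]
    refine integral_congr_ae (ae_of_all _ fun t => ?_)
    simp only [e]; ring
  · have hcl : IsClosed {ν : ℝ | A + 1 / (n + 1) ≤ |ν|} :=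
      isClosed_le continuous_const continuous_abs
    have hsub : tsupport (fun ν => cutoffSpec n (ν - ξ)) ⊆ {ν : ℝ | A + 1 / (n + 1) ≤ |ν|} := by
      refine closure_minimal (fun ν hν => ?_) hcl
      rw [Function.mem_support] at hν
      have h3 : |ν - ξ| < 1 / (n + 1) := by
        by_contra h4
        exact hν (cutoffSpec_eq_zero (not_lt.1 h4))
      have h5 := abs_sub_abs_le_abs_sub ξ ν
      rw [abs_sub_comm] at h5
      have h6 : (2 / (n + 1) : ℝ) = 1 / (n + 1) + 1 / (n + 1) := by ring
      simp only [mem_ofPred_eq]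
      linarith
    refine hsub.trans fun ν hν => ?_
    have : (0 : ℝ) < 1 / (n + 1) := by positivity
    have hν' : A + 1 / (n + 1) ≤ |ν| := hν
    change A < |ν|
    linarith

theorem EvBdd.mono {g g' : ℕ → ℝ → ℝ≥0∞} {a a' : ℝ} (h : EvBdd g a) (ha : a ≤ a')
    (hg : ∀ n ξ, a' < |ξ| → g' n ξ ≤ g n ξ) : EvBdd g' a' := by
  intro δ hδ
  obtain ⟨C, hC⟩ := h δ hδ
  refine ⟨C, hC.mono fun n hn => le_trans ?_ hn⟩
  calc _ ≤ ∫⁻ ξ in highFreq (a' + δ), g n ξ :=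
        setLIntegral_mono' (measurableSet_highFreq _) fun ξ hξ =>
          hg n ξ (lt_of_le_of_lt (by linarith) hξ)
    _ ≤ _ := lintegral_mono_set (highFreq_anti (by linarith))

theorem EvBdd.add {g g' : ℕ → ℝ → ℝ≥0∞} {a : ℝ} (h : EvBdd g a) (h' : EvBdd g' a)
    (hm : ∀ n, Measurable (g n)) : EvBdd (fun n ξ => g n ξ + g' n ξ) a := by
  intro δ hδ
  obtain ⟨C, hC⟩ := h δ hδ
  obtain ⟨C', hC'⟩ := h' δ hδ
  refine ⟨C + C', (hC.and hC').mono fun n hn => ?_⟩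
  rw [lintegral_add_left (hm n)]
  exact_mod_cast add_le_add hn.1 hn.2

theorem EvBdd.const_mul {g : ℕ → ℝ → ℝ≥0∞} {a : ℝ} (h : EvBdd g a) (K : ℝ≥0) :
    EvBdd (fun n ξ => K * g n ξ) a := by
  intro δ hδ
  obtain ⟨C, hC⟩ := h δ hδ
  refine ⟨K * C, hC.mono fun n hn => ?_⟩
  rw [lintegral_const_mul' _ _ ENNReal.coe_ne_top, ENNReal.coe_mul]
  gcongr

theorem evBdd_of_lintegral_le {g : ℕ → ℝ → ℝ≥0∞} {a : ℝ} {C : ℝ≥0}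
    (h : ∀ n, ∫⁻ ξ, g n ξ ≤ C) : EvBdd g a := fun _ _ =>
  ⟨C, Eventually.of_forall fun n => (setLIntegral_le_lintegral _ _).trans (h n)⟩

/-- The force multiplies the spectral threshold by `2 p - 1`. -/
theorem EvBdd.force (hu : BddCont u) {a : ℝ} (ha : 0 < a)
    (h : EvBdd (fun n ξ => ‖ft (fun t => cutoff n t * u t) ξ‖ₑ ^ 2) a) {p : ℕ} (hp : 1 ≤ p)
    (v : ℕ → ℝ) :
    EvBdd (fun n ξ => ‖ft (fun t => cutoff n t * KGOscillators.force p v (u t)) ξ‖ₑ ^ 2)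
      ((2 * p - 1) * a) := by
  intro δ hδ
  have hq : (1 : ℝ) ≤ 2 * p - 1 := by
    have : (1 : ℝ) ≤ p := by exact_mod_cast hp
    linarith
  -- With outer radius `a + 2ε` the band of the filtered force ends at `(2p - 1) a + δ/2`; the
  -- cutoff widens it by at most `2/(n+1) < δ/4`, still below the range of integration.
  set ε := δ / (4 * (2 * p - 1)) with hε
  have hε0 : 0 < ε := by positivity
  have hεq : (2 * p - 1) * ε = δ / 4 := by rw [hε]; field_simp
  set b : ContDiffBump (0 : ℝ) := ⟨a + ε, a + 2 * ε, by positivity, by linarith⟩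
  have hB : BddCont (conv u (lowPass b)) := hu.conv (lowPass b).integrable
  have hd := lintegral_sub_lowPass_lt_top b hu h (by change a < a + ε; linarith)
  obtain ⟨K, hK⟩ := hu.2
  obtain ⟨L, hL⟩ := hB.2
  obtain ⟨Λ, hΛ⟩ := exists_lipschitz_force p v (max K L)
  have hFB := hB.force p v
  have hFu := hu.force p v
  have hFd : BddCont (fun t => KGOscillators.force p v (u t) -
      KGOscillators.force p v (conv u (lowPass b) t)) := by
    obtain ⟨K', hK'⟩ := hFu.2
    obtain ⟨L', hL'⟩ := hFB.2
    exact ⟨hFu.1.sub hFB.1, K' + L', fun t =>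
      (norm_sub_le _ _).trans (add_le_add (hK' t) (hL' t))⟩
  set D : ℝ≥0∞ := ENNReal.ofReal (2 * Real.pi) * ((Λ : ℝ≥0∞) ^ 2 *
    ∫⁻ t, ‖u t - conv u (lowPass b) t‖ₑ ^ 2) with hD
  have hDtop : D ≠ ⊤ := ENNReal.mul_ne_top ENNReal.ofReal_ne_top
    (ENNReal.mul_ne_top (by simp) hd.ne)
  refine ⟨D.toNNReal, ?_⟩
  rw [ENNReal.coe_toNNReal hDtop]
  filter_upwards [eventually_radius_lt (by positivity : 0 < δ / 4)] with n hn
  -- At these frequencies the force of the low-pass part contributes nothing and may be subtracted.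
  -- The Lipschitz bound on the ball containing both fields controls the difference in `L²`,
  -- independently of `n`.
  calc _ ≤ ∫⁻ ξ in highFreq ((2 * p - 1) * a + δ), ‖ft (fun t => cutoff n t *
        (KGOscillators.force p v (u t) -
          KGOscillators.force p v (conv u (lowPass b) t))) ξ‖ₑ ^ 2 := by
        refine setLIntegral_mono' (measurableSet_highFreq _) fun ξ hξ => le_of_eq ?_
        have hz := ft_cutoff_mul_eq_zero (bandLimited_force b hu hp v) (n := n) (ξ := ξ) (by
          have h1 : (2 * p - 1) * a + δ < |ξ| := hξ
          have h2 : (2 * p - 1) * b.rOut = (2 * p - 1) * a + 2 * ((2 * p - 1) * ε) := by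
            change (2 * p - 1) * (a + 2 * ε) = _; ring
          rw [h2, hεq]
          linarith)
        have e : (fun t => cutoff n t * (KGOscillators.force p v (u t) -
            KGOscillators.force p v (conv u (lowPass b) t))) = fun t =>
            cutoff n t * KGOscillators.force p v (u t) -
              cutoff n t * KGOscillators.force p v (conv u (lowPass b) t) := by
          ext t; ring
        rw [e, ft_sub (integrable_cutoff_mul hFu _) (integrable_cutoff_mul hFB _), hz, sub_zero]
    _ ≤ _ := setLIntegral_le_lintegral _ _
    _ = ENNReal.ofReal (2 * Real.pi) * ∫⁻ t, ‖cutoff n t * (KGOscillators.force p v (u t) -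
          KGOscillators.force p v (conv u (lowPass b) t))‖ₑ ^ 2 :=
        lintegral_ft_sq (integrable_cutoff_mul hFd _) (memLp_cutoff_mul hFd _)
    _ ≤ _ := by
        rw [hD, ← lintegral_const_mul' ((Λ : ℝ≥0∞) ^ 2) _ (by simp)]
        gcongr with t
        rw [← mul_pow]
        gcongr
        rw [enorm_mul]
        calc _ ≤ 1 * ‖KGOscillators.force p v (u t) -
              KGOscillators.force p v (conv u (lowPass b) t)‖ₑ := by
              gcongr
              rw [← ofReal_norm, ENNReal.ofReal_le_one]
              exact norm_cutoff_le n t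
          _ ≤ _ := by
              rw [one_mul]
              exact hΛ _ _ ((hK t).trans (le_max_left _ _)) ((hL t).trans (le_max_right _ _))

end ForceSpectrum

/-! ### Recursion for the thresholds -/

section Thresholds

variable {N : ℕ} {m : ℝ} {p : Fin N → ℕ}

theorem muLeft_first {J : Fin N} (h : (J : ℕ) = 0) : muLeft m p J = m := by
  have e : Finset.Iio J = ∅ := by
    ext K; simp [Fin.lt_def, h]
  rw [muLeft, e, Finset.prod_empty, mul_one]

theorem muLeft_next {K J : Fin N} (h : (K : ℕ) + 1 = J) :
    muLeft m p J = (2 * (p K : ℝ) - 1) * muLeft m p K := by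
  have e : Finset.Iio J = insert K (Finset.Iio K) := by
    ext L; simp only [Finset.mem_Iio, Finset.mem_insert, Fin.lt_def, Fin.ext_iff]; omega
  rw [muLeft, e, Finset.prod_insert (by simp), muLeft]
  ring

theorem muRight_last {J : Fin N} (h : (J : ℕ) + 1 = N) : muRight m p J = m := by
  have e : Finset.Ioi J = ∅ := by
    ext K; simp only [Finset.mem_Ioi, Fin.lt_def]; have := K.2; simp; omega
  rw [muRight, e, Finset.prod_empty, mul_one]

theorem muRight_previous {K J : Fin N} (h : (K : ℕ) + 1 = J) :
    muRight m p K = (2 * (p J : ℝ) - 1) * muRight m p J := by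
  have e : Finset.Ioi K = insert J (Finset.Ioi J) := by
    ext L; simp only [Finset.mem_Ioi, Finset.mem_insert, Fin.lt_def, Fin.ext_iff]; omega
  rw [muRight, e, Finset.prod_insert (by simp), muRight]
  ring

theorem one_le_two_mul_sub_one {q : ℕ} (hq : 1 ≤ q) : (1 : ℝ) ≤ 2 * (q : ℝ) - 1 := by
  have : (1 : ℝ) ≤ q := by exact_mod_cast hq
  linarith

theorem le_muLeft (hm : 0 < m) (hp : ∀ J, 1 ≤ p J) (J : Fin N) : m ≤ muLeft m p J :=
  le_mul_of_one_le_right hm.le (Finset.prod_induction _ (fun x : ℝ => 1 ≤ x)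
    (fun _ _ => one_le_mul_of_one_le_of_one_le) le_rfl fun K _ => one_le_two_mul_sub_one (hp K))

theorem le_muRight (hm : 0 < m) (hp : ∀ J, 1 ≤ p J) (J : Fin N) : m ≤ muRight m p J :=
  le_mul_of_one_le_right hm.le (Finset.prod_induction _ (fun x : ℝ => 1 ≤ x)
    (fun _ _ => one_le_mul_of_one_le_of_one_le) le_rfl fun K _ => one_le_two_mul_sub_one (hp K))

end Thresholds

/-! ### Propagation of spectral bounds through the oscillators -/

section Propagation

/-- The weight `ξ² - m²` degenerates only at `|ξ| = m`. For `|ξ| > a + δ` with `a ≥ m` it is at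
least `δ²`, and then `ξ²` is at most `(1 + m²/δ²)` times it. -/
theorem evBdd_of_sideEnergy {m a : ℝ} (hm : 0 < m) (ha : m ≤ a) {D s : ℕ → ℝ → ℂ}
    (h : EvBdd (fun n ξ => Slopes.sideEnergy (ξ ^ 2 - m ^ 2) (D n ξ) (s n ξ)) a) :
    EvBdd (fun n (ξ : ℝ) => ‖(ξ : ℂ) * s n ξ‖ₑ ^ 2) a := by
  intro δ hδ
  obtain ⟨C, hC⟩ := h.const_mul (1 + m ^ 2 / δ ^ 2).toNNReal δ hδ
  refine ⟨C, hC.mono fun n hn => le_trans ?_ hn⟩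
  refine setLIntegral_mono' (measurableSet_highFreq _) fun ξ hξ => ?_
  have hξ' : a + δ < |ξ| := hξ
  have h1 : δ ^ 2 ≤ ξ ^ 2 - m ^ 2 := by
    rw [← sq_abs ξ]; nlinarith
  have h2 : ξ ^ 2 ≤ (1 + m ^ 2 / δ ^ 2) * (ξ ^ 2 - m ^ 2) := by
    have h3 : m ^ 2 ≤ m ^ 2 / δ ^ 2 * (ξ ^ 2 - m ^ 2) := by
      rw [div_mul_eq_mul_div, le_div_iff₀ (by positivity)]
      gcongr
    linarith
  beta_reduce
  rw [enorm_mul, mul_pow, enorm_real_sq]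
  calc _ ≤ ENNReal.ofReal ((1 + m ^ 2 / δ ^ 2) * (ξ ^ 2 - m ^ 2)) * ‖s n ξ‖ₑ ^ 2 := by gcongr
    _ = ENNReal.ofReal (1 + m ^ 2 / δ ^ 2) * (ENNReal.ofReal (ξ ^ 2 - m ^ 2) * ‖s n ξ‖ₑ ^ 2) := by
        rw [ENNReal.ofReal_mul (by positivity), mul_assoc]
    _ ≤ _ := by
        rw [Slopes.sideEnergy]
        exact mul_le_mul_right le_add_self _

theorem EvBdd.of_weighted {m a : ℝ} (hm : 0 < m) (ha : m ≤ a) {s : ℕ → ℝ → ℂ}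
    (h : EvBdd (fun n (ξ : ℝ) => ‖(ξ : ℂ) * s n ξ‖ₑ ^ 2) a) :
    EvBdd (fun n ξ => ‖s n ξ‖ₑ ^ 2) a := by
  refine (h.const_mul ((m ^ 2)⁻¹).toNNReal).mono le_rfl fun n ξ hξ => ?_
  rw [enorm_mul, mul_pow, enorm_real_sq, ← mul_assoc]
  change _ ≤ ENNReal.ofReal ((m ^ 2)⁻¹) * _ * _
  rw [← ENNReal.ofReal_mul (by positivity)]
  refine le_mul_of_one_le_left zero_le ?_
  rw [ENNReal.one_le_ofReal, inv_mul_eq_div, one_le_div (by positivity), ← sq_abs ξ]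
  gcongr
  linarith

variable {m : ℝ} {Ψ : ℝ → EnergyState} {B : ℝ≥0} {N : ℕ} {X : Fin N → ℝ} {f : Fin N → ℝ → ℂ}
  {sR sL : ℕ → ℝ → ℝ → ℂ} {p : Fin N → ℕ}

/-- The energy density on the right of the point `x`. -/
def rightEnergy (m : ℝ) (Ψ : ℝ → EnergyState) (sR : ℕ → ℝ → ℝ → ℂ) (x : ℝ) (n : ℕ) (ξ : ℝ) : ℝ≥0∞ :=
  Slopes.sideEnergy (ξ ^ 2 - m ^ 2) (sR n x ξ) (cutFt Ψ (cutoff n) x ξ)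

/-- A solution of uniformly bounded energy together with the one-sided
slopes of the Fourier transforms of its cutoffs. -/
structure BoundedSolution (m : ℝ) (X : Fin N → ℝ) (f : Fin N → ℝ → ℂ) (Ψ : ℝ → EnergyState)
    (B : ℝ≥0) (sR sL : ℕ → ℝ → ℝ → ℂ) : Prop where
  mass_pos : 0 < m
  solves : SolvesForcedKG m X f Ψ
  energy_le : ∀ t, (Ψ t).energy m ≤ B
  slopes : ∀ n, FieldSlopes m X f Ψ (cutoff n) (sR n) (sL n)

theorem exists_boundedSolution (hm : 0 < m) (hX : Function.Injective X)
    (hΨ : SolvesForcedKG m X f Ψ) (hB : ∀ t, (Ψ t).energy m ≤ B) (hf : ∀ J, BddCont (f J)) :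
    ∃ sR sL, BoundedSolution m X f Ψ B sR sL := by
  have hM : ∃ M : ℝ, ∀ J t, ‖f J t‖ ≤ M := by
    choose M hM using fun J => (hf J).2
    exact ⟨∑ J, |M J|, fun J t => (hM J t).trans ((le_abs_self _).trans
      (Finset.single_le_sum (f := fun J => |M J|) (fun _ _ => abs_nonneg _) (Finset.mem_univ J)))⟩
  obtain ⟨M, hM⟩ := hM
  have h := fun n => exists_fieldSlopes (κ := cutoff n) hm hX hΨ (fun t _ => hB t)
    (fun J => (hf J).1) (fun J t _ => hM J t)
  choose sR sL h using h
  exact ⟨sR, sL, hm, hΨ, hB, h⟩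

namespace BoundedSolution

theorem bound (h : BoundedSolution m X f Ψ B sR sL) (κ : 𝓢(ℝ, ℂ)) : EnergyBoundNear m Ψ κ B := fun t _ => h.energy_le t

theorem bddCont_fld (h : BoundedSolution m X f Ψ B sR sL) (x : ℝ) : BddCont (fun t => (Ψ t).fld x) :=
  ⟨h.solves.continuousInEnergy.continuous_fld_right h.mass_pos x, fldBound m B, fun t =>
    norm_fld_le_fldBound h.mass_pos (h.energy_le t) x⟩

theorem measurable_rightEnergy (h : BoundedSolution m X f Ψ B sR sL) (x : ℝ) (n : ℕ) : Measurable (rightEnergy m Ψ sR x n) := by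
  have h1 : Measurable fun ξ => sR n x ξ :=
    (measurable_slopeR h.mass_pos h.solves (h.bound _) (h.slopes n)).comp measurable_prodMk_left
  have h2 : Continuous fun ξ => cutFt Ψ (cutoff n) x ξ :=
    (continuous_cutFt h.mass_pos h.solves.continuousInEnergy (h.bound (cutoff n))).comp
      (Continuous.prodMk_right x)
  have h3 : Measurable fun ξ : ℝ => ENNReal.ofReal (ξ ^ 2 - m ^ 2) := by fun_prop
  exact (h1.enorm.pow_const 2).add (h3.mul (h2.enorm.measurable.pow_const 2))

theorem measurable_leftEnergy (h : BoundedSolution m X f Ψ B sR sL) (x : ℝ) (n : ℕ) : Measurable (rightEnergy m Ψ sL x n) := by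
  have h1 : Measurable fun ξ => sL n x ξ :=
    (measurable_slopeL h.mass_pos h.solves (h.bound _) (h.slopes n)).comp measurable_prodMk_left
  have h2 : Continuous fun ξ => cutFt Ψ (cutoff n) x ξ :=
    (continuous_cutFt h.mass_pos h.solves.continuousInEnergy (h.bound (cutoff n))).comp
      (Continuous.prodMk_right x)
  have h3 : Measurable fun ξ : ℝ => ENNReal.ofReal (ξ ^ 2 - m ^ 2) := by fun_prop
  exact (h1.enorm.pow_const 2).add (h3.mul (h2.enorm.measurable.pow_const 2))

/-- The averaging length is tied to the cutoff, `L = n + 1`, which makes the bound uniform in `n`.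
-/
theorem evBdd_sideRem (h : BoundedSolution m X f Ψ B sR sL) (a : ℝ) :
    EvBdd (fun n ξ => sideRem Ψ (cutoff n) (sR n) (n + 1) ξ) a := by
  refine evBdd_of_lintegral_le (C := (sideConst m (cutoff 0) B 1).toNNReal) fun n => ?_
  rw [ENNReal.coe_toNNReal (sideConst_lt_top _ _ _ _).ne]
  exact (lintegral_sideRem_le h.mass_pos h.solves (h.bound _) (h.slopes n) _).trans
    (sideConst_cutoff_le m B n)

/-- To the left of all oscillators there are free intervals of every length, in particular of length
`n + 1`, so averaging gives the bound above `m` with no input. -/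
theorem evBdd_left_first (h : BoundedSolution m X f Ψ B sR sL) {x : ℝ} (hx : ∀ J, x ≤ X J) : EvBdd (rightEnergy m Ψ sL x) m := by
  refine (h.evBdd_sideRem m).mono le_rfl fun n ξ hξ => ?_
  have hn : (0 : ℝ) < n + 1 := by positivity
  have h1 := (sideEnergy_average h.mass_pos h.solves (h.bound (cutoff n)) (h.slopes n) hn hξ
    (a := x - (n + 1)) fun J hJ => by have := hx J; rw [sub_add_cancel] at hJ; linarith [hJ.2]).2
  rwa [sub_add_cancel] at h1

theorem evBdd_right_last (h : BoundedSolution m X f Ψ B sR sL) {x : ℝ} (hx : ∀ J, X J ≤ x) : EvBdd (rightEnergy m Ψ sR x) m := by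
  refine (h.evBdd_sideRem m).mono le_rfl fun n ξ hξ => ?_
  have hn : (0 : ℝ) < n + 1 := by positivity
  exact (sideEnergy_average h.mass_pos h.solves (h.bound (cutoff n)) (h.slopes n) hn hξ
    (a := x) fun J hJ => by have := hx J; linarith [hJ.1]).1

theorem evBdd_left_of_right (h : BoundedSolution m X f Ψ B sR sL) {a x y : ℝ} (ha : m ≤ a) (hxy : x < y) (hfree : FreeOn X x y)
    (hE : EvBdd (rightEnergy m Ψ sR x) a) : EvBdd (rightEnergy m Ψ sL y) a := by
  refine (hE.add (h.evBdd_sideRem a) (h.measurable_rightEnergy x)).mono le_rfl fun n ξ hξ => ?_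
  have hn : (0 : ℝ) < n + 1 := by positivity
  exact sideEnergy_left_le h.mass_pos h.solves (h.bound (cutoff n)) (h.slopes n) hn
    (ha.trans_lt hξ) hxy hfree

theorem evBdd_right_of_left (h : BoundedSolution m X f Ψ B sR sL) {a x y : ℝ} (ha : m ≤ a) (hxy : x < y) (hfree : FreeOn X x y)
    (hE : EvBdd (rightEnergy m Ψ sL y) a) : EvBdd (rightEnergy m Ψ sR x) a := by
  refine (hE.add (h.evBdd_sideRem a) (h.measurable_leftEnergy y)).mono le_rfl fun n ξ hξ => ?_
  have hn : (0 : ℝ) < n + 1 := by positivity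
  exact sideEnergy_right_le h.mass_pos h.solves (h.bound (cutoff n)) (h.slopes n) hn
    (ha.trans_lt hξ) hxy hfree

/-- The field is continuous across `X J`; only its slope changes, by the transform of the force. -/
theorem evBdd_right_of_jump (h : BoundedSolution m X f Ψ B sR sL) {a a' : ℝ} (ha : a ≤ a') (J : Fin N)
    (hE : EvBdd (rightEnergy m Ψ sL (X J)) a)
    (hf : EvBdd (fun n ξ => ‖ft (fun t => cutoff n t * f J t) ξ‖ₑ ^ 2) a') :
    EvBdd (rightEnergy m Ψ sR (X J)) a' := by
  have h1 : EvBdd (rightEnergy m Ψ sL (X J)) a' := hE.mono ha fun _ _ _ => le_rfl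
  refine ((h1.const_mul 2).add (hf.const_mul 2) fun n =>
    (h.measurable_leftEnergy _ n).const_mul _).mono le_rfl fun n ξ _ => ?_
  have hj : sR n (X J) ξ = sL n (X J) ξ - ft (fun t => cutoff n t * f J t) ξ := by
    linear_combination (h.slopes n ξ).jump J
  rw [rightEnergy, rightEnergy, Slopes.sideEnergy, Slopes.sideEnergy, hj]
  have h2 := enorm_sub_sq_le (sL n (X J) ξ) (ft (fun t => cutoff n t * f J t) ξ)
  push_cast
  set w := ENNReal.ofReal (ξ ^ 2 - m ^ 2) * ‖cutFt Ψ (cutoff n) (X J) ξ‖ₑ ^ 2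
  calc _ ≤ 2 * ‖sL n (X J) ξ‖ₑ ^ 2 + 2 * ‖ft (fun t => cutoff n t * f J t) ξ‖ₑ ^ 2 + 2 * w := by
        gcongr
        exact le_mul_of_one_le_left zero_le (by norm_num)
    _ = _ := by ring

theorem evBdd_left_of_jump (h : BoundedSolution m X f Ψ B sR sL) {a a' : ℝ} (ha : a ≤ a') (J : Fin N)
    (hE : EvBdd (rightEnergy m Ψ sR (X J)) a)
    (hf : EvBdd (fun n ξ => ‖ft (fun t => cutoff n t * f J t) ξ‖ₑ ^ 2) a') :
    EvBdd (rightEnergy m Ψ sL (X J)) a' := by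
  have h1 : EvBdd (rightEnergy m Ψ sR (X J)) a' := hE.mono ha fun _ _ _ => le_rfl
  refine ((h1.const_mul 2).add (hf.const_mul 2) fun n =>
    (h.measurable_rightEnergy _ n).const_mul _).mono le_rfl fun n ξ _ => ?_
  have hj : sL n (X J) ξ = sR n (X J) ξ + ft (fun t => cutoff n t * f J t) ξ := by
    linear_combination -(h.slopes n ξ).jump J
  rw [rightEnergy, rightEnergy, Slopes.sideEnergy, Slopes.sideEnergy, hj]
  have h2 := enorm_add_sq_le (sR n (X J) ξ) (ft (fun t => cutoff n t * f J t) ξ)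
  push_cast
  set w := ENNReal.ofReal (ξ ^ 2 - m ^ 2) * ‖cutFt Ψ (cutoff n) (X J) ξ‖ₑ ^ 2
  calc _ ≤ 2 * ‖sR n (X J) ξ‖ₑ ^ 2 + 2 * ‖ft (fun t => cutoff n t * f J t) ξ‖ₑ ^ 2 + 2 * w := by
        gcongr
        exact le_mul_of_one_le_left zero_le (by norm_num)
    _ = _ := by ring

theorem freeOn_consecutive (hX : StrictMono X) {K J : Fin N} (hKJ : (K : ℕ) + 1 = J) :
    FreeOn X (X K) (X J) := fun I hI => by
  have h1 := hX.lt_iff_lt.1 hI.1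
  have h2 := hX.lt_iff_lt.1 hI.2
  rw [Fin.lt_def] at h1 h2
  omega

/-- The spectral threshold of the force at `X J` is at most `2 p J - 1` times that of the field. -/
def ForceResponse (X : Fin N → ℝ) (f : Fin N → ℝ → ℂ) (Ψ : ℝ → EnergyState) (p : Fin N → ℕ) : Prop :=
  ∀ J a, 0 < a → EvBdd (fun n ξ => ‖cutFt Ψ (cutoff n) (X J) ξ‖ₑ ^ 2) a →
    EvBdd (fun n ξ => ‖ft (fun t => cutoff n t * f J t) ξ‖ₑ ^ 2) ((2 * (p J : ℝ) - 1) * a)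

theorem evBdd_force (h : BoundedSolution m X f Ψ B sR sL) (hr : ForceResponse X f Ψ p) {a : ℝ} (ha : m ≤ a) {s : ℕ → ℝ → ℝ → ℂ}
    {J : Fin N} (hE : EvBdd (rightEnergy m Ψ s (X J)) a) :
    EvBdd (fun n ξ => ‖ft (fun t => cutoff n t * f J t) ξ‖ₑ ^ 2) ((2 * (p J : ℝ) - 1) * a) :=
  hr J a (h.mass_pos.trans_le ha) ((evBdd_of_sideEnergy h.mass_pos ha hE).of_weighted h.mass_pos ha)

/-- Induction from the left: a bound to the left of `X K` bounds the field there, hence the force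
above `2 p K - 1` times the threshold, hence the density to the right of `X K`; the latter is
carried along the free interval to the next oscillator. -/
theorem evBdd_left (h : BoundedSolution m X f Ψ B sR sL) (hX : StrictMono X) (hp : ∀ J, 1 ≤ p J) (hr : ForceResponse X f Ψ p) :
    ∀ (k : ℕ) (J : Fin N), (J : ℕ) = k → EvBdd (rightEnergy m Ψ sL (X J)) (muLeft m p J) := by
  intro k
  induction k with
  | zero =>
    intro J hJ
    rw [muLeft_first hJ]
    exact h.evBdd_left_first fun K => hX.monotone (by rw [Fin.le_def]; omega)
  | succ k ih =>
    intro J hJ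
    have hk : k < N := by have := J.2; omega
    set K : Fin N := ⟨k, hk⟩
    have hKJ : (K : ℕ) + 1 = J := hJ.symm
    have hmu := le_muLeft h.mass_pos hp
    have h1 := ih K rfl
    have h2 : muLeft m p K ≤ (2 * (p K : ℝ) - 1) * muLeft m p K :=
      le_mul_of_one_le_left (h.mass_pos.le.trans (hmu K)) (one_le_two_mul_sub_one (hp K))
    have h3 := h.evBdd_right_of_jump h2 K h1 (h.evBdd_force hr (hmu K) h1)
    rw [← muLeft_next hKJ] at h3
    exact h.evBdd_left_of_right (hmu J) (hX (by rw [Fin.lt_def]; omega))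
      (freeOn_consecutive hX hKJ) h3

theorem evBdd_right_of_muLeft (h : BoundedSolution m X f Ψ B sR sL) (hX : StrictMono X) (hp : ∀ J, 1 ≤ p J)
    (hr : ForceResponse X f Ψ p) (J : Fin N) :
    EvBdd (rightEnergy m Ψ sR (X J)) ((2 * (p J : ℝ) - 1) * muLeft m p J) := by
  have hmu := le_muLeft h.mass_pos hp J
  have h1 := h.evBdd_left hX hp hr _ J rfl
  exact h.evBdd_right_of_jump (le_mul_of_one_le_left (h.mass_pos.le.trans hmu)
    (one_le_two_mul_sub_one (hp J))) J h1 (h.evBdd_force hr hmu h1)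

/-- The mirror image of `evBdd_left`. The induction counts the oscillators remaining to the right,
and the bound concerns the right side of `X J`, before its own force enters. -/
theorem evBdd_right (h : BoundedSolution m X f Ψ B sR sL) (hX : StrictMono X) (hp : ∀ J, 1 ≤ p J) (hr : ForceResponse X f Ψ p) :
    ∀ (k : ℕ) (J : Fin N), (J : ℕ) + 1 + k = N →
      EvBdd (rightEnergy m Ψ sR (X J)) (muRight m p J) := by
  intro k
  induction k with
  | zero =>
    intro J hJ
    rw [muRight_last hJ]
    exact h.evBdd_right_last fun K => hX.monotone (by rw [Fin.le_def]; have := K.2; omega)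
  | succ k ih =>
    intro J hJ
    have hk : (J : ℕ) + 1 < N := by omega
    set K : Fin N := ⟨J + 1, hk⟩
    have hKJ : (J : ℕ) + 1 = K := rfl
    have hmu := le_muRight h.mass_pos hp
    have h1 := ih K (by simp only [K]; omega)
    have h2 : muRight m p K ≤ (2 * (p K : ℝ) - 1) * muRight m p K :=
      le_mul_of_one_le_left (h.mass_pos.le.trans (hmu K)) (one_le_two_mul_sub_one (hp K))
    have h3 := h.evBdd_left_of_jump h2 K h1 (h.evBdd_force hr (hmu K) h1)
    rw [← muRight_previous hKJ] at h3
    exact h.evBdd_right_of_left (hmu J) (hX (by rw [Fin.lt_def]; omega))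
      (freeOn_consecutive hX hKJ) h3

end BoundedSolution

end Propagation

/-! ### Densities of distributions as weak limits -/

section Density

/-- Bounded sequences of a Hilbert space have weak cluster points. -/
theorem exists_weak_limit {H : Type*} [NormedAddCommGroup H] [InnerProductSpace ℂ H]
    [CompleteSpace H] (v : ℕ → H) (C : ℝ) (hv : ∀ᶠ n in atTop, ‖v n‖ ≤ C) :
    ∃ v₀ : H, ∀ (w : H) (c : ℂ), Tendsto (fun n => inner ℂ (v n) w) atTop (𝓝 c) →
      inner ℂ v₀ w = c := by
  set Λ : ℕ → WeakDual ℂ H := fun n => StrongDual.toWeakDual (InnerProductSpace.toDual ℂ H (v n))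
  have hK := WeakDual.isCompact_closedBall (𝕜 := ℂ) (E := H) 0 C
  have hle : map Λ atTop ≤ 𝓟 (WeakDual.toStrongDual ⁻¹' Metric.closedBall (0 : StrongDual ℂ H) C) := by
    rw [le_principal_iff, mem_map]
    filter_upwards [hv] with n hn
    change InnerProductSpace.toDual ℂ H (v n) ∈ Metric.closedBall 0 C
    rw [mem_closedBall_zero_iff, LinearIsometryEquiv.norm_map]
    exact hn
  -- Banach–Alaoglu. A cluster point of the filter is sufficient, with no subsequence and no
  -- separability, since convergence of the tested inner products is part of the hypothesis.
  obtain ⟨Λ₀, -, hΛ⟩ := hK hle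
  refine ⟨(InnerProductSpace.toDual ℂ H).symm (WeakDual.toStrongDual Λ₀), fun w c hc => ?_⟩
  rw [InnerProductSpace.toDual_symm_apply]
  have : NeBot (𝓝 Λ₀ ⊓ map Λ atTop) := hΛ
  have h1 : Tendsto (fun Φ : WeakDual ℂ H => Φ w) (𝓝 Λ₀ ⊓ map Λ atTop) (𝓝 (Λ₀ w)) :=
    ((WeakDual.eval_continuous w).tendsto Λ₀).mono_left inf_le_left
  have h2 : Tendsto (fun Φ : WeakDual ℂ H => Φ w) (𝓝 Λ₀ ⊓ map Λ atTop) (𝓝 c) := by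
    refine Tendsto.mono_left ?_ inf_le_right
    rw [tendsto_map'_iff]
    exact hc
  exact tendsto_nhds_unique h1 h2

theorem exists_weak_limit_setIntegral {g : ℕ → ℝ → ℂ} (hg : ∀ n, Measurable (g n)) {S : Set ℝ}
    {C : ℝ≥0} (hC : ∀ᶠ n in atTop, ∫⁻ ξ in S, ‖g n ξ‖ₑ ^ 2 ≤ C) :
    ∃ h : ℝ → ℂ, MemLp h 2 (volume.restrict S) ∧
      ∀ f : ℝ → ℂ, MemLp f 2 (volume.restrict S) → ∀ c : ℂ,
        Tendsto (fun n => ∫ ξ in S, g n ξ * f ξ) atTop (𝓝 c) → ∫ ξ in S, h ξ * f ξ = c := by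
  classical
  set μ : Measure ℝ := volume.restrict S
  have hL : ∀ n, ∫⁻ ξ in S, ‖g n ξ‖ₑ ^ 2 ≤ C →
      MemLp (fun ξ => starRingEnd ℂ (g n ξ)) 2 μ := by
    intro n hn
    refine ⟨(Complex.continuous_conj.measurable.comp (hg n)).aestronglyMeasurable, ?_⟩
    rw [eLpNorm_lt_top_iff_lintegral_rpow_enorm_lt_top (by norm_num) (by norm_num)]
    refine lt_of_le_of_lt ?_ (hn.trans_lt ENNReal.coe_lt_top)
    refine lintegral_mono fun ξ => ?_
    simp
  -- The conjugate compensates for the conjugate linearity of the inner product in its first slot.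
  -- The value 0 is used when the function is not in `L²`, which does not happen once the eventual
  -- bound holds.
  set v : ℕ → Lp ℂ 2 μ := fun n =>
    if h : MemLp (fun ξ => starRingEnd ℂ (g n ξ)) 2 μ then h.toLp else 0 with hv
  have hvn : ∀ᶠ n in atTop, ‖v n‖ ≤ Real.sqrt C := by
    filter_upwards [hC] with n hn
    have hLn := hL n hn
    have e : v n = hLn.toLp := by rw [hv]; exact dif_pos hLn
    refine Real.le_sqrt_of_sq_le ?_
    have h1 := lintegral_sq_eq_ofReal_norm_sq hLn
    rw [← e] at h1
    have h2 : ENNReal.ofReal (‖v n‖ ^ 2) ≤ ENNReal.ofReal C := by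
      rw [← h1, ENNReal.ofReal_coe_nnreal]
      refine le_trans (lintegral_mono fun ξ => ?_) hn
      simp
    exact (ENNReal.ofReal_le_ofReal_iff C.2).1 h2
  obtain ⟨v₀, h₀⟩ := exists_weak_limit v _ hvn
  refine ⟨fun ξ => starRingEnd ℂ (v₀ ξ), (Lp.memLp v₀).star, fun f hf c hc => ?_⟩
  have h1 := h₀ hf.toLp c ?_
  · rw [← h1, L2.inner_def]
    refine integral_congr_ae ?_
    filter_upwards [hf.coeFn_toLp] with ξ hξ
    rw [hξ]
    simp [mul_comm]
  · refine hc.congr' ?_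
    filter_upwards [hC] with n hn
    have hLn := hL n hn
    have e : v n = hLn.toLp := by rw [hv]; exact dif_pos hLn
    rw [L2.inner_def, e]
    refine integral_congr_ae ?_
    filter_upwards [hf.coeFn_toLp, hLn.coeFn_toLp] with ξ hξ hξ'
    rw [hξ, hξ']
    simp [mul_comm]

theorem isOpen_highFreq (a : ℝ) : IsOpen (highFreq a) :=
  isOpen_lt continuous_const continuous_abs

theorem locallyIntegrableOn_of_memLp {h : ℝ → ℂ} {a : ℝ}
    (hh : ∀ ε : ℝ, 0 < ε → MemLp h 2 (volume.restrict (highFreq (a + ε)))) :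
    LocallyIntegrableOn h (highFreq a) := by
  intro x hx
  have hx' : a < |x| := hx
  set ε := (|x| - a) / 2 with hε
  have hε0 : 0 < ε := by rw [hε]; linarith
  have hxe : x ∈ highFreq (a + ε) := by change a + ε < |x|; rw [hε]; linarith
  refine ⟨highFreq (a + ε) ∩ Metric.ball x 1, mem_nhdsWithin_of_mem_nhds
    (inter_mem ((isOpen_highFreq _).mem_nhds hxe) (Metric.ball_mem_nhds x one_pos)), ?_⟩
  have h1 : MemLp h 2 (volume.restrict (highFreq (a + ε) ∩ Metric.ball x 1)) :=
    (hh ε hε0).mono_measure (Measure.restrict_mono inter_subset_left le_rfl)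
  have : IsFiniteMeasure (volume.restrict (highFreq (a + ε) ∩ Metric.ball x 1)) :=
    ⟨by
      rw [Measure.restrict_apply_univ]
      exact (measure_mono inter_subset_right).trans_lt measure_ball_lt_top⟩
  exact h1.integrable (by norm_num)

theorem exists_subset_highFreq {K : Set ℝ} (hK : IsCompact K) {a : ℝ} (h : K ⊆ highFreq a) :
    ∃ ε : ℝ, 0 < ε ∧ K ⊆ highFreq (a + ε) := by
  rcases K.eq_empty_or_nonempty with rfl | hne
  · exact ⟨1, one_pos, empty_subset _⟩
  · obtain ⟨x, hx, hmin⟩ := hK.exists_isMinOn hne (continuous_abs.continuousOn (s := K))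
    have hx' : a < |x| := h hx
    refine ⟨(|x| - a) / 2, by linarith, fun y hy => ?_⟩
    have : |x| ≤ |y| := hmin hy
    change a + (|x| - a) / 2 < |y|
    linarith

theorem setIntegral_mul_eq {g η : ℝ → ℂ} {S : Set ℝ} (hη : tsupport η ⊆ S) :
    ∫ ξ in S, g ξ * η ξ = ∫ ξ : ℝ, g ξ * η ξ :=
  setIntegral_eq_integral_of_forall_compl_eq_zero fun x hx => by
    rw [image_eq_zero_of_notMem_tsupport fun h => hx (hη h), mul_zero]

/-- Functions whose restrictions to high frequencies are eventually bounded in `L²`, and which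
converge in the sense of distributions there, converge to a locally square integrable function. -/
theorem EvBdd.exists_density {g : ℕ → ℝ → ℂ} (hg : ∀ n, Measurable (g n)) {a : ℝ}
    (h : EvBdd (fun n ξ => ‖g n ξ‖ₑ ^ 2) a)
    (hlim : ∀ η : ℝ → ℂ, IsTestFunction η → tsupport η ⊆ highFreq a →
      ∃ c : ℂ, Tendsto (fun n => ∫ ξ : ℝ, g n ξ * η ξ) atTop (𝓝 c)) :
    ∃ G : ℝ → ℂ, (∀ ε : ℝ, 0 < ε → MemLp G 2 (volume.restrict (highFreq (a + ε)))) ∧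
      ∀ η : ℝ → ℂ, IsTestFunction η → tsupport η ⊆ highFreq a →
        Tendsto (fun n => ∫ ξ : ℝ, g n ξ * η ξ) atTop (𝓝 (∫ ξ in highFreq a, G ξ * η ξ)) := by
  set U : ℕ → Set ℝ := fun k => highFreq (a + 1 / ((k : ℝ) + 1)) with hU
  have hpos : ∀ k : ℕ, 0 < 1 / ((k : ℝ) + 1) := fun k => by positivity
  have hUa : ∀ k, U k ⊆ highFreq a := fun k => highFreq_anti (by have := hpos k; linarith)
  have hUmono : ∀ {j k : ℕ}, j ≤ k → U j ⊆ U k := fun {j k} hjk =>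
    highFreq_anti (by gcongr)
  have hex : ∀ k, ∃ hk : ℝ → ℂ, MemLp hk 2 (volume.restrict (U k)) ∧
      ∀ f : ℝ → ℂ, MemLp f 2 (volume.restrict (U k)) → ∀ c : ℂ,
        Tendsto (fun n => ∫ ξ in U k, g n ξ * f ξ) atTop (𝓝 c) → ∫ ξ in U k, hk ξ * f ξ = c := by
    intro k
    obtain ⟨C, hC⟩ := h _ (hpos k)
    exact exists_weak_limit_setIntegral hg hC
  choose w hw hlimw using hex
  have hwlim : ∀ k (η : ℝ → ℂ), IsTestFunction η → tsupport η ⊆ U k →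
      Tendsto (fun n => ∫ ξ : ℝ, g n ξ * η ξ) atTop (𝓝 (∫ ξ : ℝ, w k ξ * η ξ)) := by
    intro k η hη hs
    obtain ⟨c, hc⟩ := hlim η hη (hs.trans (hUa k))
    have h1 := hlimw k η ((hη.1.continuous.memLp_of_hasCompactSupport hη.2).restrict _) c
      (by simpa only [setIntegral_mul_eq hs] using hc)
    rw [setIntegral_mul_eq hs] at h1
    rwa [h1]
  have hwloc : ∀ {j k : ℕ}, j ≤ k → LocallyIntegrableOn (w k) (U j) := by
    intro j k hjk
    refine locallyIntegrableOn_of_memLp fun ε hε => ?_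
    refine (hw k).mono_measure (Measure.restrict_mono (highFreq_anti ?_) le_rfl)
    have : 1 / ((k : ℝ) + 1) ≤ 1 / ((j : ℝ) + 1) := by gcongr
    linarith
  -- Weak limits on two nested sets represent the same limit functional on the smaller one, so they
  -- agree there almost everywhere.
  have hae : ∀ j k : ℕ, j ≤ k → ∀ᵐ ξ : ℝ, ξ ∈ U j → w j ξ - w k ξ = 0 := by
    intro j k hjk
    refine IsOpen.ae_eq_zero_of_integral_contDiff_smul_eq_zero (isOpen_highFreq _)
      ((hwloc le_rfl).sub (hwloc hjk)) fun ρ hρ hρc hρs => ?_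
    have hη : IsTestFunction (fun ξ => (ρ ξ : ℂ)) :=
      ⟨contDiff_ofReal_comp hρ, hasCompactSupport_ofReal_comp hρc⟩
    have hs : tsupport (fun ξ => (ρ ξ : ℂ)) ⊆ U j := by
      refine Subset.trans (closure_mono fun x hx => ?_) hρs
      simpa using hx
    have h1 := tendsto_nhds_unique (hwlim j _ hη hs) (hwlim k _ hη (hs.trans (hUmono hjk)))
    have hint : ∀ i, j ≤ i → Integrable (fun ξ => w i ξ * (ρ ξ : ℂ)) := by
      intro i hi
      have h2 : MemLp (fun ξ => (ρ ξ : ℂ)) 2 (volume.restrict (U i)) :=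
        (hη.1.continuous.memLp_of_hasCompactSupport hη.2).restrict _
      have h3 : IntegrableOn (fun ξ => w i ξ * (ρ ξ : ℂ)) (U i) := (hw i).integrable_mul h2
      refine (integrableOn_iff_integrable_of_support_subset fun ξ hξ => ?_).1 h3
      refine hUmono hi (hs (subset_tsupport _ ?_))
      exact right_ne_zero_of_mul hξ
    calc ∫ ξ : ℝ, ρ ξ • (w j ξ - w k ξ)
        = ∫ ξ : ℝ, (w j ξ * (ρ ξ : ℂ) - w k ξ * (ρ ξ : ℂ)) := by
          refine integral_congr_ae (ae_of_all _ fun ξ => ?_)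
          simp only [Complex.real_smul]; ring
      _ = 0 := by rw [integral_sub (hint j le_rfl) (hint k hjk), h1, sub_self]
  have hae' : ∀ᵐ ξ : ℝ, ∀ j k : ℕ, j ≤ k → ξ ∈ U j → w j ξ - w k ξ = 0 := by
    simp only [ae_all_iff]
    exact hae
  -- The local densities are glued by taking at `ξ` the one attached to the first set containing
  -- `ξ`. Outside the union the infimum of the empty set is 0 and the value is irrelevant.
  set G : ℝ → ℂ := fun ξ => w (sInf {k | ξ ∈ U k}) ξ with hG
  have hGw : ∀ k, ∀ᵐ ξ : ℝ, ξ ∈ U k → G ξ = w k ξ := by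
    intro k
    filter_upwards [hae'] with ξ hξ hk
    exact sub_eq_zero.1 (hξ _ k (Nat.sInf_le hk) (Nat.sInf_mem (s := {k | ξ ∈ U k}) ⟨k, hk⟩))
  have hcov : ∀ ε : ℝ, 0 < ε → ∃ k, highFreq (a + ε) ⊆ U k := by
    intro ε hε
    obtain ⟨k, hk⟩ := exists_nat_one_div_lt hε
    exact ⟨k, highFreq_anti (by linarith)⟩
  refine ⟨G, fun ε hε => ?_, fun η hη hs => ?_⟩
  · obtain ⟨k, hk⟩ := hcov ε hε
    have h1 : MemLp G 2 (volume.restrict (U k)) := (hw k).ae_eq (by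
      refine (ae_restrict_iff' (measurableSet_highFreq _)).2 ?_
      filter_upwards [hGw k] with ξ hξ hm using (hξ hm).symm)
    exact h1.mono_measure (Measure.restrict_mono hk le_rfl)
  · obtain ⟨ε, hε, hsε⟩ := exists_subset_highFreq hη.2 hs
    obtain ⟨k, hk⟩ := hcov ε hε
    have h1 := hwlim k η hη (hsε.trans hk)
    rw [setIntegral_mul_eq hs]
    refine (congrArg 𝓝 (integral_congr_ae ?_)).le |> h1.mono_right
    filter_upwards [hGw k] with ξ hξ
    by_cases hm : ξ ∈ U k
    · rw [hξ hm]
    · rw [image_eq_zero_of_notMem_tsupport fun h => hm (hk (hsε h)), mul_zero, mul_zero]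

theorem SchwartzMap.isTestFunction {η : 𝓢(ℝ, ℂ)} (h : HasCompactSupport η) :
    IsTestFunction η := ⟨η.smooth ⊤, h⟩

theorem EvBdd.absContAboveWithBound {g : ℕ → ℝ → ℂ} (hg : ∀ n, Measurable (g n)) {a : ℝ}
    (h : EvBdd (fun n ξ => ‖g n ξ‖ₑ ^ 2) a) {T : 𝓢'(ℝ, ℂ)}
    (hT : ∀ η : 𝓢(ℝ, ℂ), HasCompactSupport η →
      Tendsto (fun n => ∫ ξ : ℝ, g n ξ * η ξ) atTop (𝓝 (T η))) :
    AbsContAboveWithBound T a (fun _ => 1) := by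
  obtain ⟨G, hG, hlim⟩ := h.exists_density hg fun η hη _ => ⟨T hη.toSchwartz, by
    simpa only [hη.coe_toSchwartz] using hT hη.toSchwartz (by rw [hη.coe_toSchwartz]; exact hη.2)⟩
  refine ⟨G, ⟨locallyIntegrableOn_of_memLp hG, fun η hη hs => ?_⟩, fun ε hε => ?_⟩
  · exact tendsto_nhds_unique (hT η hη) (hlim η (SchwartzMap.isTestFunction hη) hs)
  · simp only [mul_one]
    exact (hG ε hε).integrable_norm_pow (by norm_num)

/-- The density is found for `ξ g_n(ξ)` and divided by `ξ`, which is nonzero for `|ξ| > a ≥ 0`.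
Correspondingly a test function is divided by `ξ`; it stays smooth because its support avoids the
origin. -/
theorem EvBdd.absContAboveWithBound_sq {g : ℕ → ℝ → ℂ} (hg : ∀ n, Measurable (g n)) {a : ℝ}
    (ha : 0 ≤ a) (h : EvBdd (fun n (ξ : ℝ) => ‖(ξ : ℂ) * g n ξ‖ₑ ^ 2) a) {T : 𝓢'(ℝ, ℂ)}
    (hT : ∀ η : 𝓢(ℝ, ℂ), HasCompactSupport η →
      Tendsto (fun n => ∫ ξ : ℝ, g n ξ * η ξ) atTop (𝓝 (T η))) :
    AbsContAboveWithBound T a (fun ξ => ξ ^ 2) := by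
  have hmul : ∀ {η : ℝ → ℂ}, IsTestFunction η → IsTestFunction (fun ξ : ℝ => (ξ : ℂ) * η ξ) :=
    fun {η} hη => ⟨Complex.ofRealCLM.contDiff.mul hη.1, hη.2.mul_left⟩
  have hne : ∀ {ξ : ℝ}, ξ ∈ highFreq a → (ξ : ℂ) ≠ 0 := fun {ξ} hξ => by
    have hξ' : a < |ξ| := hξ
    exact Complex.ofReal_ne_zero.2 (abs_pos.1 (ha.trans_lt hξ'))
  obtain ⟨G, hG, hlim⟩ := h.exists_density
    (g := fun n ξ => (ξ : ℂ) * g n ξ) (fun n => Complex.measurable_ofReal.mul (hg n)) fun η hη _ =>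
      ⟨T (hmul hη).toSchwartz, by
        have h1 := hT (hmul hη).toSchwartz (by
          rw [(hmul hη).coe_toSchwartz]; exact (hmul hη).2)
        refine h1.congr fun n => integral_congr_ae (ae_of_all _ fun ξ => ?_)
        simp only [(hmul hη).coe_toSchwartz]
        ring⟩
  refine ⟨fun ξ => G ξ * (ξ : ℂ)⁻¹, ⟨?_, fun η hη hs => ?_⟩, fun ε hε => ?_⟩
  · refine (locallyIntegrableOn_of_memLp hG).mul_continuousOn ?_
      (isOpen_highFreq a).isLocallyClosed
    exact Complex.continuous_ofReal.continuousOn.inv₀ fun ξ hξ => hne hξ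
  · set ζ : ℝ → ℂ := fun ξ => (ξ : ℂ)⁻¹ * η ξ with hζ
    have hsub : tsupport ζ ⊆ tsupport η := closure_mono fun x hx => right_ne_zero_of_mul hx
    have hζt : IsTestFunction ζ := by
      refine ⟨contMDiff_iff_contDiff.1 (contMDiff_of_tsupport fun x hx => ?_), hη.mul_left⟩
      rw [contMDiffAt_iff_contDiffAt]
      exact (Complex.ofRealCLM.contDiff.contDiffAt.inv (hne (hs (hsub hx)))).mul
        (η.smooth ⊤).contDiffAt
    have h1 := hlim ζ hζt (hsub.trans hs)
    have h2 : Tendsto (fun n => ∫ ξ : ℝ, (ξ : ℂ) * g n ξ * ζ ξ) atTop (𝓝 (T η)) := by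
      refine (hT η hη).congr fun n => integral_congr_ae (ae_of_all _ fun ξ => ?_)
      by_cases hξ : ξ ∈ highFreq a
      · have := hne hξ
        simp only [hζ]
        field_simp
      · have h0 : η ξ = 0 := image_eq_zero_of_notMem_tsupport fun h => hξ (hs h)
        simp [hζ, h0]
    rw [tendsto_nhds_unique h2 h1]
    refine integral_congr_ae (ae_of_all _ fun ξ => ?_)
    simp only [hζ]
    ring
  · have h1 := (hG ε hε).integrable_norm_pow (p := 2) (by norm_num)
    refine h1.congr ?_
    refine (ae_restrict_iff' (measurableSet_highFreq _)).2 (ae_of_all _ fun ξ hξ => ?_)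
    have hξ0 := hne (highFreq_anti (by linarith : a ≤ a + ε) hξ)
    have hn : ‖(ξ : ℂ)‖ ^ 2 = ξ ^ 2 := by simp
    simp only
    rw [norm_mul, norm_inv, mul_pow, ← hn, mul_assoc, ← mul_pow,
      inv_mul_cancel₀ (norm_ne_zero_iff.2 hξ0), one_pow, mul_one]

theorem AbsContAboveWithBound.absContAbove {T : 𝓢'(ℝ, ℂ)} {a : ℝ} {w : ℝ → ℝ}
    (h : AbsContAboveWithBound T a w) : AbsContAbove T a :=
  h.imp fun _ hg => hg.1

end Density

/-! ### The Fourier transform in time as a tempered distribution -/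

section TimeFourier

theorem BddCont.memLp_top {u : ℝ → ℂ} (hu : BddCont u) : MemLp u ⊤ volume :=
  memLp_top_of_bound hu.1.aestronglyMeasurable hu.2.choose (ae_of_all _ hu.2.choose_spec)

/-- The Fourier transform of a bounded continuous function of time. -/
def BddCont.timeFt {u : ℝ → ℂ} (hu : BddCont u) : 𝓢'(ℝ, ℂ) :=
  PointwiseConvergenceCLM.precomp ℂ ftS (Lp.toTemperedDistribution (hu.memLp_top.toLp u))

theorem BddCont.timeFt_apply {u : ℝ → ℂ} (hu : BddCont u) (η : 𝓢(ℝ, ℂ)) :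
    hu.timeFt η = ∫ t : ℝ, u t * ftS η t := by
  change Lp.toTemperedDistribution (hu.memLp_top.toLp u) (ftS η) = _
  rw [Lp.toTemperedDistribution_apply]
  refine integral_congr_ae ?_
  filter_upwards [hu.memLp_top.coeFn_toLp] with t ht
  rw [ht, smul_eq_mul, mul_comm]

theorem BddCont.isTimeFourier {u : ℝ → ℂ} (hu : BddCont u) : IsTimeFourier u hu.timeFt := by
  intro η
  have e : (fun t => u t * fourierOfTest η t) = fun t => u t * ftS η t := by
    simp only [ftS_eq_fourierOfTest]
  rw [e, hu.timeFt_apply]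
  exact ⟨hu.integrable_mul (ftS η).integrable, rfl⟩

theorem IsTimeFourier.sub {u v : ℝ → ℂ} {S T : 𝓢'(ℝ, ℂ)} (hu : IsTimeFourier u S)
    (hv : IsTimeFourier v T) : IsTimeFourier (fun t => u t - v t) (S - T) := by
  intro η
  obtain ⟨h1, h2⟩ := hu η
  obtain ⟨h3, h4⟩ := hv η
  simp only [sub_mul]
  refine ⟨h1.sub h3, ?_⟩
  rw [integral_sub h1 h3, ← h2, ← h4]
  rfl

theorem BddCont.norm_timeFt_le {u : ℝ → ℂ} (hu : BddCont u) {K : ℝ} (hK : ∀ t, ‖u t‖ ≤ K)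
    (η : 𝓢(ℝ, ℂ)) : ‖hu.timeFt η‖ ≤ K * ∫ t, ‖ftS η t‖ := by
  rw [hu.timeFt_apply, ← integral_const_mul]
  refine norm_integral_le_of_norm_le ((ftS η).integrable.norm.const_mul K) (ae_of_all _ fun t => ?_)
  rw [norm_mul]
  gcongr
  exact hK t

theorem BddCont.integrable_ft_mul {u : ℝ → ℂ} (hu : BddCont u) (κ η : 𝓢(ℝ, ℂ)) :
    Integrable (fun ξ : ℝ => ft (fun t => κ t * u t) ξ * η ξ) := by
  have h1 := integrable_cutoff_mul hu κ
  exact BddCont.integrable_mul ⟨continuous_ft h1, _, norm_ft_le _⟩ η.integrable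

/-- Removing a cutoff in time in the sense of tempered distributions. -/
theorem BddCont.tendsto_integral_ft {u : ℝ → ℂ} (hu : BddCont u) {κ : ℕ → 𝓢(ℝ, ℂ)} {M : ℝ}
    (hM : ∀ n t, ‖κ n t‖ ≤ M) {c : ℂ} (hc : ∀ t, Tendsto (fun n => κ n t) atTop (𝓝 c))
    (η : 𝓢(ℝ, ℂ)) :
    Tendsto (fun n => ∫ ξ : ℝ, ft (fun t => κ n t * u t) ξ * η ξ) atTop (𝓝 (c * hu.timeFt η)) := by
  obtain ⟨K, hK⟩ := hu.2
  simp only [integral_ft_mul (integrable_cutoff_mul hu _) η.integrable]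
  rw [hu.timeFt_apply, ← integral_const_mul]
  refine tendsto_integral_of_dominated_convergence (fun t => M * K * ‖ftS η t‖) (fun n => ?_)
    ((ftS η).integrable.norm.const_mul _) (fun n => ae_of_all _ fun t => ?_)
    (ae_of_all _ fun t => ?_)
  · exact (((κ n).continuous.mul hu.1).mul (continuous_ft η.integrable)).aestronglyMeasurable
  · rw [norm_mul, norm_mul, ftS_apply]
    gcongr
    · exact (norm_nonneg _).trans (hM n t)
    · exact hM n t
    · exact hK t
  · rw [ftS_apply, ← mul_assoc]
    exact ((hc t).mul_const _).mul_const _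

/-- Multiplication by the frequency. -/
def mulFreq : 𝓢(ℝ, ℂ) →L[ℂ] 𝓢(ℝ, ℂ) := SchwartzMap.smulLeftCLM ℂ (fun ξ : ℝ => (ξ : ℂ))

theorem mulFreq_apply (η : 𝓢(ℝ, ℂ)) (ξ : ℝ) : mulFreq η ξ = ξ * η ξ :=
  SchwartzMap.smulLeftCLM_apply_apply Complex.ofRealCLM.hasTemperateGrowth η ξ

/-- Multiplication by `m² - ω²`. -/
def mulSymbol (m : ℝ) : 𝓢(ℝ, ℂ) →L[ℂ] 𝓢(ℝ, ℂ) :=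
  ((m : ℂ) ^ 2) • ContinuousLinearMap.id ℂ 𝓢(ℝ, ℂ) - mulFreq.comp mulFreq

theorem mulSymbol_apply (m : ℝ) (η : 𝓢(ℝ, ℂ)) (ξ : ℝ) :
    mulSymbol m η ξ = ((m : ℂ) ^ 2 - (ξ : ℂ) ^ 2) * η ξ := by
  change (m : ℂ) ^ 2 * η ξ - mulFreq (mulFreq η) ξ = _
  rw [mulFreq_apply, mulFreq_apply]
  ring

theorem dS_cutoff (n : ℕ) (t : ℝ) :
    dS (cutoff n) t = ((n + 1 : ℝ)⁻¹ : ℝ) * dS (cutoff 0) ((n + 1 : ℝ)⁻¹ * t) := by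
  rw [dS_dilation (κ := cutoff 0) (c := 1) (fun t => by rw [cutoff_eq_dilation, one_mul]) t, one_mul]

theorem dS_dS_cutoff (n : ℕ) (t : ℝ) :
    dS (dS (cutoff n)) t =
      (((n + 1 : ℝ)⁻¹ : ℝ) * ((n + 1 : ℝ)⁻¹ : ℝ)) * dS (dS (cutoff 0)) ((n + 1 : ℝ)⁻¹ * t) :=
  dS_dilation (dS_cutoff n) t

theorem SchwartzMap.exists_norm_le (κ : 𝓢(ℝ, ℂ)) : ∃ M : ℝ, 0 ≤ M ∧ ∀ t, ‖κ t‖ ≤ M :=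
  ⟨SchwartzMap.seminorm ℂ 0 0 κ, apply_nonneg _ _, fun t => κ.norm_le_seminorm ℂ t⟩

/-- Each derivative of the dilated cutoff gains a factor `1/(n+1)`, so the commutator terms
disappear in the limit. -/
theorem exists_dS_cutoff : ∃ M : ℝ, (∀ n t, ‖dS (cutoff n) t‖ ≤ M) ∧
    ∀ t, Tendsto (fun n => dS (cutoff n) t) atTop (𝓝 0) := by
  obtain ⟨M, hM0, hM⟩ := SchwartzMap.exists_norm_le (dS (cutoff 0))
  have h1 : ∀ n t, ‖dS (cutoff n) t‖ ≤ 1 / ((n : ℝ) + 1) * M := fun n t => by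
    rw [dS_cutoff, norm_mul, Complex.norm_real, Real.norm_of_nonneg (by positivity), one_div]
    gcongr
    exact hM _
  refine ⟨M, fun n t => (h1 n t).trans ?_, fun t => ?_⟩
  · refine mul_le_of_le_one_left hM0 ?_
    rw [div_le_one (by positivity)]
    linarith [Nat.cast_nonneg (α := ℝ) n]
  · refine squeeze_zero_norm (fun n => h1 n t) ?_
    simpa using (tendsto_one_div_add_atTop_nhds_zero_nat (𝕜 := ℝ)).mul_const M

theorem exists_dS_dS_cutoff : ∃ M : ℝ, (∀ n t, ‖dS (dS (cutoff n)) t‖ ≤ M) ∧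
    ∀ t, Tendsto (fun n => dS (dS (cutoff n)) t) atTop (𝓝 0) := by
  obtain ⟨M, hM0, hM⟩ := SchwartzMap.exists_norm_le (dS (dS (cutoff 0)))
  have hle : ∀ n : ℕ, 1 / ((n : ℝ) + 1) ≤ 1 := fun n => by
    rw [div_le_one (by positivity)]
    linarith [Nat.cast_nonneg (α := ℝ) n]
  have h1 : ∀ n t, ‖dS (dS (cutoff n)) t‖ ≤ 1 / ((n : ℝ) + 1) * M := fun n t => by
    rw [dS_dS_cutoff, norm_mul, norm_mul, Complex.norm_real,
      Real.norm_of_nonneg (by positivity), ← one_div]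
    gcongr
    · exact mul_le_of_le_one_left (by positivity) (hle n)
    · exact hM _
  refine ⟨M, fun n t => (h1 n t).trans (mul_le_of_le_one_left hM0 (hle n)), fun t => ?_⟩
  refine squeeze_zero_norm (fun n => h1 n t) ?_
  simpa using (tendsto_one_div_add_atTop_nhds_zero_nat (𝕜 := ℝ)).mul_const M

end TimeFourier

/-! ### The one-sided space derivative of the transform -/

section Taylor

theorem taylor_integral {D q : ℝ → ℂ} (hD : ∀ y, HasDerivAt D (q y) y) (hq : Continuous q)
    (a x : ℝ) :
    ∫ y in a..x, D y = ((x - a : ℝ) : ℂ) * D a + ∫ y in a..x, ((x - y : ℝ) : ℂ) * q y := by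
  have hDc : Continuous D := continuous_iff_continuousAt.2 fun y => (hD y).continuousAt
  have h1 : ∀ y, HasDerivAt (fun y : ℝ => ((x - y : ℝ) : ℂ)) (-1) y := fun y => by
    have := ((hasDerivAt_id y).const_sub x).ofReal_comp
    simpa using this
  have h2 := intervalIntegral.integral_mul_deriv_eq_deriv_mul (a := a) (b := x)
    (fun y _ => h1 y) (fun y _ => hD y) (continuous_const.intervalIntegrable _ _)
    (hq.intervalIntegrable _ _)
  rw [h2]
  simp

variable {N : ℕ} {m : ℝ} {X : Fin N → ℝ} {f : Fin N → ℝ → ℂ} {Ψ : ℝ → EnergyState} {B : ℝ≥0}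
  {sR sL : ℕ → ℝ → ℝ → ℂ}

/-- The second primitive of the field vanishing to second order at `a`. -/
def fldPrim (Ψ : ℝ → EnergyState) (a x t : ℝ) : ℂ :=
  ∫ y in a..x, ((x - y : ℝ) : ℂ) * (Ψ t).fld y

namespace BoundedSolution

theorem norm_fldPrim_le (h : BoundedSolution m X f Ψ B sR sL) {a x : ℝ} (hax : a ≤ x) (t : ℝ) :
    ‖fldPrim Ψ a x t‖ ≤ fldBound m B * (x - a) ^ 2 := by
  have h1 := intervalIntegral.norm_integral_le_of_norm_le_const (a := a) (b := x)
    (f := fun y => ((x - y : ℝ) : ℂ) * (Ψ t).fld y) (C := (x - a) * fldBound m B) fun y hy => by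
      rw [uIoc_of_le hax] at hy
      rw [norm_mul, Complex.norm_real, Real.norm_of_nonneg (by linarith [hy.2])]
      have := norm_fld_le_fldBound h.mass_pos (h.energy_le t) y
      exact mul_le_mul (by linarith [hy.1]) this (norm_nonneg _) (by linarith)
  rw [abs_of_nonneg (by linarith)] at h1
  calc _ ≤ _ := h1
    _ = _ := by ring

theorem bddCont_fldPrim (h : BoundedSolution m X f Ψ B sR sL) {a x : ℝ} (hax : a ≤ x) :
    BddCont (fldPrim Ψ a x) := by
  refine ⟨?_, _, h.norm_fldPrim_le hax⟩
  have hc := h.solves.continuousInEnergy.continuous_fld h.mass_pos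
  refine intervalIntegral.continuous_parametric_intervalIntegral_of_continuous'
    (f := fun t y => ((x - y : ℝ) : ℂ) * (Ψ t).fld y) ?_ a x
  exact (by fun_prop : Continuous fun p : ℝ × ℝ => ((x - p.2 : ℝ) : ℂ)).mul
    (hc.comp continuous_swap)

/-- Fubini, permitted by the uniform bound on the field and the integrability of the cutoff. The
Taylor remainder thereby becomes the transform of a bounded function of time. -/
theorem integral_cutFt (h : BoundedSolution m X f Ψ B sR sL) (κ : 𝓢(ℝ, ℂ)) (a x ξ : ℝ) :
    ∫ y in a..x, ((x - y : ℝ) : ℂ) * cutFt Ψ κ y ξ = ft (fun t => κ t * fldPrim Ψ a x t) ξ := by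
  have hc := h.solves.continuousInEnergy.continuous_fld h.mass_pos
  have h1 : ∀ y : ℝ, ((x - y : ℝ) : ℂ) * cutFt Ψ κ y ξ =
      ∫ t : ℝ, ((x - y : ℝ) : ℂ) * (Complex.exp (Complex.I * ξ * t) * (κ t * (Ψ t).fld y)) :=
    fun y => (integral_const_mul _ _).symm
  simp only [h1]
  rw [intervalIntegral_integral_swap]
  · refine integral_congr_ae (ae_of_all _ fun t => ?_)
    simp only [fldPrim]
    rw [← intervalIntegral.integral_const_mul, ← intervalIntegral.integral_const_mul]
    refine intervalIntegral.integral_congr fun y _ => ?_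
    ring
  · have : IsFiniteMeasure (volume.restrict (uIoc a x)) :=
      isFiniteMeasure_restrict.2 measure_Ioc_lt_top.ne
    have hb : Integrable (fun p : ℝ × ℝ => (|x - a| * fldBound m B) * ‖κ p.2‖)
        ((volume.restrict (uIoc a x)).prod volume) :=
      (integrable_const (μ := volume.restrict (uIoc a x)) (|x - a| * fldBound m B)).mul_prod
        κ.integrable.norm
    refine hb.mono' ?_ ?_
    · refine Continuous.aestronglyMeasurable ?_
      refine (by fun_prop : Continuous fun p : ℝ × ℝ => ((x - p.1 : ℝ) : ℂ)).mul
        ((by fun_prop : Continuous fun p : ℝ × ℝ => Complex.exp (Complex.I * ξ * p.2)).mul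
          ((κ.continuous.comp continuous_snd).mul hc))
    · have h2 : ∀ᵐ p : ℝ × ℝ ∂((volume.restrict (uIoc a x)).prod volume), p.1 ∈ uIoc a x :=
        Measure.quasiMeasurePreserving_fst.ae (ae_restrict_mem measurableSet_uIoc)
      filter_upwards [h2] with p hp
      simp only [Function.uncurry]
      rw [norm_mul, norm_mul, norm_exp_I_mul, one_mul, norm_mul, Complex.norm_real, Real.norm_eq_abs]
      have h3 := norm_fld_le_fldBound h.mass_pos (h.energy_le p.2) p.1
      have h4 : |x - p.1| ≤ |x - a| := by
        rw [abs_sub_comm x p.1, abs_sub_comm x a]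
        rw [uIoc_comm] at hp
        have := Set.abs_sub_left_of_mem_uIcc (uIoc_subset_uIcc hp)
        simpa using this
      calc |x - p.1| * (‖κ p.2‖ * ‖(Ψ p.2).fld p.1‖)
          ≤ |x - a| * (‖κ p.2‖ * fldBound m B) := by gcongr
        _ = _ := by ring

/-- Taylor's formula at `a` with integral remainder, the second derivative being replaced through
the equation. The slope is thus expressed by transforms of bounded functions of time, whose limits
as distributions exist. -/
theorem taylor_slope (h : BoundedSolution m X f Ψ B sR sL) {a b x : ℝ} (hfree : FreeOn X a b)
    (hx : x ∈ Ioc a b) (n : ℕ) (ξ : ℝ) :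
    ((x - a : ℝ) : ℂ) * sR n a ξ = cutFt Ψ (cutoff n) x ξ - cutFt Ψ (cutoff n) a ξ
      - ((m : ℂ) ^ 2 - (ξ : ℂ) ^ 2) * ft (fun t => cutoff n t * fldPrim Ψ a x t) ξ
      - 2 * Complex.I * (ξ * ft (fun t => dS (cutoff n) t * fldPrim Ψ a x t) ξ)
      - ft (fun t => dS (dS (cutoff n)) t * fldPrim Ψ a x t) ξ := by
  have hab : a < b := hx.1.trans_le hx.2
  obtain ⟨D, hD, hs, hR, -⟩ := (h.slopes n ξ).free a b hab hfree
  have hE := h.solves.continuousInEnergy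
  have hq := continuous_section (continuous_curvFt h.mass_pos hE (h.bound (cutoff n))) ξ
  have h1 := taylor_integral hD hq a x
  have hcut : ∀ κ : 𝓢(ℝ, ℂ), Continuous (fun y => cutFt Ψ κ y ξ) := fun κ =>
    continuous_section (continuous_cutFt h.mass_pos hE (h.bound κ)) ξ
  have hint : ∀ κ : 𝓢(ℝ, ℂ), IntervalIntegrable
      (fun y : ℝ => ((x - y : ℝ) : ℂ) * cutFt Ψ κ y ξ) volume a x := fun κ =>
    ((by fun_prop : Continuous fun y : ℝ => ((x - y : ℝ) : ℂ)).mul (hcut κ)).intervalIntegrable _ _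
  have h2 : ∫ y in a..x, ((x - y : ℝ) : ℂ) * curvFt m Ψ (cutoff n) y ξ =
      ((m : ℂ) ^ 2 - (ξ : ℂ) ^ 2) * ft (fun t => cutoff n t * fldPrim Ψ a x t) ξ
      + 2 * Complex.I * (ξ * ft (fun t => dS (cutoff n) t * fldPrim Ψ a x t) ξ)
      + ft (fun t => dS (dS (cutoff n)) t * fldPrim Ψ a x t) ξ := by
    rw [← h.integral_cutFt, ← h.integral_cutFt, ← h.integral_cutFt, ← mul_assoc (2 * Complex.I),
      ← intervalIntegral.integral_const_mul, ← intervalIntegral.integral_const_mul,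
      ← intervalIntegral.integral_add ((hint _).const_mul _) ((hint _).const_mul _),
      ← intervalIntegral.integral_add (((hint _).const_mul _).add ((hint _).const_mul _)) (hint _)]
    refine intervalIntegral.integral_congr fun y _ => ?_
    simp only [curvFt, remFt]
    push_cast
    ring
  rw [hR a ⟨le_rfl, hab⟩]
  linear_combination -hs x ⟨hx.1.le, hx.2⟩ - h1 - h2

/-- Powers of `ξ` are moved onto the test function and the cutoff is removed term by term; the terms
with a derivative of the cutoff tend to 0. -/
theorem tendsto_slope (h : BoundedSolution m X f Ψ B sR sL) {a b x : ℝ} (hfree : FreeOn X a b)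
    (hx : x ∈ Ioc a b) (η : 𝓢(ℝ, ℂ)) :
    (∀ n, Integrable (fun ξ => ((x - a : ℝ) : ℂ) * sR n a ξ * η ξ)) ∧
    Tendsto (fun n => ∫ ξ : ℝ, ((x - a : ℝ) : ℂ) * sR n a ξ * η ξ) atTop
      (𝓝 ((h.bddCont_fld x).timeFt η - (h.bddCont_fld a).timeFt η
        - (h.bddCont_fldPrim hx.1.le).timeFt (mulSymbol m η))) := by
  have hU := h.bddCont_fldPrim hx.1.le
  have e : ∀ n, (fun ξ => ((x - a : ℝ) : ℂ) * sR n a ξ * η ξ) = fun ξ =>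
      ft (fun t => cutoff n t * (Ψ t).fld x) ξ * η ξ - ft (fun t => cutoff n t * (Ψ t).fld a) ξ * η ξ
      - ft (fun t => cutoff n t * fldPrim Ψ a x t) ξ * mulSymbol m η ξ
      - 2 * Complex.I * (ft (fun t => dS (cutoff n) t * fldPrim Ψ a x t) ξ * mulFreq η ξ)
      - ft (fun t => dS (dS (cutoff n)) t * fldPrim Ψ a x t) ξ * η ξ := fun n => by
    ext ξ
    rw [h.taylor_slope hfree hx, mulSymbol_apply, mulFreq_apply]
    simp only [cutFt]
    ring
  have i1 := fun n => (h.bddCont_fld x).integrable_ft_mul (cutoff n) η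
  have i2 := fun n => (h.bddCont_fld a).integrable_ft_mul (cutoff n) η
  have i3 := fun n => hU.integrable_ft_mul (cutoff n) (mulSymbol m η)
  have i4 := fun n => (hU.integrable_ft_mul (dS (cutoff n)) (mulFreq η)).const_mul (2 * Complex.I)
  have i5 := fun n => hU.integrable_ft_mul (dS (dS (cutoff n))) η
  simp only [e]
  refine ⟨fun n => ((((i1 n).sub (i2 n)).sub (i3 n)).sub (i4 n)).sub (i5 n), ?_⟩
  have e2 : ∀ n, _ := fun n => integral_sub ((((i1 n).sub (i2 n)).sub (i3 n)).sub (i4 n)) (i5 n)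
  have e3 : ∀ n, _ := fun n => integral_sub (((i1 n).sub (i2 n)).sub (i3 n)) (i4 n)
  have e4 : ∀ n, _ := fun n => integral_sub ((i1 n).sub (i2 n)) (i3 n)
  have e5 : ∀ n, _ := fun n => integral_sub (i1 n) (i2 n)
  simp only [Pi.sub_apply] at e2 e3 e4 e5
  simp only [e2, e3, e4, e5, integral_const_mul]
  obtain ⟨M1, hM1, hlim1⟩ := exists_dS_cutoff
  obtain ⟨M2, hM2, hlim2⟩ := exists_dS_dS_cutoff
  have t1 := (h.bddCont_fld x).tendsto_integral_ft norm_cutoff_le tendsto_cutoff η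
  have t2 := (h.bddCont_fld a).tendsto_integral_ft norm_cutoff_le tendsto_cutoff η
  have t3 := hU.tendsto_integral_ft norm_cutoff_le tendsto_cutoff (mulSymbol m η)
  have t4 := (hU.tendsto_integral_ft hM1 hlim1 (mulFreq η)).const_mul (2 * Complex.I)
  have t5 := hU.tendsto_integral_ft hM2 hlim2 η
  simpa using (((t1.sub t2).sub t3).sub t4).sub t5

/-- The one-sided derivative of the Fourier transform of the field at the left end of an interval
without oscillators. -/
theorem exists_rightDeriv (h : BoundedSolution m X f Ψ B sR sL) {a b : ℝ} (hab : a < b)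
    (hfree : FreeOn X a b) :
    ∃ Θ : 𝓢'(ℝ, ℂ), HasRightDeriv (fun x => (h.bddCont_fld x).timeFt) Θ a ∧
      ∀ η : 𝓢(ℝ, ℂ), (∀ n, Integrable (fun ξ => sR n a ξ * η ξ)) ∧
        Tendsto (fun n => ∫ ξ : ℝ, sR n a ξ * η ξ) atTop (𝓝 (Θ η)) := by
  -- The limit of the slopes, solved from Taylor's formula at the far end `b`.
  set Θ : 𝓢'(ℝ, ℂ) := (((b - a : ℝ) : ℂ)⁻¹) • ((h.bddCont_fld b).timeFt - (h.bddCont_fld a).timeFt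
    - PointwiseConvergenceCLM.precomp ℂ (mulSymbol m) (h.bddCont_fldPrim hab.le).timeFt) with hΘ
  have hΘη : ∀ η, Θ η = ((b - a : ℝ) : ℂ)⁻¹ * ((h.bddCont_fld b).timeFt η -
    (h.bddCont_fld a).timeFt η - (h.bddCont_fldPrim hab.le).timeFt (mulSymbol m η)) := fun η => rfl
  have hmain : ∀ η : 𝓢(ℝ, ℂ), (∀ n, Integrable (fun ξ => sR n a ξ * η ξ)) ∧
        Tendsto (fun n => ∫ ξ : ℝ, sR n a ξ * η ξ) atTop (𝓝 (Θ η)) := by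
    intro η
    obtain ⟨h1, h2⟩ := h.tendsto_slope hfree ⟨hab, le_rfl⟩ η
    have hne : ((b - a : ℝ) : ℂ) ≠ 0 := Complex.ofReal_ne_zero.2 (sub_pos.2 hab).ne'
    have e : ∀ n, (fun ξ => sR n a ξ * η ξ) =
        fun ξ => ((b - a : ℝ) : ℂ)⁻¹ * (((b - a : ℝ) : ℂ) * sR n a ξ * η ξ) := fun n => by
      ext ξ; field_simp
    simp only [e, integral_const_mul, hΘη]
    exact ⟨fun n => (h1 n).const_mul _, h2.const_mul _⟩
  refine ⟨Θ, fun η => ?_, hmain⟩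
  -- The same slopes enter Taylor's formula at every `x` of the interval, so `Θ` satisfies it there
  -- as well; the remainder is quadratic in `x - a` by `norm_fldPrim_le`.
  have hT : ∀ x, ∀ hx : x ∈ Ioc a b, (h.bddCont_fld x).timeFt η - (h.bddCont_fld a).timeFt η
      - ((x - a : ℝ) : ℂ) * Θ η = (h.bddCont_fldPrim hx.1.le).timeFt (mulSymbol m η) := by
    intro x hx
    have h1 := (h.tendsto_slope hfree hx η).2
    have h2 := ((hmain η).2).const_mul ((x - a : ℝ) : ℂ)
    simp only [← integral_const_mul, ← mul_assoc] at h2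
    linear_combination -(tendsto_nhds_unique h2 h1)
  rw [hasDerivWithinAt_iff_isLittleO]
  set K := fldBound m B * ∫ t, ‖ftS (mulSymbol m η) t‖
  have hO : (fun x => (h.bddCont_fld x).timeFt η - (h.bddCont_fld a).timeFt η - (x - a) • Θ η)
      =O[𝓝[>] a] fun x => (x - a) ^ 2 := by
    refine Asymptotics.IsBigO.of_bound K ?_
    filter_upwards [Ioc_mem_nhdsGT hab] with x hx
    have h1 := (h.bddCont_fldPrim hx.1.le).norm_timeFt_le (h.norm_fldPrim_le hx.1.le) (mulSymbol m η)
    rw [Complex.real_smul, hT x hx, Real.norm_of_nonneg (sq_nonneg _)]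
    calc _ ≤ _ := h1
      _ = _ := by simp only [K]; ring
  refine hO.trans_isLittleO ?_
  have h3 : (fun x : ℝ => (x - a) ^ 2) =o[𝓝 a] fun x => x - a := by
    simpa using Asymptotics.isLittleO_pow_sub_sub a one_lt_two
  exact h3.mono nhdsWithin_le_nhds

end BoundedSolution

end Taylor

/-! ### Spectral bounds for the difference of two solutions -/

section Difference

theorem HasRightDeriv.sub {S T : ℝ → 𝓢'(ℝ, ℂ)} {D E : 𝓢'(ℝ, ℂ)} {a : ℝ} (hS : HasRightDeriv S D a)
    (hT : HasRightDeriv T E a) : HasRightDeriv (fun x => S x - T x) (D - E) a :=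
  fun η => (hS η).sub (hT η)

theorem EvBdd.sub {g g' : ℕ → ℝ → ℂ} {a : ℝ} (hg : ∀ n, Measurable (g n))
    (h : EvBdd (fun n ξ => ‖g n ξ‖ₑ ^ 2) a) (h' : EvBdd (fun n ξ => ‖g' n ξ‖ₑ ^ 2) a) :
    EvBdd (fun n ξ => ‖g n ξ - g' n ξ‖ₑ ^ 2) a :=
  ((h.const_mul 2).add (h'.const_mul 2)
    fun n => ((hg n).enorm.pow_const 2).const_mul _).mono le_rfl fun n ξ _ =>
      enorm_sub_sq_le (g n ξ) (g' n ξ)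

variable {N : ℕ} {m : ℝ} {X : Fin N → ℝ} {f f' : Fin N → ℝ → ℂ} {Ψ Ψ' : ℝ → EnergyState}
  {B B' : ℝ≥0} {sR sL sR' sL' s s' : ℕ → ℝ → ℝ → ℂ} {p : Fin N → ℕ}

namespace BoundedSolution

theorem measurable_slope (h : BoundedSolution m X f Ψ B sR sL) (x : ℝ) (n : ℕ) :
    Measurable (sR n x) :=
  (measurable_slopeR h.mass_pos h.solves (h.bound _) (h.slopes n)).comp measurable_prodMk_left

theorem measurable_cutFt (h : BoundedSolution m X f Ψ B sR sL) (x : ℝ) (n : ℕ) :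
    Measurable (cutFt Ψ (cutoff n) x) :=
  ((continuous_cutFt h.mass_pos h.solves.continuousInEnergy (h.bound (cutoff n))).comp
      (Continuous.prodMk_right x)).measurable

/-- The Fourier transform of the difference of two fields. -/
def diffFt (h : BoundedSolution m X f Ψ B sR sL) (h' : BoundedSolution m X f' Ψ' B' sR' sL')
    (x : ℝ) : 𝓢'(ℝ, ℂ) :=
  (h.bddCont_fld x).timeFt - (h'.bddCont_fld x).timeFt

theorem isTimeFourier_diffFt (h : BoundedSolution m X f Ψ B sR sL)
    (h' : BoundedSolution m X f' Ψ' B' sR' sL') (x : ℝ) :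
    IsTimeFourier (fun t => (Ψ t).fld x - (Ψ' t).fld x) (h.diffFt h' x) :=
  (h.bddCont_fld x).isTimeFourier.sub (h'.bddCont_fld x).isTimeFourier

theorem diffFt_absContAboveWithBound (h : BoundedSolution m X f Ψ B sR sL)
    (h' : BoundedSolution m X f' Ψ' B' sR' sL') {a x : ℝ} (ha : m ≤ a)
    (hE : EvBdd (rightEnergy m Ψ s x) a) (hE' : EvBdd (rightEnergy m Ψ' s' x) a) :
    AbsContAboveWithBound (h.diffFt h' x) a (fun ξ => ξ ^ 2) := by
  have h1 := evBdd_of_sideEnergy h.mass_pos ha hE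
  have h2 := evBdd_of_sideEnergy h.mass_pos ha hE'
  refine EvBdd.absContAboveWithBound_sq
    (g := fun n ξ => cutFt Ψ (cutoff n) x ξ - cutFt Ψ' (cutoff n) x ξ)
    (fun n => (h.measurable_cutFt x n).sub (h'.measurable_cutFt x n)) (h.mass_pos.le.trans ha) ?_
    fun η _ => ?_
  · simp only [mul_sub]
    exact EvBdd.sub (fun n => Complex.measurable_ofReal.mul (h.measurable_cutFt x n)) h1 h2
  · have t1 := (h.bddCont_fld x).tendsto_integral_ft norm_cutoff_le tendsto_cutoff η
    have t2 := (h'.bddCont_fld x).tendsto_integral_ft norm_cutoff_le tendsto_cutoff η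
    rw [one_mul] at t1 t2
    refine (t1.sub t2).congr fun n => ?_
    rw [← integral_sub ((h.bddCont_fld x).integrable_ft_mul (cutoff n) η)
      ((h'.bddCont_fld x).integrable_ft_mul (cutoff n) η)]
    simp only [cutFt, sub_mul]

theorem exists_slope_diffFt (h : BoundedSolution m X f Ψ B sR sL)
    (h' : BoundedSolution m X f' Ψ' B' sR' sL') {x y : ℝ} (hxy : x < y) (hfree : FreeOn X x y) :
    ∃ Θ : 𝓢'(ℝ, ℂ), HasRightDeriv (h.diffFt h') Θ x ∧
      ∀ a, EvBdd (rightEnergy m Ψ sR x) a → EvBdd (rightEnergy m Ψ' sR' x) a →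
        AbsContAboveWithBound Θ a (fun _ => 1) := by
  obtain ⟨Θ, hΘ, hlim⟩ := h.exists_rightDeriv hxy hfree
  obtain ⟨Θ', hΘ', hlim'⟩ := h'.exists_rightDeriv hxy hfree
  refine ⟨Θ - Θ', hΘ.sub hΘ', fun a hE hE' => ?_⟩
  have h1 : EvBdd (fun n ξ => ‖sR n x ξ‖ₑ ^ 2) a := hE.mono le_rfl fun n ξ _ => le_self_add
  have h2 : EvBdd (fun n ξ => ‖sR' n x ξ‖ₑ ^ 2) a := hE'.mono le_rfl fun n ξ _ => le_self_add
  refine EvBdd.absContAboveWithBound (g := fun n ξ => sR n x ξ - sR' n x ξ)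
    (fun n => (h.measurable_slope x n).sub (h'.measurable_slope x n))
    (EvBdd.sub (h.measurable_slope x) h1 h2) fun η _ => ?_
  refine ((hlim η).2.sub (hlim' η).2).congr fun n => ?_
  rw [← integral_sub ((hlim η).1 n) ((hlim' η).1 n)]
  simp only [sub_mul]

/-- The spectral bounds for the difference of two solutions with polynomial forces. -/
theorem absolute_continuity (h : BoundedSolution m X f Ψ B sR sL)
    (h' : BoundedSolution m X f' Ψ' B' sR' sL') (hX : StrictMono X) (hp : ∀ J, 1 ≤ p J)
    (hr : ForceResponse X f Ψ p) (hr' : ForceResponse X f' Ψ' p) :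
    ∃ Θ : Fin N → 𝓢'(ℝ, ℂ),
      (∀ J : Fin N, (J : ℕ) + 1 < N → HasRightDeriv (h.diffFt h') (Θ J) (X J)) ∧
      (∀ J : Fin N, AbsContAboveWithBound (h.diffFt h' (X J)) (muLeft m p J) (fun ν => ν ^ 2)) ∧
      (∀ J : Fin N, (J : ℕ) + 1 < N → AbsContAboveWithBound (Θ J)
        ((2 * (p J : ℝ) - 1) * muLeft m p J) (fun _ => 1)) ∧
      (∀ J : Fin N, AbsContAbove (h.diffFt h' (X J)) (muMin m p J)) ∧
      (∀ J : Fin N, (J : ℕ) + 1 < N → AbsContAbove (Θ J)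
        ((2 * (p J : ℝ) - 1) * muMin m p J)) := by
  have hΘ : ∀ J : Fin N, ∃ Θ : 𝓢'(ℝ, ℂ), (J : ℕ) + 1 < N →
      HasRightDeriv (h.diffFt h') Θ (X J) ∧
      ∀ a, EvBdd (rightEnergy m Ψ sR (X J)) a → EvBdd (rightEnergy m Ψ' sR' (X J)) a →
        AbsContAboveWithBound Θ a (fun _ => 1) := by
    intro J
    by_cases hJ : (J : ℕ) + 1 < N
    · obtain ⟨Θ, hΘ⟩ := h.exists_slope_diffFt h'
        (hX (Fin.lt_def.2 (Nat.lt_succ_self J) : J < ⟨J + 1, hJ⟩)) (freeOn_consecutive hX rfl)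
      exact ⟨Θ, fun _ => hΘ⟩
    · exact ⟨0, fun h => absurd h hJ⟩
  choose Θ hΘ using hΘ
  have hL : ∀ J, AbsContAboveWithBound (h.diffFt h' (X J)) (muLeft m p J) (fun ν => ν ^ 2) :=
    fun J => h.diffFt_absContAboveWithBound h' (le_muLeft h.mass_pos hp J)
      (h.evBdd_left hX hp hr _ J rfl) (h'.evBdd_left hX hp hr' _ J rfl)
  have hΘL : ∀ J : Fin N, (J : ℕ) + 1 < N → AbsContAboveWithBound (Θ J)
      ((2 * (p J : ℝ) - 1) * muLeft m p J) (fun _ => 1) := fun J hJ =>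
    (hΘ J hJ).2 _ (h.evBdd_right_of_muLeft hX hp hr J) (h'.evBdd_right_of_muLeft hX hp hr' J)
  have hR : ∀ J : Fin N, EvBdd (rightEnergy m Ψ sR (X J)) (muRight m p J) ∧
      EvBdd (rightEnergy m Ψ' sR' (X J)) (muRight m p J) := fun J =>
    ⟨h.evBdd_right hX hp hr (N - (J + 1)) J (by omega),
      h'.evBdd_right hX hp hr' (N - (J + 1)) J (by omega)⟩
  refine ⟨Θ, fun J hJ => (hΘ J hJ).1, hL, hΘL, fun J => ?_, fun J hJ => ?_⟩
  · rcases min_choice (muLeft m p J) (muRight m p J) with e | e <;> rw [muMin, e]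
    · exact (hL J).absContAbove
    · exact (h.diffFt_absContAboveWithBound h' (le_muRight h.mass_pos hp J)
        (hR J).1 (hR J).2).absContAbove
  · rcases min_choice (muLeft m p J) (muRight m p J) with e | e <;> rw [muMin, e]
    · exact (hΘL J hJ).absContAbove
    -- Coming from the right, the density on the right of `X J` is already bounded above `μ'_J`,
    -- which is below the required threshold.
    · have h1 : muRight m p J ≤ (2 * (p J : ℝ) - 1) * muRight m p J :=
        le_mul_of_one_le_left (h.mass_pos.le.trans (le_muRight h.mass_pos hp J))
          (one_le_two_mul_sub_one (hp J))
      exact ((hΘ J hJ).2 _ ((hR J).1.mono h1 fun _ _ _ => le_rfl)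
        ((hR J).2.mono h1 fun _ _ _ => le_rfl)).absContAbove

end BoundedSolution

end Difference

/-! ### Application to the coupled and the free equation -/

section Oscillators

variable {N : ℕ} {m : ℝ} {X : Fin N → ℝ} {p : Fin N → ℕ} {u : Fin N → ℕ → ℝ}
  {Ψ : ℝ → EnergyState}

theorem SolvesCoupledKG.exists_boundedSolution (hm : 0 < m) (hX : Function.Injective X)
    (hp : ∀ J, 1 ≤ p J) (hu : ∀ J, 0 < u J (p J)) (hΨ : SolvesCoupledKG m X p u Ψ) :
    ∃ B sR sL, BoundedSolution m X (fun J t => force (p J) (u J) ((Ψ t).fld (X J))) Ψ B sR sL ∧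
      BoundedSolution.ForceResponse X (fun J t => force (p J) (u J) ((Ψ t).fld (X J))) Ψ p := by
  obtain ⟨B, hB⟩ := SolvesCoupledKG.exists_energy_bound hm hX hp hu hΨ
  have hfld : ∀ J, BddCont (fun t => (Ψ t).fld (X J)) := fun J =>
    ⟨hΨ.continuousInEnergy.continuous_fld_right hm (X J), fldBound m B, fun t =>
      norm_fld_le_fldBound hm (hB t) (X J)⟩
  obtain ⟨sR, sL, h⟩ := KGOscillators.exists_boundedSolution hm hX hΨ hB
    fun J => (hfld J).force (p J) (u J)
  exact ⟨B, sR, sL, h, fun J a ha hE => EvBdd.force (hfld J) ha hE (hp J) (u J)⟩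

theorem SolvesFreeKG.exists_boundedSolution (hm : 0 < m) (hX : Function.Injective X)
    (hΨ : SolvesFreeKG m Ψ) :
    ∃ B sR sL, BoundedSolution m X (fun _ _ => 0) Ψ B sR sL ∧
      BoundedSolution.ForceResponse X (fun _ _ => 0) Ψ p := by
  obtain ⟨B, hB⟩ := SolvesFreeKG.exists_energy_bound hm hΨ
  obtain ⟨sR, sL, h⟩ := KGOscillators.exists_boundedSolution hm hX (hΨ.solvesForcedKG X) hB
    fun J => BddCont.const 0
  -- A vanishing force satisfies the response condition trivially, so the free solution obeys the
  -- same thresholds for any exponents.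
  refine ⟨B, sR, sL, h, fun J a ha hE => evBdd_of_lintegral_le (C := 0) fun n => ?_⟩
  simp [ft]

end Oscillators

end KGOscillators

end

theorem proposition5p2 {N : ℕ} (m : ℝ) (hm : 0 < m)
    (X : Fin N → ℝ) (hX : StrictMono X)
    (p : Fin N → ℕ) (u : Fin N → ℕ → ℝ)
    (hp : ∀ J, 2 ≤ p J) (hu : ∀ J, 0 < u J (p J))
    (Ψ Chi : ℝ → KGOscillators.EnergyState)
    (hΨ : KGOscillators.SolvesCoupledKG m X p u Ψ)
    (hChi : KGOscillators.SolvesFreeKG m Chi) (hdata : (Chi 0).SameAs (Ψ 0)) :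
    ∃ φhat : ℝ → 𝓢'(ℝ, ℂ),
      (∀ x : ℝ, KGOscillators.IsTimeFourier (fun t : ℝ => (Ψ t).fld x - (Chi t).fld x) (φhat x)) ∧
      ∃ Θ : Fin N → 𝓢'(ℝ, ℂ),
        (∀ J : Fin N, (J : ℕ) + 1 < N → KGOscillators.HasRightDeriv φhat (Θ J) (X J)) ∧
        -- absolute continuity and weighted bounds with the thresholds of the left-to-right induction
        (∀ J : Fin N, KGOscillators.AbsContAboveWithBound (φhat (X J))
          (KGOscillators.muLeft m p J) (fun ν => ν ^ 2)) ∧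
        (∀ J : Fin N, (J : ℕ) + 1 < N → KGOscillators.AbsContAboveWithBound (Θ J)
          ((2 * (p J : ℝ) - 1) * KGOscillators.muLeft m p J) (fun _ => 1)) ∧
        -- absolute continuity with the two-sided thresholds
        (∀ J : Fin N, KGOscillators.AbsContAbove (φhat (X J)) (KGOscillators.muMin m p J)) ∧
        (∀ J : Fin N, (J : ℕ) + 1 < N → KGOscillators.AbsContAbove (Θ J)
          ((2 * (p J : ℝ) - 1) * KGOscillators.muMin m p J)) := by
  obtain ⟨B, sR, sL, h, hr⟩ := KGOscillators.SolvesCoupledKG.exists_boundedSolution hm hX.injective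
    (fun J => one_le_two.trans (hp J)) hu hΨ
  obtain ⟨B', sR', sL', h', hr'⟩ :=
    KGOscillators.SolvesFreeKG.exists_boundedSolution (p := p) hm hX.injective hChi
  exact ⟨h.diffFt h', h.isTimeFourier_diffFt h',
    h.absolute_continuity h' hX (fun J => one_le_two.trans (hp J)) hr hr'⟩
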